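/- Let $\beta$ be a finite signed Borel measure on $\mathbb R$ (for instance $\beta(x)\,dx$ with $\beta\in L^1(\mathbb R)$) with $$\int_{\mathbb R}d\beta=1,\qquad \int_{\mathbb R}x^2\,d|\beta|<\infty,$$ whose Fourier transform $\widehat\beta(\xi)=\int e^{-i\xi x}\,d\beta(x)$ is real and satisfies $0\le\widehat\beta(\xi)\le C_\beta$ for all $\xi\in\mathbb R$ and some constant $C_\beta$. For $\delta>0$ let $K_\delta$ be the Fourier multiplier with symbol $\widehat\beta(\delta\xi)^{1/2}$ (this is $\widehat{\beta_\delta}(\xi)^{1/2}$ for $\beta_\delta(x)=\delta^{-1}\beta(x/\delta)$). Let $H^r=H^r(\mathbb R)$ be the $L^2$-based Sobolev space with $\|f\|_{H^r}^2=\int(1+\xi^2)^r|\widehat f(\xi)|^2d\xi$; all functions below are real-valued. Let $n\ge1$ be an integer, $s>5/2$, $0<\theta\le2$, and $u_0,v_0\in H^{s+\theta}$. For $\epsilon,\delta,T>0$ consider pairs $(u^\delta,v^\delta)$ and $(u,v)$ whose components lie in $$C\big([0,T/\epsilon^n],H^{s+\theta}\big)\cap C^1\big([0,T/\epsilon^n],H^{s+\theta-1}\big)$$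 and which satisfy on $[0,T/\epsilon^n]$ respectively the nonlocal system $$u^\delta_t=K_\delta v^\delta_x,\qquad v^\delta_t=K_\delta\big(u^\delta+\epsilon^n(u^\delta)^{n+1}\big)_x$$ and the classical elasticity system $$u_t=v_x,\qquad v_t=\big(1+(n+1)\epsilon^nu^n\big)u_x,$$ with the same initial data $u^\delta(0)=u(0)=u_0$ and $v^\delta(0)=v(0)=v_0$. Consider the estimate $$\|u^\delta(t)-u(t)\|_{H^{s-1}}+\|v^\delta(t)-v(t)\|_{H^{s-1}}\le C\,\delta^\theta\,t\,e^{C\epsilon^nt}\qquad\text{for all }t\in[0,T/\epsilon^n].\tag{$*$}$$ (a) There are $T_0>0$, $\epsilon_0>0$ and $C>0$, depending only on $\beta,n,s,\theta,u_0,v_0$, such that $(*)$ holds for all $0<T\le T_0$, all $0<\epsilon\le\epsilon_0$, all $\delta>0$ and all such solutions $(u^\delta,v^\delta)$ and $(u,v)$. (b) For all $T>0$ and $M>0$ there are $\epsilon_0>0$ and $C>0$, depending only on $T$, $M$, $\beta,n,s,\theta,u_0,v_0$, such that $(*)$ holds for all $0<\epsilon\le\epsilon_0$, all $\delta>0$ and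 all such solutions for which $\|u^\delta(t)\|_{H^{s+\theta}}$, $\|v^\delta(t)\|_{H^{s+\theta}}$, $\|u(t)\|_{H^{s+\theta}}$ and $\|v(t)\|_{H^{s+\theta}}$ are at most $M$ for all $t\in[0,T/\epsilon^n]$. In particular $C$ does not depend on $\delta$ or $\epsilon$. -/

import Mathlib

open MeasureTheory Filter Topology Set
open scoped FourierTransform SchwartzMap ENNReal

noncomputable section

namespace NonlocalElasticity

/-! ### Kernels

A kernel is a finite signed Borel measure on `ℝ`; an integrable function `b` is the special case of
the measure with density `b`. -/

/-- The Fourier transform `β̂(ξ) = ∫ exp (-i ξ x) dβ(x)` of a finite signed measure. -/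
def kernelHat (β : SignedMeasure ℝ) (ξ : ℝ) : ℂ :=
  ∫ᵛ x, Complex.exp (-(Complex.I * ξ * x)) ∂<•β

/-- The standing assumptions on the kernel: the Fourier transform is real with `0 ≤ β̂ ≤ C`, the
total mass is `1`, and the second moment of `|β|` is finite. -/
structure IsAdmissibleKernel (β : SignedMeasure ℝ) : Prop where
  hat_real : ∀ ξ, (kernelHat β ξ).im = 0
  hat_nonneg : ∀ ξ, 0 ≤ (kernelHat β ξ).re
  hat_bdd : ∃ C : ℝ, ∀ ξ, (kernelHat β ξ).re ≤ C
  mass_one : β univ = 1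
  second_moment : Integrable (fun x : ℝ => x ^ 2) β.variation

/-- The symbol `k(ξ) = β̂(ξ)^{1/2}`. -/
def kernelSymbol (β : SignedMeasure ℝ) (ξ : ℝ) : ℝ :=
  Real.sqrt (kernelHat β ξ).re

/-! ### Sobolev spaces `H^s(ℝ)`, `s ≥ 0`, as subspaces of the real space `L²(ℝ)` -/

/-- The real space `L²(ℝ)`. -/
abbrev L2 : Type := Lp ℝ 2 (volume : Measure ℝ)

/-- A real `L²` function regarded as a complex one. -/
def toComplex (f : L2) : Lp ℂ 2 (volume : Measure ℝ) :=
  Complex.ofRealCLM.compLp f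

/-- The `L²` Fourier transform in the normalization `û(ξ) = ∫ u(x) exp (-i x ξ) dx`
(Mathlib's `𝓕` has `exp (-2π i x ξ)`). It is determined up to null sets. -/
def hat (f : L2) (ξ : ℝ) : ℂ :=
  (𝓕 (toComplex f) : Lp ℂ 2 (volume : Measure ℝ)) (ξ / (2 * Real.pi))

/-- The norm `‖f‖_{H^s} = (∫ (1 + ξ²)^s |f̂(ξ)|² dξ)^{1/2}`, with value `∞` when `f ∉ H^s`. -/
def eSobolevNorm (s : ℝ) (f : L2) : ℝ≥0∞ :=
  (∫⁻ ξ : ℝ, ENNReal.ofReal ((1 + ξ ^ 2) ^ s) * ‖hat f ξ‖ₑ ^ 2) ^ (1 / 2 : ℝ)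

/-- Membership in `H^s`. -/
def MemH (s : ℝ) (f : L2) : Prop := eSobolevNorm s f < ∞

/-- `g = D_x f` in the sense of (tempered) distributions. -/
def IsWeakDeriv (f g : L2) : Prop :=
  TemperedDistribution.derivCLM ℂ (toComplex f : 𝓢'(ℝ, ℂ)) = (toComplex g : 𝓢'(ℝ, ℂ))

/-- `g = K_δ f`, where `K_δ` is the Fourier multiplier with symbol `k(δ ξ) = β̂(δ ξ)^{1/2}`. -/
def IsKApply (β : SignedMeasure ℝ) (δ : ℝ) (f g : L2) : Prop :=
  ∀ᵐ ξ : ℝ, hat g ξ = (kernelSymbol β (δ * ξ) : ℂ) * hat f ξ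

/-! ### Curves with values in Sobolev spaces (only their values on `[0, τ]` matter) -/

/-- `u ∈ C([0, τ], H^σ)`. -/
structure ContInH (σ τ : ℝ) (u : ℝ → L2) : Prop where
  mem : ∀ t ∈ Icc 0 τ, MemH σ (u t)
  cont : ∀ t ∈ Icc 0 τ,
    Tendsto (fun r => eSobolevNorm σ (u r - u t)) (𝓝[Icc 0 τ] t) (𝓝 0)

/-- `u'` is the derivative of `u` on `[0, τ]` (one-sided at the end points), as a limit of
difference quotients in the norm of `H^σ`. -/
def HasDerivInH (σ τ : ℝ) (u u' : ℝ → L2) : Prop :=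
  ∀ t ∈ Icc 0 τ, Tendsto (fun r => eSobolevNorm σ ((r - t)⁻¹ • (u r - u t) - u' t))
    (𝓝[Icc 0 τ \ {t}] t) (𝓝 0)

/-- `u ∈ C([0, τ], H^σ) ∩ C¹([0, τ], H^{σ-1})` with time derivative `u'`. -/
structure IsRegularCurve (σ τ : ℝ) (u u' : ℝ → L2) : Prop where
  cont : ContInH σ τ u
  cont_deriv : ContInH (σ - 1) τ u'
  hasDeriv : HasDerivInH (σ - 1) τ u u'

/-! ### The two Cauchy problems -/

/-- `u, v ∈ C([0, τ], H^σ) ∩ C¹([0, τ], H^{σ-1})` solve the nonlocal system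
`u_t = K_δ v_x`, `v_t = K_δ (u + εⁿ u^{n+1})_x` on `[0, τ]` with initial data `u₀, v₀`. -/
def IsNonlocalSolution (β : SignedMeasure ℝ) (n : ℕ) (ε δ σ τ : ℝ) (u₀ v₀ : L2)
    (u v : ℝ → L2) : Prop :=
  u 0 = u₀ ∧ v 0 = v₀ ∧
  ∃ u' v' : ℝ → L2, IsRegularCurve σ τ u u' ∧ IsRegularCurve σ τ v v' ∧
    ∀ t ∈ Icc 0 τ,
      (∃ vx : L2, IsWeakDeriv (v t) vx ∧ IsKApply β δ vx (u' t)) ∧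
      (∃ w wx : L2, (∀ᵐ x : ℝ, w x = u t x + ε ^ n * u t x ^ (n + 1)) ∧
        IsWeakDeriv w wx ∧ IsKApply β δ wx (v' t))

/-- `u, v ∈ C([0, τ], H^σ) ∩ C¹([0, τ], H^{σ-1})` solve the classical elasticity system
`u_t = v_x`, `v_t = (1 + (n+1) εⁿ uⁿ) u_x` on `[0, τ]` with initial data `u₀, v₀`. -/
def IsClassicalSolution (n : ℕ) (ε σ τ : ℝ) (u₀ v₀ : L2) (u v : ℝ → L2) : Prop :=
  u 0 = u₀ ∧ v 0 = v₀ ∧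
  ∃ u' v' : ℝ → L2, IsRegularCurve σ τ u u' ∧ IsRegularCurve σ τ v v' ∧
    ∀ t ∈ Icc 0 τ,
      IsWeakDeriv (v t) (u' t) ∧
      (∃ ux : L2, IsWeakDeriv (u t) ux ∧
        ∀ᵐ x : ℝ, v' t x = (1 + (n + 1) * ε ^ n * u t x ^ n) * ux x)

/-- The error bound
`‖uδ(t) - u(t)‖_{H^σ} + ‖vδ(t) - v(t)‖_{H^σ} ≤ C δ^θ t exp (C εⁿ t)` for all `t ∈ [0, τ]`. -/
def ErrorBound (n : ℕ) (ε δ θ σ τ C : ℝ) (uδ vδ u v : ℝ → L2) : Prop :=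
  ∀ t ∈ Icc 0 τ, eSobolevNorm σ (uδ t - u t) + eSobolevNorm σ (vδ t - v t) ≤
    ENNReal.ofReal (C * δ ^ θ * t * Real.exp (C * ε ^ n * t))

/-- `‖u(t)‖_{H^σ} ≤ M` for all `t ∈ [0, τ]`. -/
def BoundedInH (σ τ M : ℝ) (u : ℝ → L2) : Prop :=
  ∀ t ∈ Icc 0 τ, eSobolevNorm σ (u t) ≤ ENNReal.ofReal M

end NonlocalElasticity

end

open NonlocalElasticity

open scoped NNReal BoundedContinuousFunction LineDeriv

namespace NonlocalElasticity

/-! ### The symbol of the kernel -/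

/-! Both systems have the form `u_t = K v_x`, `v_t = K (u + εⁿ u^{n+1})_x`, with `K = K_δ` or `K =
1` (`Sol`). Two facts about the symbol `k` carry the analysis: a sup bound independent of `δ`, and
`|k(δξ) - 1| ≤ C δ^θ |ξ|^θ`. The second holds because unit mass and a finite second moment give `Re
β̂(ξ) - 1 = O(ξ²)`.

Let `p, q` be the differences of the nonlocal and the classical solution, and let `w` be the divided
difference with `(u^δ)^{n+1} - u^{n+1} = w p`. Then `p_t = K q_x + (K - 1) v_x` and `q_t = K (p + εⁿ
w p)_x + (K - 1)(u + εⁿ u^{n+1})_x`. The forcing is `O(δ^θ)` in `H^{s-1}` because `K - 1` followed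
by a derivative costs `θ + 1` derivatives and the solutions lie in `H^{s+θ}`. With `m = ⟨D⟩^{s-1}`
the energy is `E = ‖mp‖² + ‖mq‖² + εⁿ ⟨w mp, mp⟩`, comparable to the first two terms once `εⁿ` is
small.

In `E'` the terms of order one cancel since `K∂` is skew-adjoint. The terms of order `εⁿ` that would
lose a derivative combine into `⟨mq, K (m(w p_x) - ∂(w mp))⟩`. This is a commutator in which `K`
stands outside and matters only through its sup bound (`exists_commutator_estimate`). What remains
gives `E' ≤ 2αεⁿ E + 2κ √E` with `κ` of size `δ^θ`. As `E(0) = 0`, it follows that `√E ≤ κ t exp(αεⁿ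
t)` (`exists_difference_bound`), which proves (b).

For (a) the bounds assumed in (b) must be derived (`exists_uniform_bound`). The same energy is used
for a single solution at order `s + θ`, with `w = (n+1) uⁿ`. Time derivatives lie only in
`H^{s+θ-1}`, so the weight is damped by `1/⟨2πηξ⟩`. The commutator bound is uniform in `η`, one lets
`η → 0`, and a continuity argument closes the estimate for `εⁿ t` small. -/

lemma isFiniteMeasure_variation (β : SignedMeasure ℝ) : IsFiniteMeasure β.variation := by
  rw [← SignedMeasure.totalVariation_eq_variation]
  infer_instance

lemma opNorm_lsmul_flip_le :
    ‖(ContinuousLinearMap.lsmul ℝ ℝ (E := ℂ)).flip‖ ≤ 1 := by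
  rw [ContinuousLinearMap.opNorm_flip]
  exact ContinuousLinearMap.opNorm_lsmul_le

section
variable {β : SignedMeasure ℝ}

lemma integrable_exp_kernel (β : SignedMeasure ℝ) (ξ : ℝ) :
    Integrable (fun x : ℝ => Complex.exp (-(Complex.I * ξ * x))) β.variation := by
  have := isFiniteMeasure_variation β
  refine Integrable.of_bound (C := 1) (by fun_prop) (ae_of_all _ fun x => ?_)
  rw [show -(Complex.I * ξ * x) = ((-(ξ * x) : ℝ) : ℂ) * Complex.I by push_cast; ring,
    Complex.norm_exp_ofReal_mul_I]

lemma norm_integral_signedMeasure_le (f : ℝ → ℂ) :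
    ‖VectorMeasure.integral β f (ContinuousLinearMap.lsmul ℝ ℝ).flip‖ ≤
      ∫ x, ‖f x‖ ∂β.variation := by
  refine VectorMeasure.norm_integral_le_integral_norm.trans ?_
  have h0 : 0 ≤ ∫ x, ‖f x‖ ∂β.variation := integral_nonneg fun _ => norm_nonneg _
  exact (mul_le_mul_of_nonneg_right opNorm_lsmul_flip_le h0).trans (one_mul _).le

lemma integrable_abs_of_sq (h2 : Integrable (fun x : ℝ => x ^ 2) β.variation) :
    Integrable (fun x : ℝ => |x|) β.variation := by
  have := isFiniteMeasure_variation β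
  refine Integrable.mono' (h2.add (integrable_const 1)) (by fun_prop) (ae_of_all _ fun x => ?_)
  simp only [Real.norm_eq_abs, abs_abs, Pi.add_apply]
  nlinarith [sq_abs x, sq_nonneg (|x| - 1), abs_nonneg x]

/-- The finite first moment makes the transform Lipschitz. Continuity serves only to make the symbol
measurable. -/
lemma continuous_kernelHat (h2 : Integrable (fun x : ℝ => x ^ 2) β.variation) :
    Continuous (kernelHat β) := by
  have h1 := integrable_abs_of_sq h2
  refine LipschitzWith.continuous (K := Real.toNNReal (∫ x, |x| ∂β.variation))
    (LipschitzWith.of_dist_le_mul fun ξ η => ?_)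
  rw [dist_eq_norm, kernelHat, kernelHat, ← VectorMeasure.integral_sub
    (integrable_exp_kernel β ξ) (integrable_exp_kernel β η),
    Real.coe_toNNReal _ (integral_nonneg fun _ => abs_nonneg _), ← integral_mul_const]
  refine (norm_integral_signedMeasure_le _).trans (integral_mono_of_nonneg
    (ae_of_all _ fun _ => norm_nonneg _) (h1.mul_const _) (ae_of_all _ fun x => ?_))
  have e : Complex.exp (-(Complex.I * ξ * x)) - Complex.exp (-(Complex.I * η * x)) =
      Complex.exp (-(Complex.I * η * x)) *
        (Complex.exp (Complex.I * ((-((ξ - η) * x) : ℝ) : ℂ)) - 1) := by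
    rw [mul_sub, ← Complex.exp_add, mul_one]
    push_cast
    ring_nf
  have e2 : ‖Complex.exp (-(Complex.I * η * x))‖ = 1 := by
    rw [show -(Complex.I * η * x) = ((-(η * x) : ℝ) : ℂ) * Complex.I by push_cast; ring,
      Complex.norm_exp_ofReal_mul_I]
  simp only [Pi.sub_apply]
  rw [e, norm_mul, e2, one_mul]
  refine (Real.norm_exp_I_mul_ofReal_sub_one_le).trans ?_
  rw [Real.norm_eq_abs, abs_neg, abs_mul, Real.dist_eq, mul_comm]

/-- Taking real parts turns the exponential into `cos (ξ x)`, which differs from 1 at second order,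
so the first moment drops out without any assumption that it vanishes. -/
lemma abs_kernelHat_re_sub_one_le (h1 : β univ = 1)
    (h2 : Integrable (fun x : ℝ => x ^ 2) β.variation) (ξ : ℝ) :
    |(kernelHat β ξ).re - 1| ≤ (∫ x, x ^ 2 ∂β.variation) * ξ ^ 2 := by
  have hfin := isFiniteMeasure_variation β
  set C : ℂ →L[ℝ] ℂ := Complex.ofRealCLM ∘L Complex.reCLM with hC
  have hre : ((kernelHat β ξ).re : ℂ) = VectorMeasure.integral β
      (fun x : ℝ => C (Complex.exp (-(Complex.I * ξ * x)))) (ContinuousLinearMap.lsmul ℝ ℝ).flip := by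
    rw [VectorMeasure.integral_continuousLinearMap_comp (integrable_exp_kernel β ξ)]
    change C (kernelHat β ξ) = _
    rw [kernelHat, VectorMeasure.continuousLinearMap_apply_integral (integrable_exp_kernel β ξ)]
    congr 1
    ext z
    all_goals simp [hC]
  have hone : (1 : ℂ) = VectorMeasure.integral β (fun _ : ℝ => (1 : ℂ))
      (ContinuousLinearMap.lsmul ℝ ℝ).flip := by
    rw [VectorMeasure.integral_const, h1]
    simp
  have hsub : (((kernelHat β ξ).re - 1 : ℝ) : ℂ) = VectorMeasure.integral β
      (fun x : ℝ => C (Complex.exp (-(Complex.I * ξ * x))) - 1)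
        (ContinuousLinearMap.lsmul ℝ ℝ).flip := by
    have hi : Integrable (fun x : ℝ => C (Complex.exp (-(Complex.I * ξ * x)))) β.variation :=
      C.integrable_comp (integrable_exp_kernel β ξ)
    rw [VectorMeasure.integral_fun_sub hi (integrable_const (1 : ℂ)), ← hre, ← hone]
    push_cast
    ring
  rw [← Real.norm_eq_abs, ← Complex.norm_real, hsub, ← integral_mul_const]
  refine (norm_integral_signedMeasure_le _).trans (integral_mono_of_nonneg
    (ae_of_all _ fun _ => norm_nonneg _) (h2.mul_const _) (ae_of_all _ fun x => ?_))
  have e : C (Complex.exp (-(Complex.I * ξ * x))) = (Real.cos (ξ * x) : ℂ) := by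
    rw [show -(Complex.I * ξ * x) = ((-(ξ * x) : ℝ) : ℂ) * Complex.I by push_cast; ring, hC,
      ContinuousLinearMap.comp_apply, Complex.reCLM_apply, Complex.exp_ofReal_mul_I_re,
      Real.cos_neg, Complex.ofRealCLM_apply]
  simp only
  rw [e, ← Complex.ofReal_one, ← Complex.ofReal_sub, Complex.norm_real, Real.norm_eq_abs, abs_le]
  have := Real.one_sub_sq_div_two_le_cos (x := ξ * x)
  have h3 := Real.cos_le_one (ξ * x)
  constructor <;> nlinarith [sq_nonneg (ξ * x)]
end

lemma kernelSymbol_nonneg (β : SignedMeasure ℝ) (ξ : ℝ) : 0 ≤ kernelSymbol β ξ :=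
  Real.sqrt_nonneg _

namespace IsAdmissibleKernel
variable {β : SignedMeasure ℝ}

lemma measurable_kernelSymbol (hβ : IsAdmissibleKernel β) : Measurable (kernelSymbol β) := by
  have := (continuous_kernelHat hβ.second_moment).measurable
  unfold kernelSymbol
  fun_prop

lemma exists_kernelSymbol_le (hβ : IsAdmissibleKernel β) :
    ∃ K : ℝ, 1 ≤ K ∧ ∀ ξ, kernelSymbol β ξ ≤ K := by
  obtain ⟨C, hC⟩ := hβ.hat_bdd
  exact ⟨max 1 (Real.sqrt C), le_max_left _ _,
    fun ξ => (Real.sqrt_le_sqrt (hC ξ)).trans (le_max_right _ _)⟩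

/-- For `|ξ| ≥ 1` boundedness of the symbol suffices; for `|ξ| ≤ 1` the quadratic bound does, since
`θ ≤ 2` gives `ξ² ≤ |ξ|^θ`. -/
lemma exists_abs_kernelSymbol_sub_one_le (hβ : IsAdmissibleKernel β) {θ : ℝ} (hθ : 0 < θ)
    (hθ' : θ ≤ 2) : ∃ C : ℝ, 0 < C ∧ ∀ ξ, |kernelSymbol β ξ - 1| ≤ C * |ξ| ^ θ := by
  obtain ⟨K, hK1, hK⟩ := hβ.exists_kernelSymbol_le
  set S := ∫ x, x ^ 2 ∂β.variation with hS
  have hS0 : 0 ≤ S := integral_nonneg fun x => sq_nonneg x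
  refine ⟨K + S, by linarith, fun ξ => ?_⟩
  rcases le_total 1 |ξ| with h | h
  · have h1 : 1 ≤ |ξ| ^ θ := Real.one_le_rpow h hθ.le
    have h2 : |kernelSymbol β ξ - 1| ≤ K := by
      rw [abs_le]
      constructor <;> linarith [hK ξ, kernelSymbol_nonneg β ξ]
    nlinarith
  · have h1 : ξ ^ 2 ≤ |ξ| ^ θ := by
      rw [← sq_abs, ← Real.rpow_natCast]
      exact Real.rpow_le_rpow_of_exponent_ge' (abs_nonneg _) h hθ.le (by simpa using hθ')
    have h2 : |kernelSymbol β ξ - 1| ≤ |(kernelHat β ξ).re - 1| := by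
      -- With `k² - 1 = (k - 1)(k + 1)` and `k + 1 ≥ 1`, passing to the square root loses nothing.
      have e : (kernelHat β ξ).re - 1 = (kernelSymbol β ξ - 1) * (kernelSymbol β ξ + 1) := by
        have := Real.mul_self_sqrt (hβ.hat_nonneg ξ)
        unfold kernelSymbol
        linarith
      rw [e, abs_mul]
      have := kernelSymbol_nonneg β ξ
      rw [abs_of_nonneg (by linarith : 0 ≤ kernelSymbol β ξ + 1)]
      nlinarith [abs_nonneg (kernelSymbol β ξ - 1)]
    have h3 := abs_kernelHat_re_sub_one_le hβ.mass_one hβ.second_moment ξ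
    calc _ ≤ S * ξ ^ 2 := h2.trans h3
      _ ≤ S * |ξ| ^ θ := by gcongr
      _ ≤ _ := by nlinarith [Real.rpow_nonneg (abs_nonneg ξ) θ]

end IsAdmissibleKernel

/-! ### Weights -/

/-- The Japanese bracket `⟨2πξ⟩`. -/
noncomputable def jb (ξ : ℝ) : ℝ := Real.sqrt (1 + (2 * Real.pi * ξ) ^ 2)

lemma one_le_jb (ξ : ℝ) : 1 ≤ jb ξ := by
  rw [jb, Real.one_le_sqrt]
  nlinarith [sq_nonneg (2 * Real.pi * ξ)]

lemma jb_pos (ξ : ℝ) : 0 < jb ξ := zero_lt_one.trans_le (one_le_jb ξ)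

@[fun_prop]
lemma continuous_jb : Continuous jb := by
  unfold jb
  fun_prop

lemma jb_sq (ξ : ℝ) : jb ξ ^ 2 = 1 + (2 * Real.pi * ξ) ^ 2 := Real.sq_sqrt (by positivity)

@[simp]
lemma jb_zero : jb 0 = 1 := by simp [jb]

lemma abs_two_pi_mul_le_jb (ξ : ℝ) : |2 * Real.pi * ξ| ≤ jb ξ :=
  Real.abs_le_sqrt (by linarith)

lemma abs_jb_sub_jb_le (ξ ζ : ℝ) : |jb ξ - jb ζ| ≤ |2 * Real.pi * (ξ - ζ)| := by
  have e : (jb ξ - jb ζ) * (jb ξ + jb ζ) =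
      (2 * Real.pi * (ξ - ζ)) * (2 * Real.pi * ξ + 2 * Real.pi * ζ) := by
    linear_combination jb_sq ξ - jb_sq ζ
  have h1 : 0 < jb ξ + jb ζ := add_pos (jb_pos _) (jb_pos _)
  have h2 : |2 * Real.pi * ξ + 2 * Real.pi * ζ| ≤ jb ξ + jb ζ :=
    (abs_add_le _ _).trans (add_le_add (abs_two_pi_mul_le_jb _) (abs_two_pi_mul_le_jb _))
  have e2 := congrArg abs e
  rw [abs_mul, abs_mul, abs_of_pos h1] at e2
  refine le_of_mul_le_mul_right ?_ h1
  rw [e2]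
  gcongr

lemma jb_le_add (ξ ζ : ℝ) : jb ξ ≤ jb (ξ - ζ) + jb ζ := by
  have h1 := abs_le.1 (abs_jb_sub_jb_le ξ ζ)
  have h2 := abs_two_pi_mul_le_jb (ξ - ζ)
  linarith

lemma add_rpow_le {a b r : ℝ} (ha : 0 ≤ a) (hb : 0 ≤ b) (hr : 0 ≤ r) :
    (a + b) ^ r ≤ 2 ^ r * (a ^ r + b ^ r) := by
  have h1 : (a + b) ^ r ≤ (2 * max a b) ^ r :=
    Real.rpow_le_rpow (by positivity) (by linarith [le_max_left a b, le_max_right a b]) hr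
  refine h1.trans ?_
  rw [Real.mul_rpow (by norm_num) (by positivity)]
  gcongr
  rcases max_cases a b with ⟨h, -⟩ | ⟨h, -⟩ <;> rw [h]
  · linarith [Real.rpow_nonneg hb r]
  · linarith [Real.rpow_nonneg ha r]

lemma jb_rpow_le_add {r : ℝ} (hr : 0 ≤ r) (ξ ζ : ℝ) :
    jb ξ ^ r ≤ 2 ^ r * (jb (ξ - ζ) ^ r + jb ζ ^ r) :=
  (Real.rpow_le_rpow (jb_pos _).le (jb_le_add ξ ζ) hr).trans
    (add_rpow_le (jb_pos _).le (jb_pos _).le hr)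

lemma abs_rpow_sub_rpow_le {a b r : ℝ} (ha : 1 ≤ a) (hb : 1 ≤ b) (hr : 1 ≤ r) :
    |a ^ r - b ^ r| ≤ r * |a - b| * (a ^ (r - 1) + b ^ (r - 1)) := by
  wlog hab : b ≤ a generalizing a b
  · rw [abs_sub_comm, abs_sub_comm a, add_comm]
    exact this hb ha (le_of_not_ge hab)
  have hder : ∀ x ∈ Icc b a, HasDerivWithinAt (fun x : ℝ => x ^ r) (r * x ^ (r - 1)) (Icc b a) x :=
    fun x hx => (Real.hasDerivAt_rpow_const (Or.inl (by linarith [hx.1]))).hasDerivWithinAt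
  have := (convex_Icc b a).norm_image_sub_le_of_norm_hasDerivWithin_le (C := r * a ^ (r - 1))
    hder (fun x hx => by
      have hx0 : 0 ≤ x := by linarith [hx.1]
      rw [Real.norm_eq_abs, abs_of_nonneg (by positivity)]
      gcongr
      exact hx.2) (left_mem_Icc.2 hab) (right_mem_Icc.2 hab)
  rw [Real.norm_eq_abs, Real.norm_eq_abs] at this
  refine this.trans ?_
  have h1 : 0 ≤ b ^ (r - 1) := by positivity
  have h2 : 0 ≤ r * |a - b| := by positivity
  nlinarith

/-- The regularized weight `⟨2πξ⟩^r / ⟨2πηξ⟩`. -/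
noncomputable def regWeight (η r ξ : ℝ) : ℝ := jb ξ ^ r / jb (η * ξ)

lemma regWeight_nonneg (η r ξ : ℝ) : 0 ≤ regWeight η r ξ :=
  div_nonneg (Real.rpow_nonneg (jb_pos _).le _) (jb_pos _).le

@[fun_prop]
lemma continuous_regWeight (η r : ℝ) : Continuous (regWeight η r) := by
  unfold regWeight
  refine Continuous.div ?_ (by fun_prop) fun x => (jb_pos _).ne'
  exact continuous_jb.rpow_const fun x => Or.inl (jb_pos _).ne'

lemma regWeight_zero (r : ℝ) : regWeight 0 r = fun ξ => jb ξ ^ r := by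
  ext ξ
  simp [regWeight]

lemma regWeight_le (η r ξ : ℝ) : regWeight η r ξ ≤ jb ξ ^ r :=
  div_le_self (Real.rpow_nonneg (jb_pos _).le _) (one_le_jb _)

lemma mul_jb_le {η : ℝ} (h0 : 0 ≤ η) (h1 : η ≤ 1) (ξ : ℝ) : η * jb ξ ≤ jb (η * ξ) := by
  refine Real.le_sqrt_of_sq_le ?_
  rw [mul_pow, jb_sq]
  nlinarith

/-- For fixed `η > 0` the damping gains one derivative, so the regularized energy can be
differentiated along curves that are `C¹` only with values in the space of order `r - 1`. -/
lemma regWeight_le_sub_one {η : ℝ} (h0 : 0 < η) (h1 : η ≤ 1) (r ξ : ℝ) :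
    regWeight η r ξ ≤ η⁻¹ * jb ξ ^ (r - 1) := by
  rw [regWeight, div_le_iff₀ (jb_pos _), Real.rpow_sub_one (jb_pos _).ne']
  have h2 := mul_jb_le h0.le h1 ξ
  have h3 : 0 ≤ jb ξ ^ r := Real.rpow_nonneg (jb_pos _).le _
  have h4 := jb_pos ξ
  calc jb ξ ^ r = η⁻¹ * (jb ξ ^ r / jb ξ) * (η * jb ξ) := by field_simp
    _ ≤ _ := by gcongr

/-- The cancellation behind the commutator estimate. -/
lemma abs_regWeight_mul_sub_le {η r : ℝ} (hη : 0 ≤ η) (hr : 1 ≤ r) (ξ ζ : ℝ) :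
    |regWeight η r ξ * (2 * Real.pi * ζ) - (2 * Real.pi * ξ) * regWeight η r ζ| ≤
      (3 + r * 2 ^ r) * (jb (ξ - ζ) ^ r * jb ζ + jb (ξ - ζ) * jb ζ ^ r) := by
  set x := 2 * Real.pi * ξ
  set y := 2 * Real.pi * ζ with hy
  set a := jb ξ
  set b := jb ζ
  set d := jb (ξ - ζ)
  set A := jb (η * ξ)
  set B := jb (η * ζ)
  have ha : 1 ≤ a := one_le_jb _
  have hb : 1 ≤ b := one_le_jb _
  have hd : 1 ≤ d := one_le_jb _
  have hA : 1 ≤ A := one_le_jb _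
  have hB : 1 ≤ B := one_le_jb _
  have hxy : |x - y| ≤ d := by
    have := abs_two_pi_mul_le_jb (ξ - ζ)
    rwa [mul_sub] at this
  have hyb : |y| ≤ b := abs_two_pi_mul_le_jb ζ
  have hab : |a - b| ≤ |x - y| := by
    have := abs_jb_sub_jb_le ξ ζ
    rwa [mul_sub] at this
  have hAB : |B - A| ≤ η * |x - y| := by
    have := abs_jb_sub_jb_le (η * ζ) (η * ξ)
    rw [show 2 * Real.pi * (η * ζ - η * ξ) = η * (y - x) by simp only [x, y]; ring, abs_mul,
      abs_of_nonneg hη, abs_sub_comm y x] at this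
    exact this
  have hηy : η * |y| ≤ B := by
    have := abs_two_pi_mul_le_jb (η * ζ)
    rwa [show 2 * Real.pi * (η * ζ) = η * y by rw [hy]; ring, abs_mul, abs_of_nonneg hη] at this
  have hbr : 0 ≤ b ^ r := by positivity
  have hdr : 0 ≤ d ^ r := by positivity
  -- Each of the three pieces contains a difference of quantities at `ξ` and `ζ`, hence a factor
  -- controlled by `d = ⟨2π(ξ - ζ)⟩`: from the power, from the damping factor, and from the
  -- derivative symbol.
  have e : regWeight η r ξ * y - x * regWeight η r ζ =
      (a ^ r - b ^ r) * y / A + b ^ r * y * (B - A) / (A * B) - (x - y) * (b ^ r / B) := by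
    have hA' : A ≠ 0 := by positivity
    have hB' : B ≠ 0 := by positivity
    change a ^ r / A * y - x * (b ^ r / B) = _
    field_simp
    ring
  have t3 : |(x - y) * (b ^ r / B)| ≤ d * b ^ r := by
    rw [abs_mul, abs_of_nonneg (by positivity : 0 ≤ b ^ r / B)]
    gcongr
    exact div_le_self hbr hB
  -- The `η` produced by `B - A` is absorbed by `η |y| ≤ B`, so the bound is uniform in `η`.
  have t2 : |b ^ r * y * (B - A) / (A * B)| ≤ d * b ^ r := by
    rw [abs_div, abs_mul, abs_mul, abs_of_nonneg hbr, abs_of_pos (by positivity : 0 < A * B),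
      div_le_iff₀ (by positivity)]
    calc b ^ r * |y| * |B - A| ≤ b ^ r * |y| * (η * |x - y|) := by gcongr
      _ = b ^ r * (η * |y|) * |x - y| := by ring
      _ ≤ b ^ r * B * d := by gcongr
      _ = d * b ^ r * (1 * B) := by ring
      _ ≤ d * b ^ r * (A * B) := by gcongr
  have t1 : |(a ^ r - b ^ r) * y / A| ≤ (1 + r * 2 ^ r) * (d ^ r * b + d * b ^ r) := by
    rw [abs_div, abs_mul, abs_of_pos (by positivity : 0 < A)]
    refine (div_le_self (by positivity) hA).trans ?_
    have k1 : a ^ (r - 1) ≤ 2 ^ (r - 1) * (d ^ (r - 1) + b ^ (r - 1)) :=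
      jb_rpow_le_add (by linarith) ξ ζ
    have k2 : d * d ^ (r - 1) = d ^ r := by
      rw [mul_comm, ← Real.rpow_add_one (by positivity)]; ring_nf
    have k3 : b ^ (r - 1) * b = b ^ r := by
      rw [← Real.rpow_add_one (by positivity)]; ring_nf
    have k4 : (2 : ℝ) ^ (r - 1) * 2 = 2 ^ r := by
      rw [← Real.rpow_add_one (by positivity)]; ring_nf
    have k5 : (1 : ℝ) ≤ 2 ^ (r - 1) := Real.one_le_rpow (by norm_num) (by linarith)
    have k6 : 0 ≤ b ^ (r - 1) := by positivity
    have k7 : 0 ≤ d ^ (r - 1) := by positivity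
    calc |a ^ r - b ^ r| * |y| ≤ (r * |a - b| * (a ^ (r - 1) + b ^ (r - 1))) * b := by
          gcongr
          exact abs_rpow_sub_rpow_le ha hb hr
      _ ≤ (r * d * (2 ^ (r - 1) * (d ^ (r - 1) + b ^ (r - 1)) + 2 ^ (r - 1) * b ^ (r - 1))) * b := by
          gcongr
          · exact hab.trans hxy
          · nlinarith
      _ = r * 2 ^ (r - 1) * ((d * d ^ (r - 1)) * b + 2 * (d * (b ^ (r - 1) * b))) := by ring
      _ = r * 2 ^ (r - 1) * (d ^ r * b + 2 * (d * b ^ r)) := by rw [k2, k3]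
      _ ≤ r * 2 ^ (r - 1) * (2 * (d ^ r * b + d * b ^ r)) := by
          gcongr
          nlinarith [mul_nonneg hdr (by positivity : 0 ≤ b)]
      _ = r * 2 ^ r * (d ^ r * b + d * b ^ r) := by rw [← k4]; ring
      _ ≤ _ := by
          gcongr
          linarith
  rw [e]
  have h0 : 0 ≤ d ^ r * b := by positivity
  calc _ ≤ |(a ^ r - b ^ r) * y / A| + |b ^ r * y * (B - A) / (A * B)| + |(x - y) * (b ^ r / B)| :=
        (abs_sub _ _).trans (add_le_add (abs_add_le _ _) le_rfl)
    _ ≤ (1 + r * 2 ^ r) * (d ^ r * b + d * b ^ r) + d * b ^ r + d * b ^ r := by gcongr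
    _ ≤ _ := by nlinarith

/-! ### Young's inequality -/

/-- Cauchy–Schwarz applied to `f^{1/2}` and `f^{1/2} g`. -/
lemma sq_lintegral_mul_le {f g : ℝ → ℝ≥0∞} (hf : AEMeasurable f) (hg : AEMeasurable g) :
    (∫⁻ t, f t * g t) ^ 2 ≤ (∫⁻ t, f t) * ∫⁻ t, f t * g t ^ 2 := by
  have hc : (2 : ℝ).HolderConjugate 2 := by
    constructor <;> norm_num
  have h := ENNReal.lintegral_mul_le_Lp_mul_Lq volume hc (hf.pow_const (1 / 2 : ℝ))
    ((hf.pow_const (1 / 2 : ℝ)).mul hg)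
  have e1 : ∀ t, f t ^ (1 / 2 : ℝ) * (f t ^ (1 / 2 : ℝ)) = f t := fun t => by
    rw [← ENNReal.rpow_add_of_nonneg _ _ (by norm_num) (by norm_num)]
    norm_num
  have e2 : ∀ t, (f t ^ (1 / 2 : ℝ)) ^ (2 : ℝ) = f t := fun t => by
    rw [← ENNReal.rpow_mul]
    norm_num
  simp only [Pi.mul_apply, ← mul_assoc, e1, ENNReal.mul_rpow_of_nonneg _ _ zero_le_two, e2,
    ENNReal.rpow_two] at h
  calc _ ≤ ((∫⁻ t, f t) ^ (1 / 2 : ℝ) * (∫⁻ t, f t * g t ^ 2) ^ (1 / 2 : ℝ)) ^ 2 := by gcongr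
    _ = _ := by
      rw [← ENNReal.rpow_two, ENNReal.mul_rpow_of_nonneg _ _ zero_le_two, ← ENNReal.rpow_mul,
        ← ENNReal.rpow_mul]
      norm_num

/-- Cauchy–Schwarz with respect to the measure `f dt`, followed by Tonelli and translation
invariance. -/
lemma lintegral_sq_conv_le {f g : ℝ → ℝ≥0∞} (hf : AEMeasurable f) (hg : AEMeasurable g) :
    ∫⁻ x, (∫⁻ t, f t * g (x - t)) ^ 2 ≤ (∫⁻ t, f t) ^ 2 * ∫⁻ t, g t ^ 2 := by
  wlog h : Measurable f ∧ Measurable g generalizing f g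
  · have := this hf.measurable_mk.aemeasurable hg.measurable_mk.aemeasurable
      ⟨hf.measurable_mk, hg.measurable_mk⟩
    have e1 : ∀ x, ∫⁻ t, f t * g (x - t) = ∫⁻ t, hf.mk f t * hg.mk g (x - t) := fun x => by
      refine lintegral_congr_ae ?_
      filter_upwards [hf.ae_eq_mk, (Measure.measurePreserving_sub_left volume x).quasiMeasurePreserving.ae
        hg.ae_eq_mk] with t h1 h2
      rw [h1, h2]
    have e2 : ∫⁻ t, f t = ∫⁻ t, hf.mk f t := lintegral_congr_ae hf.ae_eq_mk
    have e3 : ∫⁻ t, g t ^ 2 = ∫⁻ t, hg.mk g t ^ 2 :=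
      lintegral_congr_ae (hg.ae_eq_mk.fun_comp (· ^ 2))
    simp only [e1, e2, e3]
    exact this
  obtain ⟨hf', hg'⟩ := h
  have hgs : ∀ x, Measurable fun t => g (x - t) := fun x => hg'.comp (by fun_prop)
  calc ∫⁻ x, (∫⁻ t, f t * g (x - t)) ^ 2
      ≤ ∫⁻ x, (∫⁻ t, f t) * ∫⁻ t, f t * g (x - t) ^ 2 :=
        lintegral_mono fun x => sq_lintegral_mul_le hf (hgs x).aemeasurable
    _ = (∫⁻ t, f t) * ∫⁻ x, ∫⁻ t, f t * g (x - t) ^ 2 := by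
        rw [lintegral_const_mul]
        have : Measurable fun p : ℝ × ℝ => f p.2 * g (p.1 - p.2) ^ 2 :=
          (hf'.comp measurable_snd).mul ((hg'.comp (by fun_prop)).pow_const 2)
        exact this.lintegral_prod_right'
    _ = (∫⁻ t, f t) * ∫⁻ t, ∫⁻ x, f t * g (x - t) ^ 2 := by
        rw [lintegral_lintegral_swap]
        exact ((hf'.comp measurable_snd).mul
          ((hg'.comp (by fun_prop)).pow_const 2)).aemeasurable
    _ = (∫⁻ t, f t) * ∫⁻ t, f t * ∫⁻ x, g x ^ 2 := by
        congr 1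
        refine lintegral_congr fun t => ?_
        have hm : Measurable fun x => g (x - t) ^ 2 := (hg'.comp (by fun_prop)).pow_const 2
        rw [lintegral_const_mul _ hm,
          lintegral_sub_right_eq_self (fun x => g x ^ 2) t]
    _ = _ := by
        rw [lintegral_mul_const _ hf']
        ring

lemma eLpNorm_two_eq (f : ℝ → ℝ≥0∞) : eLpNorm f 2 volume = (∫⁻ t, f t ^ 2) ^ (1 / 2 : ℝ) := by
  rw [eLpNorm_eq_lintegral_rpow_enorm_toReal (by norm_num) (by norm_num)]
  simp

lemma eLpNorm_conv_le {f g : ℝ → ℝ≥0∞} (hf : AEMeasurable f) (hg : AEMeasurable g) :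
    eLpNorm (fun x => ∫⁻ t, f t * g (x - t)) 2 volume ≤ (∫⁻ t, f t) * eLpNorm g 2 volume := by
  rw [eLpNorm_two_eq, eLpNorm_two_eq]
  refine (ENNReal.rpow_le_rpow (lintegral_sq_conv_le hf hg) (by norm_num)).trans_eq ?_
  rw [ENNReal.mul_rpow_of_nonneg _ _ (by norm_num), ← ENNReal.rpow_two, ← ENNReal.rpow_mul]
  norm_num

lemma lintegral_conv_comm (f g : ℝ → ℝ≥0∞) (x : ℝ) :
    ∫⁻ t, f t * g (x - t) = ∫⁻ t, g t * f (x - t) := by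
  rw [← lintegral_sub_left_eq_self _ x]
  refine lintegral_congr fun t => ?_
  rw [sub_sub_cancel, mul_comm]

lemma eLpNorm_conv_le' {f g : ℝ → ℝ≥0∞} (hf : AEMeasurable f) (hg : AEMeasurable g) :
    eLpNorm (fun x => ∫⁻ t, f t * g (x - t)) 2 volume ≤ eLpNorm f 2 volume * ∫⁻ t, g t := by
  simp_rw [lintegral_conv_comm f g]
  rw [mul_comm]
  exact eLpNorm_conv_le hg hf

/-! ### Weighted norms on the Fourier side -/

/-- The weighted norm `‖m F‖_{L²}`. -/
noncomputable def wN (m : ℝ → ℝ) (F : ℝ → ℂ) : ℝ≥0∞ :=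
  eLpNorm (fun ξ => (m ξ : ℂ) * F ξ) 2 volume

/-- The Sobolev norm of order `r`, on the Fourier side. -/
noncomputable def sN (r : ℝ) (F : ℝ → ℂ) : ℝ≥0∞ := wN (fun ξ => jb ξ ^ r) F

/-- `F` is the Fourier transform of an element of the Sobolev space of order `r`. -/
structure Sob (r : ℝ) (F : ℝ → ℂ) : Prop where
  meas : AEStronglyMeasurable F volume
  lt_top : sN r F < ∞

lemma ofReal_jb_rpow (r ξ : ℝ) : ENNReal.ofReal (jb ξ ^ r) = ‖((jb ξ ^ r : ℝ) : ℂ)‖ₑ := by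
  rw [← ofReal_norm, Complex.norm_real, Real.norm_of_nonneg (Real.rpow_nonneg (jb_pos _).le _)]

lemma sN_eq (r : ℝ) (F : ℝ → ℂ) :
    sN r F = eLpNorm (fun ξ => ENNReal.ofReal (jb ξ ^ r) * ‖F ξ‖ₑ) 2 volume := by
  refine eLpNorm_congr_enorm_ae (ae_of_all _ fun ξ => ?_)
  simp only [enorm_mul, ofReal_jb_rpow, enorm_eq_self]

lemma wN_congr {m : ℝ → ℝ} {F G : ℝ → ℂ} (h : F =ᵐ[volume] G) : wN m F = wN m G :=
  eLpNorm_congr_ae (h.mono fun ξ hξ => by simp only [hξ])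

lemma sN_congr {r : ℝ} {F G : ℝ → ℂ} (h : F =ᵐ[volume] G) : sN r F = sN r G := wN_congr h

lemma wN_le_of_norm_le {m m' : ℝ → ℝ} {F G : ℝ → ℂ} (C : ℝ≥0)
    (h : ∀ᵐ ξ, ‖(m ξ : ℂ) * F ξ‖ ≤ C * ‖(m' ξ : ℂ) * G ξ‖) : wN m F ≤ C * wN m' G := by
  have := eLpNorm_le_nnreal_smul_eLpNorm_of_ae_le_mul (c := C) (p := 2)
    (f := fun ξ => (m ξ : ℂ) * F ξ) (g := fun ξ => (m' ξ : ℂ) * G ξ) (μ := volume) (h.mono fun ξ hξ => ?_)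
  · simpa [ENNReal.smul_def, wN] using this
  · exact_mod_cast hξ

lemma wN_mono {m m' : ℝ → ℝ} (F : ℝ → ℂ) (C : ℝ≥0) (h : ∀ ξ, |m ξ| ≤ C * |m' ξ|) :
    wN m F ≤ C * wN m' F := by
  refine wN_le_of_norm_le C (ae_of_all _ fun ξ => ?_)
  rw [norm_mul, norm_mul, Complex.norm_real, Complex.norm_real, ← mul_assoc]
  exact mul_le_mul_of_nonneg_right (h ξ) (norm_nonneg _)

lemma sN_mono {r r' : ℝ} (h : r ≤ r') (F : ℝ → ℂ) : sN r F ≤ sN r' F := by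
  have := wN_mono (m := fun ξ => jb ξ ^ r) (m' := fun ξ => jb ξ ^ r') F 1 fun ξ => by
    rw [abs_of_nonneg (Real.rpow_nonneg (jb_pos _).le _),
      abs_of_nonneg (Real.rpow_nonneg (jb_pos _).le _), NNReal.coe_one, one_mul]
    exact Real.rpow_le_rpow_of_exponent_le (one_le_jb _) h
  simpa [sN] using this

lemma sN_le_of_norm_le {r r' : ℝ} {F G : ℝ → ℂ} (C : ℝ≥0)
    (h : ∀ᵐ ξ, ‖F ξ‖ ≤ C * jb ξ ^ (r' - r) * ‖G ξ‖) : sN r F ≤ C * sN r' G := by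
  refine wN_le_of_norm_le C (h.mono fun ξ hξ => ?_)
  have h0 := jb_pos ξ
  rw [norm_mul, norm_mul, Complex.norm_real, Complex.norm_real, Real.norm_of_nonneg (by positivity),
    Real.norm_of_nonneg (by positivity)]
  calc jb ξ ^ r * ‖F ξ‖ ≤ jb ξ ^ r * (C * jb ξ ^ (r' - r) * ‖G ξ‖) := by gcongr
    _ = C * ((jb ξ ^ r * jb ξ ^ (r' - r)) * ‖G ξ‖) := by ring
    _ = _ := by rw [← Real.rpow_add h0]; ring_nf

lemma measurable_weight {m : ℝ → ℝ} (hm : Measurable m) {F : ℝ → ℂ}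
    (hF : AEStronglyMeasurable F volume) :
    AEStronglyMeasurable (fun ξ => (m ξ : ℂ) * F ξ) volume :=
  (Complex.measurable_ofReal.comp hm).aestronglyMeasurable.mul hF

lemma measurable_jb_rpow (r : ℝ) : Measurable fun ξ => jb ξ ^ r :=
  continuous_jb.measurable.pow_const r

lemma sN_add_le {r : ℝ} {F G : ℝ → ℂ} (hF : AEStronglyMeasurable F volume)
    (hG : AEStronglyMeasurable G volume) : sN r (fun ξ => F ξ + G ξ) ≤ sN r F + sN r G := by
  refine le_trans (le_of_eq ?_) (eLpNorm_add_le (measurable_weight (measurable_jb_rpow r) hF)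
    (measurable_weight (measurable_jb_rpow r) hG) one_le_two)
  unfold sN wN
  congr 1
  ext ξ
  simp only [Pi.add_apply]
  ring

lemma sN_const_mul_le {r : ℝ} (c : ℂ) (F : ℝ → ℂ) :
    sN r (fun ξ => c * F ξ) ≤ ‖c‖₊ * sN r F :=
  sN_le_of_norm_le _ (ae_of_all _ fun ξ => by simp)

namespace Sob
variable {r : ℝ} {F G : ℝ → ℂ}

lemma congr (hF : Sob r F) (h : F =ᵐ[volume] G) : Sob r G :=
  ⟨hF.meas.congr h, (sN_congr h) ▸ hF.lt_top⟩

lemma mono (hF : Sob r F) {r' : ℝ} (h : r' ≤ r) : Sob r' F :=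
  ⟨hF.meas, (sN_mono h F).trans_lt hF.lt_top⟩

lemma add (hF : Sob r F) (hG : Sob r G) : Sob r fun ξ => F ξ + G ξ :=
  ⟨hF.meas.add hG.meas, (sN_add_le hF.meas hG.meas).trans_lt (ENNReal.add_lt_top.2 ⟨hF.2, hG.2⟩)⟩

lemma of_le (hG : Sob r G) {r' : ℝ} (hF : AEStronglyMeasurable F volume) (C : ℝ≥0)
    (h : ∀ᵐ ξ, ‖F ξ‖ ≤ C * jb ξ ^ (r - r') * ‖G ξ‖) : Sob r' F :=
  ⟨hF, (sN_le_of_norm_le C h).trans_lt (ENNReal.mul_lt_top ENNReal.coe_lt_top hG.2)⟩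

lemma const_mul (hF : Sob r F) (c : ℂ) : Sob r fun ξ => c * F ξ :=
  ⟨hF.meas.const_mul c, (sN_const_mul_le c F).trans_lt (ENNReal.mul_lt_top ENNReal.coe_lt_top hF.2)⟩

lemma sub (hF : Sob r F) (hG : Sob r G) : Sob r fun ξ => F ξ - G ξ :=
  (hF.add (hG.const_mul (-1))).congr (ae_of_all _ fun ξ => by ring)

lemma memLp_weight (hF : Sob r F) {m : ℝ → ℝ} (hm : Measurable m) (C : ℝ≥0)
    (h : ∀ ξ, |m ξ| ≤ C * jb ξ ^ r) : MemLp (fun ξ => (m ξ : ℂ) * F ξ) 2 volume := by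
  refine ⟨measurable_weight hm hF.meas, (wN_mono (m' := fun ξ => jb ξ ^ r) F C fun ξ => ?_).trans_lt
    (ENNReal.mul_lt_top ENNReal.coe_lt_top hF.2)⟩
  rw [abs_of_nonneg (Real.rpow_nonneg (jb_pos _).le _)]
  exact h ξ

lemma memLp (hF : Sob r F) (hr : 0 ≤ r) : MemLp F 2 volume := by
  have := hF.memLp_weight (m := fun _ => 1) measurable_const 1 fun ξ => by
    simpa using Real.one_le_rpow (one_le_jb ξ) hr
  simpa using this

end Sob

/-- The symbol of the derivative. -/
noncomputable def dsym (ξ : ℝ) : ℂ := 2 * Real.pi * Complex.I * ξ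

lemma dsym_eq (ξ : ℝ) : dsym ξ = ((2 * Real.pi * ξ : ℝ) : ℂ) * Complex.I := by
  unfold dsym
  push_cast
  ring

@[fun_prop]
lemma continuous_dsym : Continuous dsym := by
  unfold dsym
  fun_prop

lemma norm_dsym_le (ξ : ℝ) : ‖dsym ξ‖ ≤ jb ξ := by
  rw [dsym_eq, norm_mul, Complex.norm_I, mul_one, Complex.norm_real]
  exact abs_two_pi_mul_le_jb ξ

lemma conj_dsym (ξ : ℝ) : (starRingEnd ℂ) (dsym ξ) = -dsym ξ := by
  rw [dsym_eq, map_mul, Complex.conj_ofReal, Complex.conj_I]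
  ring

/-- The derivative on the Fourier side. -/
noncomputable def dF (F : ℝ → ℂ) (ξ : ℝ) : ℂ := dsym ξ * F ξ

lemma norm_dF_le (F : ℝ → ℂ) (ξ : ℝ) : ‖dF F ξ‖ ≤ jb ξ * ‖F ξ‖ := by
  rw [dF, norm_mul]
  exact mul_le_mul_of_nonneg_right (norm_dsym_le ξ) (norm_nonneg _)

lemma dF_congr {F G : ℝ → ℂ} (h : F =ᵐ[volume] G) : dF F =ᵐ[volume] dF G :=
  h.mono fun ξ hξ => by simp only [dF, hξ]

lemma sN_dF_le (r : ℝ) (F : ℝ → ℂ) : sN (r - 1) (dF F) ≤ sN r F := by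
  have := sN_le_of_norm_le (r := r - 1) (r' := r) (F := dF F) (G := F) 1 (ae_of_all _ fun ξ => by
    simpa using norm_dF_le F ξ)
  simpa using this

lemma aestronglyMeasurable_dF {F : ℝ → ℂ} (hF : AEStronglyMeasurable F volume) :
    AEStronglyMeasurable (dF F) volume :=
  continuous_dsym.aestronglyMeasurable.mul hF

lemma Sob.dF {r : ℝ} {F : ℝ → ℂ} (hF : Sob r F) : Sob (r - 1) (dF F) :=
  ⟨aestronglyMeasurable_dF hF.meas, (sN_dF_le r F).trans_lt hF.2⟩

/-! ### The embedding into the Wiener algebra -/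

lemma eLpNorm_jb_rpow_lt_top {q : ℝ} (hq : q < -(1 / 2)) :
    eLpNorm (fun ξ => ENNReal.ofReal (jb ξ ^ q)) 2 volume < ∞ := by
  rw [eLpNorm_two_eq]
  refine ENNReal.rpow_lt_top_of_nonneg (by norm_num) (ne_of_lt ?_)
  have h1 : Integrable (fun ξ : ℝ => (1 + ‖2 * Real.pi * ξ‖ ^ 2) ^ (-(-2 * q) / 2)) := by
    have := (integrable_rpow_neg_one_add_norm_sq (E := ℝ) (μ := volume) (r := -2 * q)
      (by simp; linarith)).comp_mul_left' (R := 2 * Real.pi) (by positivity)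
    exact this
  have h2 := h1.lintegral_lt_top
  refine lt_of_le_of_lt (lintegral_mono fun ξ => ?_) h2
  rw [← ENNReal.ofReal_pow (Real.rpow_nonneg (jb_pos _).le _)]
  refine ENNReal.ofReal_le_ofReal (le_of_eq ?_)
  rw [Real.norm_eq_abs, sq_abs, ← jb_sq, ← Real.rpow_natCast, ← Real.rpow_natCast,
    ← Real.rpow_mul (jb_pos _).le, ← Real.rpow_mul (jb_pos _).le]
  congr 1
  push_cast
  ring

/-- Cauchy–Schwarz against `⟨2πξ⟩^{a-r}`, which is square integrable exactly when `a - r < -1/2`.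
Both `a = 0` (sup bounds) and `a = 1` (commutator) are needed. -/
lemma exists_lintegral_jb_mul_le {a r : ℝ} (h : a + 1 / 2 < r) :
    ∃ C : ℝ≥0, ∀ F : ℝ → ℂ, AEStronglyMeasurable F volume →
      ∫⁻ ξ, ENNReal.ofReal (jb ξ ^ a) * ‖F ξ‖ₑ ≤ C * sN r F := by
  have hlt := eLpNorm_jb_rpow_lt_top (q := a - r) (by linarith)
  refine ⟨(eLpNorm (fun ξ => ENNReal.ofReal (jb ξ ^ (a - r))) 2 volume).toNNReal, fun F hF => ?_⟩
  rw [ENNReal.coe_toNNReal hlt.ne, sN_eq, eLpNorm_two_eq, eLpNorm_two_eq]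
  have hc : (2 : ℝ).HolderConjugate 2 := by
    constructor <;> norm_num
  have hm : ∀ b : ℝ, Measurable fun ξ => ENNReal.ofReal (jb ξ ^ b) := fun b =>
    (measurable_jb_rpow b).ennreal_ofReal
  have := ENNReal.lintegral_mul_le_Lp_mul_Lq volume hc (hm (a - r)).aemeasurable
    ((hm r).aemeasurable.mul hF.enorm)
  simp only [Pi.mul_apply, ENNReal.rpow_two] at this
  refine le_trans (le_of_eq (lintegral_congr fun ξ => ?_)) this
  rw [← mul_assoc, ← ENNReal.ofReal_mul (Real.rpow_nonneg (jb_pos _).le _),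
    ← Real.rpow_add (jb_pos _)]
  simp

lemma exists_lintegral_enorm_le {r : ℝ} (h : 1 / 2 < r) :
    ∃ C : ℝ≥0, ∀ F : ℝ → ℂ, AEStronglyMeasurable F volume →
      ∫⁻ ξ, ‖F ξ‖ₑ ≤ C * sN r F := by
  obtain ⟨C, hC⟩ := exists_lintegral_jb_mul_le (a := 0) (r := r) (by linarith)
  exact ⟨C, fun F hF => by simpa using hC F hF⟩

lemma Sob.integrable {r : ℝ} {F : ℝ → ℂ} (hF : Sob r F) (hr : 1 / 2 < r) : Integrable F := by
  obtain ⟨C, hC⟩ := exists_lintegral_enorm_le hr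
  exact ⟨hF.meas, (hC F hF.meas).trans_lt (ENNReal.mul_lt_top ENNReal.coe_lt_top hF.2)⟩

/-! ### Convolutions -/

/-- The convolution of two functions on the Fourier side. -/
noncomputable def cv (F G : ℝ → ℂ) : ℝ → ℂ :=
  convolution F G (ContinuousLinearMap.mul ℂ ℂ) volume

lemma cv_apply (F G : ℝ → ℂ) (ξ : ℝ) : cv F G ξ = ∫ t, F t * G (ξ - t) := rfl

lemma Integrable.cv {F G : ℝ → ℂ} (hF : Integrable F) (hG : Integrable G) : Integrable (cv F G) :=
  hF.integrable_convolution _ hG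

lemma enorm_cv_le (F G : ℝ → ℂ) (ξ : ℝ) : ‖cv F G ξ‖ₑ ≤ ∫⁻ t, ‖F t‖ₑ * ‖G (ξ - t)‖ₑ := by
  rw [cv_apply]
  refine (enorm_integral_le_lintegral_enorm _).trans_eq ?_
  simp only [enorm_mul]

lemma aestronglyMeasurable_lintegral_conv {f g : ℝ → ℝ≥0∞} (hf : AEMeasurable f)
    (hg : AEMeasurable g) : AEStronglyMeasurable (fun x => ∫⁻ t, f t * g (x - t)) volume := by
  have := aemeasurable_lconvolution hf hg
  refine (this.congr (ae_of_all _ fun x => ?_)).aestronglyMeasurable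
  rw [lconvolution_def]
  refine lintegral_congr fun t => ?_
  rw [sub_eq_neg_add]

/-- The algebra property of the Sobolev space: the weight at `ξ` splits into the weights at `t` and
`ξ - t`, the weighted factor is measured in `L²` and the other in `L¹`, and Young's inequality
applies. -/
lemma exists_sN_cv_le {r : ℝ} (hr : 1 / 2 < r) :
    ∃ C : ℝ≥0, ∀ F G : ℝ → ℂ, AEStronglyMeasurable F volume → AEStronglyMeasurable G volume →
      sN r (cv F G) ≤ C * (sN r F * sN r G) := by
  obtain ⟨C, hC⟩ := exists_lintegral_enorm_le hr
  refine ⟨(2 ^ r : ℝ≥0) * (C + C), fun F G hF hG => ?_⟩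
  set f : ℝ → ℝ≥0∞ := fun ξ => ‖F ξ‖ₑ
  set g : ℝ → ℝ≥0∞ := fun ξ => ‖G ξ‖ₑ
  set f' : ℝ → ℝ≥0∞ := fun ξ => ENNReal.ofReal (jb ξ ^ r) * ‖F ξ‖ₑ with hf'
  set g' : ℝ → ℝ≥0∞ := fun ξ => ENNReal.ofReal (jb ξ ^ r) * ‖G ξ‖ₑ with hg'
  have hm : AEMeasurable (fun ξ => ENNReal.ofReal (jb ξ ^ r)) volume :=
    (measurable_jb_rpow r).ennreal_ofReal.aemeasurable
  have mf : AEMeasurable f := hF.enorm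
  have mg : AEMeasurable g := hG.enorm
  have mf' : AEMeasurable f' := hm.mul hF.enorm
  have mg' : AEMeasurable g' := hm.mul hG.enorm
  have key : ∀ ξ, ENNReal.ofReal (jb ξ ^ r) * ‖cv F G ξ‖ₑ ≤ ((2 ^ r : ℝ≥0) : ℝ≥0∞) *
      ((∫⁻ t, f' t * g (ξ - t)) + ∫⁻ t, f t * g' (ξ - t)) := fun ξ => by
    have hgs : AEMeasurable fun t => g (ξ - t) :=
      mg.comp_quasiMeasurePreserving (Measure.measurePreserving_sub_left volume ξ).quasiMeasurePreserving
    calc _ ≤ ENNReal.ofReal (jb ξ ^ r) * ∫⁻ t, f t * g (ξ - t) := by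
          gcongr
          exact enorm_cv_le F G ξ
      _ = ∫⁻ t, ENNReal.ofReal (jb ξ ^ r) * (f t * g (ξ - t)) := by
          exact (lintegral_const_mul'' _ (mf.mul hgs)).symm
      _ ≤ ∫⁻ t, ((2 ^ r : ℝ≥0) : ℝ≥0∞) * (f' t * g (ξ - t) + f t * g' (ξ - t)) := by
          refine lintegral_mono fun t => ?_
          have h1 : ENNReal.ofReal (jb ξ ^ r) ≤ ((2 ^ r : ℝ≥0) : ℝ≥0∞) *
              (ENNReal.ofReal (jb t ^ r) + ENNReal.ofReal (jb (ξ - t) ^ r)) := by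
            have h0 : ∀ x, 0 ≤ jb x ^ r := fun x => Real.rpow_nonneg (jb_pos _).le _
            rw [← ENNReal.ofReal_add (h0 _) (h0 _), ← ENNReal.ofReal_coe_nnreal,
              ← ENNReal.ofReal_mul (by positivity)]
            refine ENNReal.ofReal_le_ofReal ?_
            have := jb_rpow_le_add (by linarith : 0 ≤ r) ξ t
            push_cast
            linarith
          calc _ ≤ _ := mul_le_mul_left h1 _
            _ = _ := by simp only [hf', hg', f, g]; ring
      _ = _ := by
          rw [lintegral_const_mul' _ _ ENNReal.coe_ne_top]
          congr 1
          exact lintegral_add_left' (mf'.mul hgs) _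
  rw [sN_eq]
  calc _ ≤ eLpNorm (fun ξ => ((2 ^ r : ℝ≥0) : ℝ≥0∞) *
      ((∫⁻ t, f' t * g (ξ - t)) + ∫⁻ t, f t * g' (ξ - t))) 2 volume :=
        eLpNorm_mono_enorm fun ξ => by simpa using key ξ
    _ ≤ ((2 ^ r : ℝ≥0) : ℝ≥0∞) * eLpNorm (fun ξ =>
      (∫⁻ t, f' t * g (ξ - t)) + ∫⁻ t, f t * g' (ξ - t)) 2 volume := by
        rw [eLpNorm_two_eq, eLpNorm_two_eq]
        simp only [mul_pow]
        rw [lintegral_const_mul' _ _ (by simp), ENNReal.mul_rpow_of_nonneg _ _ (by norm_num),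
          ← ENNReal.rpow_two, ← ENNReal.rpow_mul]
        norm_num
    _ ≤ ((2 ^ r : ℝ≥0) : ℝ≥0∞) * (sN r F * (C * sN r G) + (C * sN r F) * sN r G) := by
        gcongr
        refine (eLpNorm_add_le (aestronglyMeasurable_lintegral_conv mf' mg) (aestronglyMeasurable_lintegral_conv mf mg') one_le_two).trans ?_
        refine add_le_add ((eLpNorm_conv_le' mf' mg).trans ?_) ((eLpNorm_conv_le mf mg').trans ?_)
        · rw [sN_eq r F]
          gcongr
          exact hC G hG
        · rw [sN_eq r G]
          gcongr
          exact hC F hF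
    _ = _ := by push_cast; ring

lemma Sob.cv {r : ℝ} {F G : ℝ → ℂ} (hF : Sob r F) (hG : Sob r G) (hr : 1 / 2 < r) :
    Sob r (cv F G) := by
  obtain ⟨C, hC⟩ := exists_sN_cv_le hr
  exact ⟨(Integrable.cv (hF.integrable hr) (hG.integrable hr)).aestronglyMeasurable,
    (hC F G hF.meas hG.meas).trans_lt
      (ENNReal.mul_lt_top ENNReal.coe_lt_top (ENNReal.mul_lt_top hF.2 hG.2))⟩

lemma integrable_mul_sub {F G : ℝ → ℂ} (hF : MemLp F 2 volume) (hG : MemLp G 2 volume) (ξ : ℝ) :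
    Integrable fun t => F t * G (ξ - t) := by
  have h := hG.comp_measurePreserving (Measure.measurePreserving_sub_left volume ξ)
  exact hF.integrable_mul h

/-- The product rule is the splitting `ξ = t + (ξ - t)` under the integral. -/
lemma dF_cv {r : ℝ} (hr : 1 ≤ r) {F G : ℝ → ℂ} (hF : Sob r F) (hG : Sob r G) (ξ : ℝ) :
    dF (cv F G) ξ = cv (dF F) G ξ + cv F (dF G) ξ := by
  have hF2 := hF.memLp (by linarith)
  have hG2 := hG.memLp (by linarith)
  rw [dF, cv_apply, cv_apply, cv_apply, ← integral_const_mul,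
    ← integral_add (integrable_mul_sub (hF.dF.memLp (by linarith)) hG2 ξ)
      (integrable_mul_sub hF2 (hG.dF.memLp (by linarith)) ξ)]
  refine integral_congr_ae (ae_of_all _ fun t => ?_)
  simp only [dF, dsym]
  push_cast
  ring

/-! ### Fourier inversion and weak derivatives in `L²` -/

/-- The complex space `L²(ℝ)`. -/
abbrev H : Type := Lp ℂ 2 (volume : Measure ℝ)

lemma locallyIntegrable_H (f : H) : LocallyIntegrable f volume :=
  (Lp.memLp f).locallyIntegrable one_le_two

lemma continuous_fourierInv {Φ : ℝ → ℂ} (h1 : Integrable Φ) : Continuous (𝓕⁻ Φ) := by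
  have : (𝓕⁻ Φ) = fun x => 𝓕 Φ (-x) := by
    ext x
    exact Real.fourierInv_eq_fourier_neg Φ x
  rw [this]
  exact (VectorFourier.fourierIntegral_continuous Real.continuous_fourierChar (by fun_prop) h1).comp
    continuous_neg

/-- Both transforms satisfy the same duality with test functions: the `L²` one as a tempered
distribution, the integral one by Fubini. Smooth compactly supported functions then separate them.
-/
lemma coeFn_fourierInv_toLp {Φ : ℝ → ℂ} (h1 : Integrable Φ) (h2 : MemLp Φ 2 volume) :
    ((𝓕⁻ (h2.toLp Φ : H) : H) : ℝ → ℂ) =ᵐ[volume] 𝓕⁻ Φ := by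
  refine ae_eq_of_integral_contDiff_smul_eq (locallyIntegrable_H _)
    (continuous_fourierInv h1).locallyIntegrable fun g g_smooth g_cpt => ?_
  have hg₁ : HasCompactSupport (Complex.ofRealCLM ∘ g) := g_cpt.comp_left rfl
  have hg₂ : ContDiff ℝ ((⊤ : ℕ∞) : WithTop ℕ∞) (Complex.ofRealCLM ∘ g) :=
    Complex.ofRealCLM.contDiff.comp g_smooth
  set G : 𝓢(ℝ, ℂ) := hg₁.toSchwartzMap hg₂ with hG
  have hGg : ∀ x, G x = (g x : ℂ) := fun x => by simp [hG]
  have e1 : ∫ x, g x • ((𝓕⁻ (h2.toLp Φ : H) : H) : ℝ → ℂ) x =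
      ((𝓕⁻ (h2.toLp Φ : H) : H) : 𝓢'(ℝ, ℂ)) G := by
    rw [Lp.toTemperedDistribution_apply]
    exact integral_congr_ae (ae_of_all _ fun x => by simp [hGg])
  rw [e1, ← Lp.fourierInv_toTemperedDistribution_eq, TemperedDistribution.fourierInv_apply,
    Lp.toTemperedDistribution_apply]
  have e2 : ∫ x, (𝓕⁻ G) x • (h2.toLp Φ : ℝ → ℂ) x = ∫ x, 𝓕⁻ (G : ℝ → ℂ) x • Φ x := by
    refine integral_congr_ae (h2.coeFn_toLp.mono fun x hx => ?_)
    simp only [hx, SchwartzMap.fourierInv_coe]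
  rw [e2]
  have e3 := VectorFourier.integral_fourierIntegral_smul_eq_flip (L := -innerₗ ℝ)
    Real.continuous_fourierChar (by
      have : (fun p : ℝ × ℝ => (-innerₗ ℝ) p.1 p.2) = fun p : ℝ × ℝ => -inner ℝ p.1 p.2 := by
        ext p
        simp
      change Continuous fun p : ℝ × ℝ => (-innerₗ ℝ) p.1 p.2
      rw [this]
      fun_prop) G.integrable h1 (μ := volume) (ν := volume)
  have e4 : ∀ (F : ℝ → ℂ) (x : ℝ), VectorFourier.fourierIntegral Real.fourierChar volume
      (-innerₗ ℝ) F x = 𝓕⁻ F x := fun F x => by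
    rw [Real.fourierInv_eq]
    simp [VectorFourier.fourierIntegral]
  have e5 : ∀ (F : ℝ → ℂ) (x : ℝ), VectorFourier.fourierIntegral Real.fourierChar volume
      (-innerₗ ℝ).flip F x = 𝓕⁻ F x := fun F x => by
    rw [Real.fourierInv_eq]
    simp [VectorFourier.fourierIntegral, mul_comm]
  simp only [e4, e5] at e3
  rw [e3]
  exact integral_congr_ae (ae_of_all _ fun x => by simp [hGg])

lemma lineDeriv_one (g : 𝓢(ℝ, ℂ)) : ∂_{(1:ℝ)} g = SchwartzMap.derivCLM ℂ ℂ g := by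
  ext x
  simp [SchwartzMap.lineDerivOp_apply_eq_fderiv]

/-- The transform of a distributional derivative is multiplication by the symbol; testing on smooth
compactly supported functions turns this identity of distributions into one almost everywhere. -/
lemma fourier_of_isWeakDeriv {f g₁ : L2} (h : IsWeakDeriv f g₁) :
    ((𝓕 (toComplex g₁) : H) : ℝ → ℂ) =ᵐ[volume] dF (𝓕 (toComplex f) : H) := by
  have h1 : LineDeriv.lineDerivOp (1:ℝ) (toComplex f : 𝓢'(ℝ, ℂ)) = (toComplex g₁ : 𝓢'(ℝ, ℂ)) := by
    rw [← h]
    ext G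
    rw [TemperedDistribution.lineDerivOp_apply_apply, lineDeriv_one]
    simp
  have h2 := TemperedDistribution.fourier_lineDerivOp_eq (toComplex f : 𝓢'(ℝ, ℂ)) (1:ℝ)
  rw [h1, Lp.fourier_toTemperedDistribution_eq, Lp.fourier_toTemperedDistribution_eq] at h2
  refine ae_eq_of_integral_contDiff_smul_eq (locallyIntegrable_H _)
    ?_ fun g g_smooth g_cpt => ?_
  · rw [← locallyIntegrableOn_univ]
    exact ((locallyIntegrableOn_univ.2 (locallyIntegrable_H (𝓕 (toComplex f)))).continuousOn_mul
      continuous_dsym.continuousOn isOpen_univ.isLocallyClosed)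
  have hg₁ : HasCompactSupport (Complex.ofRealCLM ∘ g) := g_cpt.comp_left rfl
  have hg₂ : ContDiff ℝ ((⊤ : ℕ∞) : WithTop ℕ∞) (Complex.ofRealCLM ∘ g) :=
    Complex.ofRealCLM.contDiff.comp g_smooth
  set G : 𝓢(ℝ, ℂ) := hg₁.toSchwartzMap hg₂ with hG
  have hGg : ∀ x, G x = (g x : ℂ) := fun x => by simp [hG]
  have h3 := congrArg (fun T : 𝓢'(ℝ, ℂ) => T G) h2
  simp only [Lp.toTemperedDistribution_apply, smul_eq_mul, _root_.smul_apply,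
    TemperedDistribution.smulLeftCLM_apply_apply] at h3
  simp at h3
  have e1 : ∫ x, g x • ((𝓕 (toComplex g₁) : H) : ℝ → ℂ) x =
      ∫ x, G x * ((𝓕 (toComplex g₁) : H) : ℝ → ℂ) x :=
    integral_congr_ae (ae_of_all _ fun x => by simp [hGg])
  rw [e1, h3, ← integral_const_mul]
  refine integral_congr_ae (ae_of_all _ fun x => ?_)
  have hx : ((SchwartzMap.smulLeftCLM ℂ fun x : ℝ => (x : ℂ)) G) x = x * G x := by
    rw [SchwartzMap.smulLeftCLM_apply_apply (by fun_prop)]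
    rfl
  simp only [hx, hGg, dF, dsym, Complex.real_smul]
  ring

/-! ### The Fourier transform of real square integrable functions -/

/-- The `L²` Fourier transform, in Mathlib's normalization. -/
noncomputable def FT (f : L2) : ℝ → ℂ := (𝓕 (toComplex f) : H)

lemma memLp_FT (f : L2) : MemLp (FT f) 2 volume := Lp.memLp _

lemma toLp_FT (f : L2) : (memLp_FT f).toLp (FT f) = 𝓕 (toComplex f) := Lp.toLp_coeFn _ _

lemma coeFn_toComplex (f : L2) : (toComplex f : ℝ → ℂ) =ᵐ[volume] fun x => ((f x : ℝ) : ℂ) :=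
  ContinuousLinearMap.coeFn_compLp _ f

lemma toComplex_sub (f g : L2) : toComplex (f - g) = toComplex f - toComplex g :=
  (Complex.ofRealCLM.compLpL 2 volume).map_sub f g

lemma toComplex_smul (c : ℝ) (f : L2) : toComplex (c • f) = (c : ℂ) • toComplex f := by
  refine Lp.ext ?_
  filter_upwards [coeFn_toComplex (c • f), coeFn_toComplex f, Lp.coeFn_smul c f,
    Lp.coeFn_smul (c : ℂ) (toComplex f)] with x h1 h2 h3 h4
  rw [h1, h3, h4]
  simp [h2]

lemma FT_sub (f g : L2) : FT (f - g) =ᵐ[volume] fun ξ => FT f ξ - FT g ξ := by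
  unfold FT
  have : 𝓕 (toComplex f - toComplex g : H) = 𝓕 (toComplex f) - 𝓕 (toComplex g) :=
    (Lp.fourierTransformₗᵢ ℝ ℂ).map_sub _ _
  rw [toComplex_sub, this]
  exact Lp.coeFn_sub _ _

lemma FT_smul (c : ℝ) (f : L2) : FT (c • f) =ᵐ[volume] fun ξ => (c : ℂ) * FT f ξ := by
  unfold FT
  rw [toComplex_smul, FourierTransform.fourier_smul]
  exact Lp.coeFn_smul _ _

lemma lintegral_comp_two_pi (F : ℝ → ℝ≥0∞) :
    ∫⁻ ξ, F ξ = ENNReal.ofReal (2 * Real.pi) * ∫⁻ ξ, F (2 * Real.pi * ξ) := by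
  have hpi : (2 * Real.pi) ≠ 0 := by positivity
  conv_lhs => rw [← Real.smul_map_volume_mul_left hpi]
  rw [lintegral_smul_measure, abs_of_pos (by positivity : 0 < 2 * Real.pi),
    smul_eq_mul]
  congr 1
  exact (Homeomorph.mulLeft₀ _ hpi).measurableEmbedding.lintegral_map F

/-- The dilation by `2π` between the two Fourier normalizations leaves only a constant factor, so
all estimates can be made for `sN`. -/
lemma eSobolevNorm_eq (r : ℝ) (f : L2) :
    eSobolevNorm r f = ENNReal.ofReal (2 * Real.pi) ^ (1 / 2 : ℝ) * sN r (FT f) := by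
  rw [eSobolevNorm, lintegral_comp_two_pi, ENNReal.mul_rpow_of_nonneg _ _ (by norm_num), sN_eq,
    eLpNorm_two_eq]
  congr 2
  refine lintegral_congr fun ξ => ?_
  have hpi : (2 * Real.pi) ≠ 0 := by positivity
  rw [mul_pow (ENNReal.ofReal _), ← ENNReal.ofReal_pow (Real.rpow_nonneg (jb_pos _).le _), hat,
    mul_div_cancel_left₀ _ hpi, ← jb_sq, ← Real.rpow_natCast, ← Real.rpow_natCast,
    ← Real.rpow_mul (jb_pos _).le, ← Real.rpow_mul (jb_pos _).le, mul_comm r]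
  rfl

lemma memH_iff {r : ℝ} {f : L2} : MemH r f ↔ Sob r (FT f) := by
  have h1 : ENNReal.ofReal (2 * Real.pi) ^ (1 / 2 : ℝ) ≠ 0 := by
    simp [Real.pi_pos]
  have h2 : ENNReal.ofReal (2 * Real.pi) ^ (1 / 2 : ℝ) ≠ ∞ :=
    ENNReal.rpow_ne_top_of_nonneg (by norm_num) ENNReal.ofReal_ne_top
  rw [MemH, eSobolevNorm_eq]
  refine ⟨fun h => ⟨(memLp_FT f).1, ?_⟩, fun h => ENNReal.mul_lt_top h2.lt_top h.2⟩
  exact (ENNReal.lt_top_of_mul_ne_top_right h.ne h1)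

lemma FT_of_isWeakDeriv {f g : L2} (h : IsWeakDeriv f g) : FT g =ᵐ[volume] dF (FT f) :=
  fourier_of_isWeakDeriv h

lemma ae_comp_two_pi {p : ℝ → Prop} (h : ∀ᵐ ξ, p ξ) : ∀ᵐ ξ, p (2 * Real.pi * ξ) := by
  have hpi : (2 * Real.pi) ≠ 0 := by positivity
  have h2 := h
  rw [← Real.smul_map_volume_mul_left hpi] at h2
  have h3 : ENNReal.ofReal |2 * Real.pi| ≠ 0 := by simp [Real.pi_pos.ne']
  rw [Measure.ae_ennreal_smul_measure_iff h3] at h2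
  exact ae_of_ae_map (by fun_prop) h2

lemma FT_of_isKApply {β : SignedMeasure ℝ} {δ : ℝ} {f g : L2} (h : IsKApply β δ f g) :
    FT g =ᵐ[volume] fun ξ => (kernelSymbol β (δ * (2 * Real.pi * ξ)) : ℂ) * FT f ξ := by
  have hpi : (2 * Real.pi) ≠ 0 := by positivity
  refine (ae_comp_two_pi h).mono fun ξ hξ => ?_
  rwa [hat, hat, mul_div_cancel_left₀ _ hpi] at hξ

/-! ### Functions in the Wiener algebra -/

/-- `φ` is the inverse Fourier transform of the integrable and square integrable function `Φ`. -/
structure Rep (φ : ℝ → ℝ) (Φ : ℝ → ℂ) : Prop where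
  integrable : Integrable Φ
  memLp : MemLp Φ 2 volume
  eq : ∀ x, (φ x : ℂ) = 𝓕⁻ Φ x

lemma fourierInv_cv {F G : ℝ → ℂ} (hF : Integrable F) (hG : Integrable G) (x : ℝ) :
    𝓕⁻ (cv F G) x = 𝓕⁻ F x * 𝓕⁻ G x := by
  rw [Real.fourierInv_eq_fourier_neg, Real.fourierInv_eq_fourier_neg,
    Real.fourierInv_eq_fourier_neg]
  exact Real.fourier_mul_convolution_eq hF hG (-x)

lemma ae_eq_of_fourierInv_eq {F G : ℝ → ℂ} (hF : Integrable F) (hF2 : MemLp F 2 volume)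
    (hG : Integrable G) (hG2 : MemLp G 2 volume) (h : ∀ x, 𝓕⁻ F x = 𝓕⁻ G x) :
    F =ᵐ[volume] G := by
  have h1 : (𝓕⁻ (hF2.toLp F : H) : H) = 𝓕⁻ (hG2.toLp G : H) :=
    Lp.ext ((coeFn_fourierInv_toLp hF hF2).trans
      (EventuallyEq.trans (ae_of_all _ h) (coeFn_fourierInv_toLp hG hG2).symm))
  have h2 : hF2.toLp F = hG2.toLp G := by
    have h3 := congrArg (fun f : H => (𝓕 f : H)) h1
    simpa using h3
  exact hF2.coeFn_toLp.symm.trans (h2 ▸ hG2.coeFn_toLp)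

lemma fourierInv_add {F G : ℝ → ℂ} (hF : Integrable F) (hG : Integrable G) (x : ℝ) :
    𝓕⁻ (fun ξ => F ξ + G ξ) x = 𝓕⁻ F x + 𝓕⁻ G x := by
  rw [Real.fourierInv_eq, Real.fourierInv_eq, Real.fourierInv_eq,
    ← integral_add (by simpa using (Real.fourierIntegral_convergent_iff (-x)).2 hF)
      (by simpa using (Real.fourierIntegral_convergent_iff (-x)).2 hG)]
  simp only [smul_add]

lemma fourierInv_const_mul (c : ℂ) (F : ℝ → ℂ) (x : ℝ) :
    𝓕⁻ (fun ξ => c * F ξ) x = c * 𝓕⁻ F x := by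
  rw [Real.fourierInv_eq, Real.fourierInv_eq, ← integral_const_mul]
  refine integral_congr_ae (ae_of_all _ fun ξ => ?_)
  simp only [Circle.smul_def, smul_eq_mul]
  ring

namespace Rep
variable {φ ψ : ℝ → ℝ} {Φ Ψ : ℝ → ℂ}

lemma continuous (h : Rep φ Φ) : Continuous φ := by
  have h1 := continuous_fourierInv h.integrable
  have h2 : φ = fun x => (𝓕⁻ Φ x).re := by
    ext x
    rw [← h.eq x, Complex.ofReal_re]
  rw [h2]
  exact Complex.continuous_re.comp h1

lemma congr (h : Rep φ Φ) (hΦ : Φ =ᵐ[volume] Ψ) : Rep φ Ψ :=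
  ⟨h.1.congr hΦ, h.2.ae_eq hΦ, fun x => by
    rw [h.eq x, Real.fourierInv_congr_ae hΦ]⟩

lemma add (h : Rep φ Φ) (h' : Rep ψ Ψ) : Rep (fun x => φ x + ψ x) fun ξ => Φ ξ + Ψ ξ :=
  ⟨h.1.add h'.1, h.2.add h'.2, fun x => by
    push_cast
    rw [h.eq, h'.eq, fourierInv_add h.1 h'.1]⟩

lemma const_mul (h : Rep φ Φ) (c : ℝ) : Rep (fun x => c * φ x) fun ξ => (c : ℂ) * Φ ξ :=
  ⟨h.1.const_mul _, h.2.const_mul _, fun x => by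
    push_cast
    rw [h.eq, fourierInv_const_mul]⟩

lemma sub (h : Rep φ Φ) (h' : Rep ψ Ψ) : Rep (fun x => φ x - ψ x) fun ξ => Φ ξ - Ψ ξ := by
  have := h.add (h'.const_mul (-1))
  convert this using 2 <;> push_cast <;> ring

lemma mul (h : Rep φ Φ) (h' : Rep ψ Ψ) (hm : MemLp (cv Φ Ψ) 2 volume) :
    Rep (fun x => φ x * ψ x) (cv Φ Ψ) :=
  ⟨Integrable.cv h.1 h'.1, hm, fun x => by
    push_cast
    rw [h.eq, h'.eq, fourierInv_cv h.1 h'.1]⟩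

lemma fourier_eq (h : Rep φ Φ) {f : H} (hf : (f : ℝ → ℂ) =ᵐ[volume] fun x => (φ x : ℂ)) :
    ((𝓕 f : H) : ℝ → ℂ) =ᵐ[volume] Φ := by
  have h1 : f = 𝓕⁻ (h.memLp.toLp Φ : H) := by
    refine Lp.ext (hf.trans ?_)
    refine EventuallyEq.trans ?_ (coeFn_fourierInv_toLp h.integrable h.memLp).symm
    exact ae_of_all _ h.eq
  rw [h1, FourierTransform.fourier_fourierInv_eq]
  exact h.memLp.coeFn_toLp

lemma FT_eq (h : Rep φ Φ) {f : L2} (hf : (f : ℝ → ℝ) =ᵐ[volume] φ) : FT f =ᵐ[volume] Φ :=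
  h.fourier_eq ((coeFn_toComplex f).trans (hf.mono fun x hx => by simp only [hx]))

lemma unique (h : Rep φ Φ) (h' : Rep φ Ψ) : Φ =ᵐ[volume] Ψ :=
  ae_eq_of_fourierInv_eq h.1 h.2 h'.1 h'.2 fun x => (h.eq x).symm.trans (h'.eq x)

lemma enorm_le (h : Rep φ Φ) (x : ℝ) : ‖φ x‖ₑ ≤ ∫⁻ ξ, ‖Φ ξ‖ₑ := by
  have h1 : ‖φ x‖ₑ = ‖𝓕⁻ Φ x‖ₑ := by
    rw [← h.eq x, ← ofReal_norm, ← ofReal_norm, Complex.norm_real]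
  rw [h1, Real.fourierInv_eq]
  refine (enorm_integral_le_lintegral_enorm _).trans_eq ?_
  refine lintegral_congr fun ξ => ?_
  rw [← ofReal_norm, ← ofReal_norm, Circle.norm_smul]

end Rep

lemma exists_rep {f : L2} (h : Integrable (FT f)) :
    ∃ φ : ℝ → ℝ, Rep φ (FT f) ∧ (f : ℝ → ℝ) =ᵐ[volume] φ := by
  have h1 := coeFn_fourierInv_toLp h (memLp_FT f)
  rw [toLp_FT, FourierTransform.fourierInv_fourier_eq] at h1
  have h2 := (coeFn_toComplex f).symm.trans h1
  have hc := continuous_fourierInv h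
  -- The inverse transform is continuous and real almost everywhere, hence real everywhere.
  have him : (fun x => (𝓕⁻ (FT f) x).im) = fun _ => 0 :=
    Continuous.ae_eq_iff_eq volume (Complex.continuous_im.comp hc) continuous_const |>.1
      (h2.mono fun x hx => by simp only [← hx, Complex.ofReal_im, Function.comp])
  refine ⟨fun x => (𝓕⁻ (FT f) x).re, ⟨h, memLp_FT f, fun x => ?_⟩, h2.mono fun x hx => ?_⟩
  · exact Complex.ext (by simp) (by simpa using (congrFun him x).symm)
  · simp only [← hx, Complex.ofReal_re]

/-! ### Products in the Wiener algebra -/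

/-- `φ` has Sobolev norm of order `r` at most `C`. -/
def WB (r : ℝ) (C : ℝ≥0) (φ : ℝ → ℝ) : Prop := ∃ Φ, Rep φ Φ ∧ sN r Φ ≤ C

lemma Rep.sob {r : ℝ} {C : ℝ≥0} {φ : ℝ → ℝ} {Φ : ℝ → ℂ} (h : Rep φ Φ) (h' : sN r Φ ≤ C) :
    Sob r Φ := ⟨h.integrable.1, h'.trans_lt ENNReal.coe_lt_top⟩

lemma WB.add {r : ℝ} {C C' : ℝ≥0} {φ ψ : ℝ → ℝ} (h : WB r C φ) (h' : WB r C' ψ) :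
    WB r (C + C') fun x => φ x + ψ x := by
  obtain ⟨Φ, h1, h2⟩ := h
  obtain ⟨Ψ, h3, h4⟩ := h'
  refine ⟨_, h1.add h3, (sN_add_le h1.1.1 h3.1.1).trans ?_⟩
  rw [ENNReal.coe_add]
  exact add_le_add h2 h4

lemma exists_WB_mul {r : ℝ} (hr : 1 / 2 < r) : ∃ K : ℝ≥0, ∀ {C C' : ℝ≥0} {φ ψ : ℝ → ℝ},
    WB r C φ → WB r C' ψ → WB r (K * (C * C')) fun x => φ x * ψ x := by
  obtain ⟨K, hK⟩ := exists_sN_cv_le hr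
  refine ⟨K, ?_⟩
  rintro C C' φ ψ ⟨Φ, h1, h2⟩ ⟨Ψ, h3, h4⟩
  refine ⟨cv Φ Ψ, h1.mul h3 (((h1.sob h2).cv (h3.sob h4) hr).memLp (by linarith)),
    (hK _ _ h1.1.1 h3.1.1).trans ?_⟩
  push_cast
  gcongr

lemma exists_WB_pow {r : ℝ} (hr : 1 / 2 < r) (M : ℝ≥0) (n : ℕ) : ∃ C : ℝ≥0, ∀ {φ : ℝ → ℝ},
    WB r M φ → WB r C fun x => φ x ^ (n + 1) := by
  obtain ⟨K, hK⟩ := exists_WB_mul hr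
  induction n with
  | zero => exact ⟨M, fun h => by simpa using h⟩
  | succ n ih =>
    obtain ⟨C, hC⟩ := ih
    refine ⟨K * (C * M), fun h => ?_⟩
    simpa only [pow_succ _ (n + 1)] using hK (hC h) h

/-! ### Divided differences of the power nonlinearity -/

/-- The sum `∑ a ^ i * b ^ (n - i)` over `i ≤ n`. -/
def gsum {R : Type*} [CommRing R] : ℕ → R → R → R
  | 0, _, _ => 1
  | n + 1, a, b => a * gsum n a b + b ^ (n + 1)

lemma sub_mul_gsum {R : Type*} [CommRing R] (n : ℕ) (a b : R) :
    (a - b) * gsum n a b = a ^ (n + 1) - b ^ (n + 1) := by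
  induction n with
  | zero => simp [gsum]
  | succ n ih =>
    rw [gsum, mul_add, mul_left_comm, ih]
    ring

lemma gsum_self {R : Type*} [CommRing R] (n : ℕ) (a : R) : gsum n a a = (n + 1) * a ^ n := by
  induction n with
  | zero => simp [gsum]
  | succ n ih =>
    rw [gsum, ih]
    push_cast
    ring

lemma gsum_apply (n : ℕ) (a b : ℝ →ᵇ ℝ) (x : ℝ) : gsum n a b x = gsum n (a x) (b x) := by
  induction n with
  | zero => simp [gsum]
  | succ n ih => simp [gsum, ih]

lemma exists_WB_gsum {r : ℝ} (hr : 1 / 2 < r) (M : ℝ≥0) {n : ℕ} (hn : 1 ≤ n) :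
    ∃ C : ℝ≥0, ∀ {φ ψ : ℝ → ℝ}, WB r M φ → WB r M ψ → WB r C fun x => gsum n (φ x) (ψ x) := by
  obtain ⟨K, hK⟩ := exists_WB_mul hr
  -- The induction must start at 1: for `n = 0` the sum is the constant 1, which lies in no Sobolev
  -- space on the line.
  induction n, hn using Nat.le_induction with
  | base => exact ⟨M + M, fun h h' => by simpa [gsum] using h.add h'⟩
  | succ n hn ih =>
    obtain ⟨C, hC⟩ := ih
    obtain ⟨C', hC'⟩ := exists_WB_pow hr M n
    exact ⟨K * (M * C) + C', fun h h' => (hK h (hC h h')).add (hC' h')⟩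

/-- The derivative of `gsum`. -/
def dgsum {R : Type*} [CommRing R] : ℕ → R → R → R → R → R
  | 0, _, _, _, _ => 0
  | n + 1, a, b, a', b' => a' * gsum n a b + a * dgsum n a b a' b' + (n + 1) * b ^ n * b'

/-- The coefficient `w` of the energy is differentiated in time in the Banach algebra of bounded
continuous functions, where sup bounds are all the energy estimate needs. -/
lemma hasDerivWithinAt_gsum (n : ℕ) {a b : ℝ → ℝ →ᵇ ℝ} {a' b' : ℝ →ᵇ ℝ} {s : Set ℝ} {t : ℝ}
    (ha : HasDerivWithinAt a a' s t) (hb : HasDerivWithinAt b b' s t) :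
    HasDerivWithinAt (fun t => gsum n (a t) (b t)) (dgsum n (a t) (b t) a' b') s t := by
  induction n with
  | zero => exact hasDerivWithinAt_const _ _ _
  | succ n ih =>
    have := (ha.mul ih).add (hb.pow (n + 1))
    simp only [Nat.add_sub_cancel, Nat.cast_add, Nat.cast_one] at this
    exact this

lemma exists_norm_gsum_le (n : ℕ) (M : ℝ) : ∃ C : ℝ, 0 ≤ C ∧ ∀ a b a' b' : ℝ →ᵇ ℝ,
    ‖a‖ ≤ M → ‖b‖ ≤ M → ‖a'‖ ≤ M → ‖b'‖ ≤ M →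
      ‖gsum n a b‖ ≤ C ∧ ‖dgsum n a b a' b'‖ ≤ C := by
  rcases lt_or_ge M 0 with hM | hM
  · exact ⟨0, le_rfl, fun a b a' b' h => absurd ((norm_nonneg a).trans h) (not_le.2 hM)⟩
  induction n with
  | zero => exact ⟨1, zero_le_one, fun a b a' b' _ _ _ _ => by simp [gsum, dgsum]⟩
  | succ n ih =>
    obtain ⟨C, hC, h⟩ := ih
    have hp : 0 ≤ M ^ n := pow_nonneg hM n
    have hnn : (0 : ℝ) ≤ n := n.cast_nonneg
    refine ⟨M * C + M * C + (n + 1) * M ^ n * M, by positivity, fun a b a' b' ha hb ha' hb' => ?_⟩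
    obtain ⟨h1, h2⟩ := h a b a' b' ha hb ha' hb'
    have hb1 : ∀ k : ℕ, ‖b ^ k‖ ≤ M ^ k := fun k =>
      (norm_pow_le b k).trans (pow_le_pow_left₀ (norm_nonneg _) hb k)
    constructor
    · refine (norm_add_le _ _).trans ?_
      have e1 : ‖a * gsum n a b‖ ≤ M * C := (norm_mul_le _ _).trans (by gcongr)
      have e2 := hb1 (n + 1)
      have e3 : M ^ (n + 1) ≤ (n + 1) * M ^ n * M := by
        rw [pow_succ]
        nlinarith [mul_nonneg hp hM]
      nlinarith [mul_nonneg hM hC]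
    · refine (norm_add_le _ _).trans (add_le_add ((norm_add_le _ _).trans (add_le_add ?_ ?_)) ?_)
      · exact (norm_mul_le _ _).trans (by gcongr)
      · exact (norm_mul_le _ _).trans (by gcongr)
      · refine (norm_mul_le _ _).trans (mul_le_mul ((norm_mul_le _ _).trans ?_) hb'
          (norm_nonneg _) (by positivity))
        refine mul_le_mul ?_ (hb1 n) (norm_nonneg _) (by positivity)
        refine (BoundedContinuousFunction.norm_le (by positivity)).2 fun x => ?_
        simp only [BoundedContinuousFunction.coe_add, Pi.add_apply,
          BoundedContinuousFunction.coe_one, Pi.one_apply]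
        rw [BoundedContinuousFunction.coe_natCast]
        simp only [Pi.natCast_apply]
        rw [Real.norm_of_nonneg (by positivity)]

/-- `φ'` is the derivative of `φ`, both in the Wiener algebra. -/
def IsD (r : ℝ) (φ φ' : ℝ → ℂ) : Prop :=
  ∃ Φ, Sob r Φ ∧ (∀ x, φ x = 𝓕⁻ Φ x) ∧ ∀ x, φ' x = 𝓕⁻ (dF Φ) x

/-- The product rule is transported from convolutions by Fourier inversion, so no pointwise
differentiation occurs. The condition on `r` makes the transforms of the derivatives integrable. -/
lemma IsD.mul {r : ℝ} (hr : 3 / 2 < r) {φ φ' ψ ψ' : ℝ → ℂ} (h : IsD r φ φ') (h' : IsD r ψ ψ') :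
    IsD r (fun x => φ x * ψ x) fun x => φ' x * ψ x + φ x * ψ' x := by
  obtain ⟨Φ, s1, h1, h2⟩ := h
  obtain ⟨Ψ, s2, h3, h4⟩ := h'
  have hr' : 1 / 2 < r - 1 := by linarith
  have i1 := s1.integrable (by linarith)
  have i2 := s2.integrable (by linarith)
  have i3 := s1.dF.integrable hr'
  have i4 := s2.dF.integrable hr'
  refine ⟨cv Φ Ψ, s1.cv s2 (by linarith), fun x => ?_, fun x => ?_⟩
  · rw [fourierInv_cv i1 i2, ← h1, ← h3]
  · rw [funext (dF_cv (by linarith) s1 s2), fourierInv_add (Integrable.cv i3 i2)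
      (Integrable.cv i1 i4), fourierInv_cv i3 i2, fourierInv_cv i1 i4, ← h1, ← h2, ← h3, ← h4]

lemma IsD.pow {r : ℝ} (hr : 3 / 2 < r) {φ φ' : ℝ → ℂ} (h : IsD r φ φ') (n : ℕ) :
    IsD r (fun x => φ x ^ (n + 1)) fun x => (n + 1) * φ x ^ n * φ' x := by
  induction n with
  | zero => simpa using h
  | succ n ih =>
    convert ih.mul hr h using 2
    all_goals
      push_cast
      ring

/-! ### Continuous representatives and weighted transforms -/

open Classical in
/-- The bounded continuous representative of `f`. -/
noncomputable def bcf (f : L2) : ℝ →ᵇ ℝ :=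
  if h : ∃ φ : ℝ →ᵇ ℝ, Rep φ (FT f) ∧ (f : ℝ → ℝ) =ᵐ[volume] φ then h.choose else 0

lemma bcf_spec {f : L2} {r : ℝ} (hr : 1 / 2 < r) (hf : Sob r (FT f)) :
    Rep (bcf f) (FT f) ∧ (f : ℝ → ℝ) =ᵐ[volume] bcf f := by
  have hint := hf.integrable hr
  obtain ⟨φ, h1, h2⟩ := exists_rep hint
  have hfin : ∫⁻ ξ, ‖FT f ξ‖ₑ ≠ ∞ := hint.2.ne
  have hb : ∀ x, ‖φ x‖ ≤ (∫⁻ ξ, ‖FT f ξ‖ₑ).toReal := fun x => by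
    rw [← toReal_enorm]
    exact ENNReal.toReal_mono hfin (h1.enorm_le x)
  have h : ∃ φ : ℝ →ᵇ ℝ, Rep φ (FT f) ∧ (f : ℝ → ℝ) =ᵐ[volume] φ :=
    ⟨BoundedContinuousFunction.ofNormedAddCommGroup φ h1.continuous _ hb, h1, h2⟩
  rw [bcf, dif_pos h]
  exact h.choose_spec

lemma Rep.bcf_ext {φ ψ : ℝ →ᵇ ℝ} {Φ : ℝ → ℂ} (h : Rep φ Φ) (h' : Rep ψ Φ) : φ = ψ := by
  ext x
  exact Complex.ofReal_injective ((h.eq x).trans (h'.eq x).symm)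

open Classical in
/-- The weighted Fourier transform `m f̂` as an element of `L²`. -/
noncomputable def wt (m : ℝ → ℝ) (f : L2) : H :=
  if h : MemLp (fun ξ => (m ξ : ℂ) * FT f ξ) 2 volume then h.toLp else 0

lemma coeFn_wt {m : ℝ → ℝ} {f : L2} (h : MemLp (fun ξ => (m ξ : ℂ) * FT f ξ) 2 volume) :
    (wt m f : ℝ → ℂ) =ᵐ[volume] fun ξ => (m ξ : ℂ) * FT f ξ := by
  rw [wt, dif_pos h]
  exact h.coeFn_toLp

lemma enorm_wt {m : ℝ → ℝ} {f : L2} (h : MemLp (fun ξ => (m ξ : ℂ) * FT f ξ) 2 volume) :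
    ‖wt m f‖ₑ = wN m (FT f) := by
  rw [wt, dif_pos h, Lp.enorm_toLp]
  rfl

/-- `L` is linear and bounded on the Sobolev space of order `r`. -/
structure SobLin {X : Type*} [NormedAddCommGroup X] [NormedSpace ℝ X] (r : ℝ) (L : L2 → X) :
    Prop where
  sub : ∀ f g, Sob r (FT f) → Sob r (FT g) → L (f - g) = L f - L g
  smul : ∀ (c : ℝ) f, Sob r (FT f) → L (c • f) = c • L f
  bound : ∃ C : ℝ≥0, ∀ f, Sob r (FT f) → ‖L f‖ₑ ≤ C * sN r (FT f)

lemma Sob.FT_sub {r : ℝ} {f g : L2} (hf : Sob r (FT f)) (hg : Sob r (FT g)) :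
    Sob r (FT (f - g)) :=
  (hf.sub hg).congr (NonlocalElasticity.FT_sub f g).symm

lemma Sob.FT_smul {r : ℝ} {f : L2} (hf : Sob r (FT f)) (c : ℝ) : Sob r (FT (c • f)) :=
  (hf.const_mul c).congr (NonlocalElasticity.FT_smul c f).symm

lemma sobLin_bcf {r : ℝ} (hr : 1 / 2 < r) : SobLin r bcf where
  sub f g hf hg :=
    ((bcf_spec hr (hf.FT_sub hg)).1.congr (FT_sub f g)).bcf_ext
      ((bcf_spec hr hf).1.sub (bcf_spec hr hg).1)
  smul c f hf :=
    ((bcf_spec hr (hf.FT_smul c)).1.congr (FT_smul c f)).bcf_ext ((bcf_spec hr hf).1.const_mul c)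
  bound := by
    obtain ⟨C, hC⟩ := exists_lintegral_enorm_le hr
    refine ⟨C, fun f hf => ?_⟩
    have hfin : ∫⁻ ξ, ‖FT f ξ‖ₑ ≠ ∞ := (hf.integrable hr).2.ne
    refine le_trans ?_ (hC _ hf.meas)
    rw [← ofReal_norm, ← ENNReal.ofReal_toReal hfin]
    refine ENNReal.ofReal_le_ofReal ((BoundedContinuousFunction.norm_le ENNReal.toReal_nonneg).2
      fun x => ?_)
    rw [← toReal_enorm]
    exact ENNReal.toReal_mono hfin ((bcf_spec hr hf).1.enorm_le x)

lemma sobLin_wt {r : ℝ} {m : ℝ → ℝ} (hm : Measurable m) (C : ℝ≥0)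
    (h : ∀ ξ, |m ξ| ≤ C * jb ξ ^ r) : SobLin r (wt m) where
  sub f g hf hg := by
    refine Lp.ext ?_
    filter_upwards [coeFn_wt ((hf.FT_sub hg).memLp_weight hm C h), coeFn_wt (hf.memLp_weight hm C h),
      coeFn_wt (hg.memLp_weight hm C h), Lp.coeFn_sub (wt m f) (wt m g), FT_sub f g]
      with ξ h1 h2 h3 h4 h5
    rw [h1, h4, Pi.sub_apply, h2, h3, h5]
    ring
  smul c f hf := by
    refine Lp.ext ?_
    filter_upwards [coeFn_wt ((hf.FT_smul c).memLp_weight hm C h), coeFn_wt (hf.memLp_weight hm C h),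
      Lp.coeFn_smul c (wt m f), FT_smul c f] with ξ h1 h2 h4 h5
    rw [h1, h4, Pi.smul_apply, h2, h5, Complex.real_smul]
    ring
  bound := by
    refine ⟨C, fun f hf => ?_⟩
    rw [enorm_wt (hf.memLp_weight hm C h)]
    refine wN_mono (FT f) C fun ξ => ?_
    rw [abs_of_nonneg (Real.rpow_nonneg (jb_pos _).le _)]
    exact h ξ

/-! ### Curves -/

lemma sN_le_eSobolevNorm (r : ℝ) (f : L2) : sN r (FT f) ≤ eSobolevNorm r f := by
  rw [eSobolevNorm_eq]
  refine le_mul_of_one_le_left (bot_le) (ENNReal.one_le_rpow ?_ (by norm_num))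
  rw [ENNReal.one_le_ofReal]
  linarith [Real.pi_gt_three]

section
variable {X : Type*} [NormedAddCommGroup X] [NormedSpace ℝ X] {r τ : ℝ} {u u' : ℝ → L2}

lemma SobLin.bound' {L : L2 → X} (hL : SobLin r L) :
    ∃ C : ℝ≥0, ∀ f, Sob r (FT f) → ‖L f‖ₑ ≤ C * eSobolevNorm r f := by
  obtain ⟨C, hC⟩ := hL.bound
  exact ⟨C, fun f hf => (hC f hf).trans (by gcongr; exact sN_le_eSobolevNorm r f)⟩

lemma ContInH.sob (h : ContInH r τ u) {t : ℝ} (ht : t ∈ Icc 0 τ) : Sob r (FT (u t)) :=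
  memH_iff.1 (h.mem t ht)

lemma ContInH.continuousOn (h : ContInH r τ u) {L : L2 → X} (hL : SobLin r L) :
    ContinuousOn (fun t => L (u t)) (Icc 0 τ) := by
  obtain ⟨C, hC⟩ := hL.bound'
  intro t ht
  rw [ContinuousWithinAt, tendsto_iff_norm_sub_tendsto_zero]
  have h1 : Tendsto (fun s => (C : ℝ≥0∞) * eSobolevNorm r (u s - u t)) (𝓝[Icc 0 τ] t) (𝓝 0) := by
    have := ENNReal.Tendsto.const_mul (h.cont t ht) (Or.inr (ENNReal.coe_ne_top (r := C)))
    simpa using this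
  have h2 : Tendsto (fun s => ‖L (u s) - L (u t)‖ₑ) (𝓝[Icc 0 τ] t) (𝓝 0) := by
    refine tendsto_of_tendsto_of_tendsto_of_le_of_le' tendsto_const_nhds h1
      (Eventually.of_forall fun _ => bot_le) ?_
    filter_upwards [self_mem_nhdsWithin] with s hs
    rw [← hL.sub _ _ (h.sob hs) (h.sob ht)]
    exact hC _ ((h.sob hs).FT_sub (h.sob ht))
  have h3 := (ENNReal.tendsto_toReal ENNReal.zero_ne_top).comp h2
  simpa [Function.comp_def] using h3

lemma IsRegularCurve.sob_sub_one (h : IsRegularCurve r τ u u') {t : ℝ} (ht : t ∈ Icc 0 τ) :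
    Sob (r - 1) (FT (u t)) := (h.cont.sob ht).mono (by linarith)

/-- A linear map bounded on the space of order `r - 1` carries the limit of difference quotients to
a derivative in a Banach space. It is applied to the bounded continuous representative and to
weighted transforms. -/
lemma IsRegularCurve.hasDerivWithinAt (h : IsRegularCurve r τ u u') {L : L2 → X}
    (hL : SobLin (r - 1) L) {t : ℝ} (ht : t ∈ Icc 0 τ) :
    HasDerivWithinAt (fun t => L (u t)) (L (u' t)) (Icc 0 τ) t := by
  obtain ⟨C, hC⟩ := hL.bound'
  rw [hasDerivWithinAt_iff_tendsto_slope, tendsto_iff_norm_sub_tendsto_zero]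
  have h1 : Tendsto (fun s => (C : ℝ≥0∞) * eSobolevNorm (r - 1) ((s - t)⁻¹ • (u s - u t) - u' t))
      (𝓝[Icc 0 τ \ {t}] t) (𝓝 0) := by
    have := ENNReal.Tendsto.const_mul (h.hasDeriv t ht) (Or.inr (ENNReal.coe_ne_top (r := C)))
    simpa using this
  have h2 : Tendsto (fun s => ‖slope (fun t => L (u t)) t s - L (u' t)‖ₑ)
      (𝓝[Icc 0 τ \ {t}] t) (𝓝 0) := by
    refine tendsto_of_tendsto_of_tendsto_of_le_of_le' tendsto_const_nhds h1
      (Eventually.of_forall fun _ => bot_le) ?_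
    filter_upwards [self_mem_nhdsWithin] with s hs
    have s1 := h.sob_sub_one hs.1
    have s2 := h.sob_sub_one ht
    have s3 := h.cont_deriv.sob ht
    rw [slope_def_module, ← hL.sub _ _ s1 s2, ← hL.smul _ _ (s1.FT_sub s2),
      ← hL.sub _ _ ((s1.FT_sub s2).FT_smul _) s3]
    exact hC _ (((s1.FT_sub s2).FT_smul _).FT_sub s3)
  have h3 := (ENNReal.tendsto_toReal ENNReal.zero_ne_top).comp h2
  simpa [Function.comp_def] using h3

end

/-! ### Multiplication by bounded functions -/

lemma memLp_bcf_mul (w : ℝ →ᵇ ℝ) (f : H) : MemLp (fun x => (w x : ℂ) * f x) 2 volume := by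
  refine (Lp.memLp f).of_le_mul (c := ‖w‖) ?_ (ae_of_all _ fun x => ?_)
  · exact (Complex.continuous_ofReal.comp w.continuous).aestronglyMeasurable.mul
      (Lp.aestronglyMeasurable f)
  · rw [norm_mul, Complex.norm_real]
    gcongr
    exact w.norm_coe_le_norm x

/-- Multiplication of square integrable functions by bounded continuous ones. -/
noncomputable def mulCLM : (ℝ →ᵇ ℝ) →L[ℝ] H →L[ℝ] H :=
  LinearMap.mkContinuous₂ (LinearMap.mk₂ ℝ (fun w f => (memLp_bcf_mul w f).toLp)
    (fun w w' f => Lp.ext (by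
      filter_upwards [(memLp_bcf_mul (w + w') f).coeFn_toLp, (memLp_bcf_mul w f).coeFn_toLp,
        (memLp_bcf_mul w' f).coeFn_toLp, Lp.coeFn_add (memLp_bcf_mul w f).toLp
          (memLp_bcf_mul w' f).toLp] with x h1 h2 h3 h4
      rw [h1, h4, Pi.add_apply, h2, h3, BoundedContinuousFunction.add_apply]
      push_cast
      ring))
    (fun c w f => Lp.ext (by
      filter_upwards [(memLp_bcf_mul (c • w) f).coeFn_toLp, (memLp_bcf_mul w f).coeFn_toLp,
        Lp.coeFn_smul c (memLp_bcf_mul w f).toLp] with x h1 h2 h4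
      rw [h1, h4, Pi.smul_apply, h2, BoundedContinuousFunction.smul_apply, Complex.real_smul,
        smul_eq_mul]
      push_cast
      ring))
    (fun w f g => Lp.ext (by
      filter_upwards [(memLp_bcf_mul w (f + g)).coeFn_toLp, (memLp_bcf_mul w f).coeFn_toLp,
        (memLp_bcf_mul w g).coeFn_toLp, Lp.coeFn_add (memLp_bcf_mul w f).toLp
          (memLp_bcf_mul w g).toLp, Lp.coeFn_add f g] with x h1 h2 h3 h4 h5
      rw [h1, h4, Pi.add_apply, h2, h3, h5, Pi.add_apply]
      ring))
    (fun c w f => Lp.ext (by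
      filter_upwards [(memLp_bcf_mul w (c • f)).coeFn_toLp, (memLp_bcf_mul w f).coeFn_toLp,
        Lp.coeFn_smul c (memLp_bcf_mul w f).toLp, Lp.coeFn_smul c f] with x h1 h2 h4 h5
      rw [h1, h4, Pi.smul_apply, h2, h5, Pi.smul_apply, Complex.real_smul, Complex.real_smul]
      ring))) 1 (fun w f => by
    rw [one_mul]
    refine Lp.norm_le_mul_norm_of_ae_le_mul ?_
    filter_upwards [(memLp_bcf_mul w f).coeFn_toLp] with x h1
    rw [LinearMap.mk₂_apply, h1, norm_mul, Complex.norm_real]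
    gcongr
    exact w.norm_coe_le_norm x)

lemma coeFn_mulCLM (w : ℝ →ᵇ ℝ) (f : H) :
    (mulCLM w f : ℝ → ℂ) =ᵐ[volume] fun x => (w x : ℂ) * f x :=
  (memLp_bcf_mul w f).coeFn_toLp

lemma norm_mulCLM_le (w : ℝ →ᵇ ℝ) (f : H) : ‖mulCLM w f‖ ≤ ‖w‖ * ‖f‖ := by
  refine Lp.norm_le_mul_norm_of_ae_le_mul ?_
  filter_upwards [coeFn_mulCLM w f] with x h1
  rw [h1, norm_mul, Complex.norm_real]
  gcongr
  exact w.norm_coe_le_norm x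

lemma inner_mulCLM_comm (w : ℝ →ᵇ ℝ) (f g : H) :
    inner ℝ f (mulCLM w g) = inner ℝ g (mulCLM w f) := by
  rw [L2.inner_def, L2.inner_def]
  refine integral_congr_ae ?_
  filter_upwards [coeFn_mulCLM w f, coeFn_mulCLM w g] with x h1 h2
  rw [h1, h2, Complex.inner, Complex.inner]
  simp only [Complex.mul_re, Complex.conj_re, Complex.conj_im, Complex.ofReal_re,
    Complex.ofReal_im, Complex.mul_im]
  ring

/-- The inverse Fourier transform as a real-linear isometry. -/
noncomputable def invF : H →L[ℝ] H :=
  ((Lp.fourierTransformₗᵢ ℝ ℂ).symm.toContinuousLinearEquiv : H →L[ℂ] H).restrictScalars ℝ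

lemma invF_apply (f : H) : invF f = 𝓕⁻ f := rfl

lemma norm_invF (f : H) : ‖invF f‖ = ‖f‖ := (Lp.fourierTransformₗᵢ ℝ ℂ).symm.norm_map f

/-- Plancherel for the real inner product, obtained from the isometry by polarization. -/
lemma inner_invF (f g : H) : inner ℝ (invF f) g = inner ℝ f (𝓕 g) := by
  have h : ∀ a b : H, inner ℝ (invF a) (invF b) = inner ℝ a b := fun a b => by
    rw [real_inner_eq_norm_add_mul_self_sub_norm_mul_self_sub_norm_mul_self_div_two,
      real_inner_eq_norm_add_mul_self_sub_norm_mul_self_sub_norm_mul_self_div_two, ← map_add,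
      norm_invF, norm_invF, norm_invF]
  rw [← h f (𝓕 g), invF_apply (𝓕 g), FourierTransform.fourierInv_fourier_eq]

/-- The quadratic form `⟨x, w y⟩`, with `x` and `y` given on the Fourier side. -/
noncomputable def qf (w : ℝ →ᵇ ℝ) (x y : H) : ℝ := inner ℝ (invF x) (mulCLM w (invF y))

lemma qf_comm (w : ℝ →ᵇ ℝ) (x y : H) : qf w x y = qf w y x := inner_mulCLM_comm _ _ _

lemma qf_add_left (w : ℝ →ᵇ ℝ) (x x' y : H) : qf w (x + x') y = qf w x y + qf w x' y := by
  simp only [qf, map_add, inner_add_left]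

lemma abs_qf_le (w : ℝ →ᵇ ℝ) (x y : H) : |qf w x y| ≤ ‖w‖ * (‖x‖ * ‖y‖) := by
  refine (abs_real_inner_le_norm _ _).trans ?_
  have := norm_mulCLM_le w (invF y)
  rw [norm_invF] at this
  rw [norm_invF]
  nlinarith [norm_nonneg x]

lemma hasDerivWithinAt_qf {w : ℝ → ℝ →ᵇ ℝ} {x : ℝ → H} {w' : ℝ →ᵇ ℝ} {x' : H} {s : Set ℝ} {t : ℝ}
    (hw : HasDerivWithinAt w w' s t) (hx : HasDerivWithinAt x x' s t) :
    HasDerivWithinAt (fun t => qf (w t) (x t) (x t))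
      (2 * qf (w t) x' (x t) + qf w' (x t) (x t)) s t := by
  have h1 : HasDerivWithinAt (fun t => invF (x t)) (invF x') s t :=
    invF.hasFDerivAt.comp_hasDerivWithinAt t hx
  have h2 : HasDerivWithinAt (fun t => mulCLM (w t)) (mulCLM w') s t :=
    mulCLM.hasFDerivAt.comp_hasDerivWithinAt t hw
  have h3 := h1.inner ℝ (h2.clm_apply h1)
  refine h3.congr_deriv ?_
  rw [inner_add_right]
  change qf w' (x t) (x t) + qf (w t) (x t) x' + qf (w t) x' (x t) = _
  rw [qf_comm (w t) (x t) x']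
  ring

lemma fourier_mulCLM {w : ℝ →ᵇ ℝ} {W Φ : ℝ → ℂ} (hw : Rep w W) (hΦ : Integrable Φ)
    (hc : MemLp (cv Φ W) 2 volume) {y : H} (hy : (y : ℝ → ℂ) =ᵐ[volume] Φ) :
    ((𝓕 (mulCLM w (invF y)) : H) : ℝ → ℂ) =ᵐ[volume] cv Φ W := by
  have hΦ2 : MemLp Φ 2 volume := (Lp.memLp y).ae_eq hy
  have e1 : y = hΦ2.toLp Φ := Lp.ext (hy.trans hΦ2.coeFn_toLp.symm)
  have e2 : mulCLM w (invF y) = 𝓕⁻ (hc.toLp (cv Φ W) : H) := by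
    refine Lp.ext ?_
    filter_upwards [coeFn_mulCLM w (invF y), coeFn_fourierInv_toLp hΦ hΦ2,
      coeFn_fourierInv_toLp (Integrable.cv hΦ hw.integrable) hc] with x h1 h2 h3
    rw [h1, h3, fourierInv_cv hΦ hw.integrable, ← hw.eq, mul_comm, ← h2, e1, invF_apply]
  rw [e2, FourierTransform.fourier_fourierInv_eq]
  exact hc.coeFn_toLp

/-! ### The two cancellations in the energy estimate -/

/-- The symbol `k(ξ) · 2πiξ` is purely imaginary, so the real parts of the two integrands are
opposite at every frequency. This is the skew-adjointness of `K∂`. -/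
lemma inner_add_inner_eq_zero {m k : ℝ → ℝ} {p q : ℝ → ℂ} {P Q A B : H}
    (hP : (P : ℝ → ℂ) =ᵐ[volume] fun ξ => (m ξ : ℂ) * p ξ)
    (hQ : (Q : ℝ → ℂ) =ᵐ[volume] fun ξ => (m ξ : ℂ) * q ξ)
    (hA : (A : ℝ → ℂ) =ᵐ[volume] fun ξ => (m ξ : ℂ) * (k ξ * dF q ξ))
    (hB : (B : ℝ → ℂ) =ᵐ[volume] fun ξ => (m ξ : ℂ) * (k ξ * dF p ξ)) :
    inner ℝ P A + inner ℝ Q B = 0 := by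
  rw [L2.inner_def, L2.inner_def, ← integral_add (L2.integrable_inner _ _)
    (L2.integrable_inner _ _)]
  refine (integral_congr_ae ?_).trans (integral_zero _ _)
  filter_upwards [hP, hQ, hA, hB] with ξ h1 h2 h3 h4
  rw [h1, h2, h3, h4, Complex.inner, Complex.inner, dF, dF, dsym_eq]
  simp only [Complex.mul_re, Complex.conj_re, Complex.conj_im, Complex.ofReal_re,
    Complex.ofReal_im, Complex.mul_im, Complex.I_re, Complex.I_im]
  ring

/-- The two convolutions are merged under one integral before absolute values are taken, so that the
kernel estimate `abs_regWeight_mul_sub_le` applies. On its right side one factor carries order `r`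
and the other order 1. -/
lemma enorm_commutator_le {η r : ℝ} (hη : 0 ≤ η) (hr : 1 ≤ r) {p W : ℝ → ℂ}
    (hp : AEStronglyMeasurable p volume) (hW : AEStronglyMeasurable W volume) (ξ : ℝ)
    (h1 : Integrable fun t => dF p t * W (ξ - t))
    (h2 : Integrable fun t => ((regWeight η r t : ℂ) * p t) * W (ξ - t)) :
    ‖(regWeight η r ξ : ℂ) * cv (dF p) W ξ -
        dsym ξ * cv (fun t => (regWeight η r t : ℂ) * p t) W ξ‖ₑ ≤
      ENNReal.ofReal (3 + r * 2 ^ r) *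
        ((∫⁻ t, (ENNReal.ofReal (jb t ^ (1 : ℝ)) * ‖p t‖ₑ) *
            (ENNReal.ofReal (jb (ξ - t) ^ r) * ‖W (ξ - t)‖ₑ)) +
          ∫⁻ t, (ENNReal.ofReal (jb t ^ r) * ‖p t‖ₑ) *
            (ENNReal.ofReal (jb (ξ - t) ^ (1 : ℝ)) * ‖W (ξ - t)‖ₑ)) := by
  have hmw : ∀ b : ℝ, AEMeasurable (fun t => ENNReal.ofReal (jb t ^ b) * ‖p t‖ₑ) volume := fun b =>
    (measurable_jb_rpow b).ennreal_ofReal.aemeasurable.mul hp.enorm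
  have hmW : ∀ b : ℝ, AEMeasurable
      (fun t => ENNReal.ofReal (jb (ξ - t) ^ b) * ‖W (ξ - t)‖ₑ) volume := fun b =>
    ((measurable_jb_rpow b).ennreal_ofReal.aemeasurable.mul hW.enorm).comp_quasiMeasurePreserving
      (Measure.measurePreserving_sub_left volume ξ).quasiMeasurePreserving
  rw [cv_apply, cv_apply, ← integral_const_mul, ← integral_const_mul,
    ← integral_sub (h1.const_mul _) (h2.const_mul _)]
  have hadd : (∫⁻ t, (ENNReal.ofReal (jb t ^ (1 : ℝ)) * ‖p t‖ₑ) *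
            (ENNReal.ofReal (jb (ξ - t) ^ r) * ‖W (ξ - t)‖ₑ)) +
          ∫⁻ t, (ENNReal.ofReal (jb t ^ r) * ‖p t‖ₑ) *
            (ENNReal.ofReal (jb (ξ - t) ^ (1 : ℝ)) * ‖W (ξ - t)‖ₑ) =
      ∫⁻ t, ((ENNReal.ofReal (jb t ^ (1 : ℝ)) * ‖p t‖ₑ) *
            (ENNReal.ofReal (jb (ξ - t) ^ r) * ‖W (ξ - t)‖ₑ) +
          (ENNReal.ofReal (jb t ^ r) * ‖p t‖ₑ) *
            (ENNReal.ofReal (jb (ξ - t) ^ (1 : ℝ)) * ‖W (ξ - t)‖ₑ)) :=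
    (lintegral_add_left' ((hmw 1).mul (hmW r)) _).symm
  rw [hadd, ← lintegral_const_mul' _ _ ENNReal.ofReal_ne_top]
  refine (enorm_integral_le_lintegral_enorm _).trans (lintegral_mono fun t => ?_)
  have e : (regWeight η r ξ : ℂ) * (dF p t * W (ξ - t)) -
      dsym ξ * (((regWeight η r t : ℂ) * p t) * W (ξ - t)) =
      (((regWeight η r ξ * (2 * Real.pi * t) - (2 * Real.pi * ξ) * regWeight η r t : ℝ) : ℂ) *
        Complex.I) * (p t * W (ξ - t)) := by
    rw [dF, dsym_eq, dsym_eq]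
    push_cast
    ring
  have h0 : ∀ x b : ℝ, 0 ≤ jb x ^ b := fun x b => Real.rpow_nonneg (jb_pos x).le b
  have hk : ‖((regWeight η r ξ * (2 * Real.pi * t) - (2 * Real.pi * ξ) * regWeight η r t : ℝ) : ℂ) *
        Complex.I‖ₑ ≤ ENNReal.ofReal (3 + r * 2 ^ r) *
      (ENNReal.ofReal (jb (ξ - t) ^ r) * ENNReal.ofReal (jb t ^ (1 : ℝ)) +
        ENNReal.ofReal (jb (ξ - t) ^ (1 : ℝ)) * ENNReal.ofReal (jb t ^ r)) := by
    rw [← ofReal_norm, norm_mul, Complex.norm_I, mul_one, Complex.norm_real,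
      ← ENNReal.ofReal_mul (h0 _ _), ← ENNReal.ofReal_mul (h0 _ _),
      ← ENNReal.ofReal_add (mul_nonneg (h0 _ _) (h0 _ _)) (mul_nonneg (h0 _ _) (h0 _ _)),
      ← ENNReal.ofReal_mul (by positivity)]
    refine ENNReal.ofReal_le_ofReal ?_
    rw [Real.rpow_one, Real.rpow_one]
    exact abs_regWeight_mul_sub_le hη hr ξ t
  rw [e, enorm_mul _ (p t * W (ξ - t)), enorm_mul (p t)]
  refine (mul_le_mul_left hk _).trans_eq ?_
  ring

lemma lintegral_enorm_mul_le (Q : H) {Z : ℝ → ℝ≥0∞} (hZ : AEMeasurable Z) :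
    ∫⁻ ξ, ‖Q ξ‖ₑ * Z ξ ≤ ‖Q‖ₑ * eLpNorm Z 2 volume := by
  have hc : (2 : ℝ).HolderConjugate 2 := by
    constructor <;> norm_num
  have := ENNReal.lintegral_mul_le_Lp_mul_Lq volume hc (Lp.aestronglyMeasurable Q).enorm hZ
  refine this.trans_eq ?_
  have h1 : ‖Q‖ₑ = eLpNorm (fun ξ => ‖Q ξ‖ₑ) 2 volume := by
    rw [Lp.enorm_def]
    exact eLpNorm_congr_enorm_ae (ae_of_all _ fun ξ => by simp)
  rw [h1, eLpNorm_two_eq, eLpNorm_two_eq]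
  simp only [ENNReal.rpow_two]

/-- The commutator estimate. -/
lemma exists_commutator_estimate {r : ℝ} (hr : 3 / 2 < r) : ∃ C : ℝ≥0,
    ∀ {η R : ℝ} {C' K : ℝ≥0} {k : ℝ → ℝ} {p q W : ℝ → ℂ} {w : ℝ →ᵇ ℝ} {P Q A N : H}, 0 ≤ η →
      r ≤ R → 5 / 2 < R → (∀ ξ, |regWeight η r ξ| ≤ C' * jb ξ ^ (R - 1)) → (∀ ξ, |k ξ| ≤ K) →
      Sob R p → Sob R W → Rep w W →
      (P : ℝ → ℂ) =ᵐ[volume] (fun ξ => (regWeight η r ξ : ℂ) * p ξ) →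
      (Q : ℝ → ℂ) =ᵐ[volume] (fun ξ => (regWeight η r ξ : ℂ) * q ξ) →
      (A : ℝ → ℂ) =ᵐ[volume] (fun ξ => (regWeight η r ξ : ℂ) * (k ξ * dF q ξ)) →
      (N : ℝ → ℂ) =ᵐ[volume] (fun ξ => (regWeight η r ξ : ℂ) * (k ξ * cv (dF p) W ξ)) →
      ‖inner ℝ Q N + qf w A P‖ₑ ≤ C * K * ‖Q‖ₑ * (sN r p * sN r W) := by
  obtain ⟨C₁, hC₁⟩ := exists_lintegral_jb_mul_le (a := 1) (r := r) (by linarith)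
  refine ⟨Real.toNNReal (3 + r * 2 ^ r) * (C₁ + C₁), ?_⟩
  intro η R C' K k p q W w P Q A N hη hrR hR hm hk hp hW hw hP hQ hA hN
  set m := regWeight η r with hmdef
  have hmmeas : Measurable m := (continuous_regWeight η r).measurable
  -- The weight costs at most `R - 1` derivatives, so `m p` keeps one derivative; this makes its
  -- product with `w` a genuine convolution of integrable functions.
  have hmp : Sob 1 fun ξ => (m ξ : ℂ) * p ξ := by
    refine hp.of_le (measurable_weight hmmeas hp.meas) C' (ae_of_all _ fun ξ => ?_)
    rw [norm_mul, Complex.norm_real]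
    exact mul_le_mul_of_nonneg_right (hm ξ) (norm_nonneg _)
  have hcv : MemLp (cv (fun ξ => (m ξ : ℂ) * p ξ) W) 2 volume :=
    (hmp.cv (hW.mono (by linarith)) (by norm_num)).memLp zero_le_one
  have hZ := fourier_mulCLM hw (hmp.integrable (by norm_num)) hcv hP
  set Z : H := 𝓕 (mulCLM w (invF P))
  have hdp : MemLp (dF p) 2 volume := hp.dF.memLp (by linarith)
  have hW2 : MemLp W 2 volume := hW.memLp (by linarith)
  set f₁ : ℝ → ℝ≥0∞ := fun t => ENNReal.ofReal (jb t ^ (1 : ℝ)) * ‖p t‖ₑ with hf₁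
  set f₂ : ℝ → ℝ≥0∞ := fun t => ENNReal.ofReal (jb t ^ r) * ‖p t‖ₑ with hf₂
  set g₁ : ℝ → ℝ≥0∞ := fun t => ENNReal.ofReal (jb t ^ (1 : ℝ)) * ‖W t‖ₑ with hg₁
  set g₂ : ℝ → ℝ≥0∞ := fun t => ENNReal.ofReal (jb t ^ r) * ‖W t‖ₑ with hg₂
  have mw : ∀ (b : ℝ) {F : ℝ → ℂ}, AEStronglyMeasurable F volume →
      AEMeasurable (fun t => ENNReal.ofReal (jb t ^ b) * ‖F t‖ₑ) volume := fun b F hF =>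
    (measurable_jb_rpow b).ennreal_ofReal.aemeasurable.mul hF.enorm
  have mf₁ : AEMeasurable f₁ := mw 1 hp.meas
  have mf₂ : AEMeasurable f₂ := mw r hp.meas
  have mg₁ : AEMeasurable g₁ := mw 1 hW.meas
  have mg₂ : AEMeasurable g₂ := mw r hW.meas
  set Y : ℝ → ℝ≥0∞ := fun ξ => (∫⁻ t, f₁ t * g₂ (ξ - t)) + ∫⁻ t, f₂ t * g₁ (ξ - t) with hY
  have mY₁ := aestronglyMeasurable_lintegral_conv mf₁ mg₂
  have mY₂ := aestronglyMeasurable_lintegral_conv mf₂ mg₁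
  have key : ∀ᵐ ξ, ‖inner ℝ (Q ξ) (N ξ) + inner ℝ (A ξ) (Z ξ)‖ₑ ≤
      (Real.toNNReal (3 + r * 2 ^ r) * K : ℝ≥0) * (‖Q ξ‖ₑ * Y ξ) := by
    filter_upwards [hQ, hA, hN, hZ] with ξ h1 h2 h3 h4
    -- Integration by parts at one frequency: conjugating `dsym` changes its sign, which moves the
    -- derivative in `A` onto `Z` and leaves `k` as a common factor outside the commutator.
    have e : inner ℝ (Q ξ) (N ξ) + inner ℝ (A ξ) (Z ξ) =
        ((starRingEnd ℂ) (Q ξ) * ((k ξ : ℂ) * ((m ξ : ℂ) * cv (dF p) W ξ -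
          dsym ξ * cv (fun t => (m t : ℂ) * p t) W ξ))).re := by
      rw [h1, h2, h3, h4, Complex.inner, Complex.inner, ← Complex.add_re]
      congr 1
      simp only [dF, map_mul, Complex.conj_ofReal, conj_dsym]
      ring
    rw [e, ← ofReal_norm, Real.norm_eq_abs]
    refine (ENNReal.ofReal_le_ofReal (Complex.abs_re_le_norm _)).trans ?_
    rw [ofReal_norm, enorm_mul, enorm_mul]
    have e1 : ‖(starRingEnd ℂ) (Q ξ)‖ₑ = ‖Q ξ‖ₑ := by
      rw [← ofReal_norm, RCLike.norm_conj, ofReal_norm]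
    have e2 : ‖(k ξ : ℂ)‖ₑ ≤ K := by
      rw [← ofReal_norm, Complex.norm_real, ← ENNReal.ofReal_coe_nnreal]
      exact ENNReal.ofReal_le_ofReal (hk ξ)
    have e3 := enorm_commutator_le hη (by linarith : 1 ≤ r) hp.meas hW.meas ξ
      (integrable_mul_sub hdp hW2 ξ) (integrable_mul_sub (hmp.memLp zero_le_one) hW2 ξ)
    calc _ ≤ ‖Q ξ‖ₑ * (K * (ENNReal.ofReal (3 + r * 2 ^ r) * Y ξ)) := by
          rw [e1]
          gcongr
      _ = _ := by
          rw [ENNReal.coe_mul, ENNReal.ofReal]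
          ring
  have hYn : eLpNorm Y 2 volume ≤ (C₁ + C₁) * (sN r p * sN r W) := by
    refine (eLpNorm_add_le mY₁ mY₂ one_le_two).trans ?_
    -- In each convolution the factor with weight of order 1 goes into `L¹`, which is where `r >
    -- 3/2` is used, and the other into `L²`.
    have b1 : eLpNorm (fun ξ => ∫⁻ t, f₁ t * g₂ (ξ - t)) 2 volume ≤ (C₁ * sN r p) * sN r W := by
      refine (eLpNorm_conv_le mf₁ mg₂).trans ?_
      rw [sN_eq r W]
      gcongr
      exact hC₁ p hp.meas
    have b2 : eLpNorm (fun ξ => ∫⁻ t, f₂ t * g₁ (ξ - t)) 2 volume ≤ sN r p * (C₁ * sN r W) := by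
      refine (eLpNorm_conv_le' mf₂ mg₁).trans ?_
      rw [sN_eq r p]
      gcongr
      exact hC₁ W hW.meas
    refine (add_le_add b1 b2).trans_eq ?_
    ring
  have hmY : AEMeasurable Y := mY₁.aemeasurable.add mY₂.aemeasurable
  have hsum : inner ℝ Q N + qf w A P = ∫ ξ, (inner ℝ (Q ξ) (N ξ) + inner ℝ (A ξ) (Z ξ)) := by
    rw [qf, inner_invF, L2.inner_def, L2.inner_def, ← integral_add (L2.integrable_inner _ _)
      (L2.integrable_inner _ _)]
  rw [hsum]
  calc _ ≤ ∫⁻ ξ, ‖inner ℝ (Q ξ) (N ξ) + inner ℝ (A ξ) (Z ξ)‖ₑ := enorm_integral_le_lintegral_enorm _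
    _ ≤ ∫⁻ ξ, (Real.toNNReal (3 + r * 2 ^ r) * K : ℝ≥0) * (‖Q ξ‖ₑ * Y ξ) := lintegral_mono_ae key
    _ ≤ (Real.toNNReal (3 + r * 2 ^ r) * K : ℝ≥0) * (‖Q‖ₑ * ((C₁ + C₁) * (sN r p * sN r W))) := by
        rw [lintegral_const_mul' _ _ ENNReal.coe_ne_top]
        gcongr
        exact (lintegral_enorm_mul_le Q hmY).trans (by gcongr)
    _ = _ := by
        push_cast
        ring

/-! ### The common form of the two systems -/

/-- `u_t = K v_x`, `v_t = K (u + εⁿ u^{n+1})_x` on the Fourier side, for a multiplier `K` with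
symbol `k`. -/
structure Sol (k : ℝ → ℝ) (n : ℕ) (ε R τ : ℝ) (u v u' v' : ℝ → L2) : Prop where
  ucurve : IsRegularCurve R τ u u'
  vcurve : IsRegularCurve R τ v v'
  eq_u : ∀ t ∈ Icc 0 τ, FT (u' t) =ᵐ[volume] fun ξ => k ξ * dF (FT (v t)) ξ
  eq_v : ∀ t ∈ Icc 0 τ, ∃ A, Rep (fun x => bcf (u t) x ^ (n + 1)) A ∧
    FT (v' t) =ᵐ[volume] fun ξ => k ξ * dF (fun ξ => FT (u t) ξ + ((ε ^ n : ℝ) : ℂ) * A ξ) ξ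

lemma WB_bcf {f : L2} {r : ℝ} (hr : 1 / 2 < r) (hf : Sob r (FT f)) {M : ℝ≥0}
    (h : sN r (FT f) ≤ M) : WB r M (bcf f) := ⟨_, (bcf_spec hr hf).1, h⟩

lemma exists_rep_pow {f : L2} {r : ℝ} (hr : 1 / 2 < r) (hf : Sob r (FT f)) (n : ℕ) :
    ∃ A, Rep (fun x => bcf f x ^ (n + 1)) A ∧ Sob r A := by
  obtain ⟨C, hC⟩ := exists_WB_pow hr (sN r (FT f)).toNNReal n
  obtain ⟨A, h1, h2⟩ := hC (WB_bcf hr hf (ENNReal.coe_toNNReal hf.2.ne).ge)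
  exact ⟨A, h1, h1.sob h2⟩

lemma isD_bcf {f : L2} {r : ℝ} (hr : 1 / 2 < r) (hf : Sob r (FT f)) :
    IsD r (fun x => (bcf f x : ℂ)) (𝓕⁻ (dF (FT f))) :=
  ⟨FT f, hf, (bcf_spec hr hf).1.eq, fun _ => rfl⟩

lemma IsNonlocalSolution.exists_sol {β : SignedMeasure ℝ} {n : ℕ} {ε δ R τ : ℝ} {u₀ v₀ : L2}
    {u v : ℝ → L2} (hR : 1 / 2 < R) (h : IsNonlocalSolution β n ε δ R τ u₀ v₀ u v) :
    ∃ u' v', Sol (fun ξ => kernelSymbol β (δ * (2 * Real.pi * ξ))) n ε R τ u v u' v' := by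
  obtain ⟨-, -, u', v', hu, hv, heq⟩ := h
  refine ⟨u', v', hu, hv, fun t ht => ?_, fun t ht => ?_⟩
  · obtain ⟨⟨vx, h1, h2⟩, -⟩ := heq t ht
    filter_upwards [FT_of_isKApply h2, FT_of_isWeakDeriv h1] with ξ e1 e2
    rw [e1, e2]
  · obtain ⟨-, w, wx, hw, h1, h2⟩ := heq t ht
    have hs := hu.cont.sob ht
    obtain ⟨A, hA, -⟩ := exists_rep_pow hR hs n
    obtain ⟨hrep, hae⟩ := bcf_spec hR hs
    have hwA : FT w =ᵐ[volume] fun ξ => FT (u t) ξ + ((ε ^ n : ℝ) : ℂ) * A ξ := by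
      refine (hrep.add (hA.const_mul (ε ^ n))).FT_eq ?_
      filter_upwards [hw, hae] with x e1 e2
      rw [e1, e2]
    refine ⟨A, hA, ?_⟩
    filter_upwards [FT_of_isKApply h2, FT_of_isWeakDeriv h1, dF_congr hwA] with ξ e1 e2 e3
    rw [e1, e2, e3]

/-- The chain rule puts `(1 + (n+1) εⁿ uⁿ) u_x` into divergence form, so the classical system is the
case of symbol 1. -/
lemma IsClassicalSolution.exists_sol {n : ℕ} {ε R τ : ℝ} {u₀ v₀ : L2} {u v : ℝ → L2}
    (hR : 3 / 2 < R) (h : IsClassicalSolution n ε R τ u₀ v₀ u v) :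
    ∃ u' v', Sol (fun _ => 1) n ε R τ u v u' v' := by
  obtain ⟨-, -, u', v', hu, hv, heq⟩ := h
  refine ⟨u', v', hu, hv, fun t ht => ?_, fun t ht => ?_⟩
  · filter_upwards [FT_of_isWeakDeriv (heq t ht).1] with ξ e1
    rw [e1, Complex.ofReal_one, one_mul]
  · obtain ⟨-, ux, h1, h2⟩ := heq t ht
    have hs := hu.cont.sob ht
    have hR' : 1 / 2 < R := by linarith
    obtain ⟨A, hA, hAs⟩ := exists_rep_pow hR' hs n
    obtain ⟨hrep, hae⟩ := bcf_spec hR' hs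
    have hux : Sob (R - 1) (FT ux) := hs.dF.congr (FT_of_isWeakDeriv h1).symm
    obtain ⟨hrepx, haex⟩ := bcf_spec (by linarith) hux
    obtain ⟨Φ, sΦ, e1, e2⟩ := (isD_bcf hR' hs).pow hR n
    have hAΦ : A =ᵐ[volume] Φ := ae_eq_of_fourierInv_eq hA.1 hA.2 (sΦ.integrable hR')
      (sΦ.memLp (by linarith)) fun x => by
        rw [← hA.eq x, ← e1 x]
        push_cast
        rfl
    have hdΦ : Sob (R - 1) (dF Φ) := sΦ.dF
    have hdi := hdΦ.integrable (by linarith)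
    have hrep2 : Rep (fun x => (n + 1) * bcf (u t) x ^ n * bcf ux x) (dF Φ) := by
      refine ⟨hdi, hdΦ.memLp (by linarith), fun x => ?_⟩
      rw [← e2 x]
      beta_reduce
      rw [← Real.fourierInv_congr_ae (FT_of_isWeakDeriv h1), ← hrepx.eq x]
      push_cast
      rfl
    have hv' : FT (v' t) =ᵐ[volume] fun ξ => FT ux ξ + ((ε ^ n : ℝ) : ℂ) * dF Φ ξ := by
      refine (hrepx.add (hrep2.const_mul (ε ^ n))).FT_eq ?_
      filter_upwards [h2, hae, haex] with x e1 e2 e3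
      rw [e1, e2, e3]
      ring
    refine ⟨A, hA, ?_⟩
    filter_upwards [hv', FT_of_isWeakDeriv h1, hAΦ] with ξ e1 e2 e3
    rw [e1, e2, dF, dF, dF, e3]
    push_cast
    ring

lemma Sol.mono {k : ℝ → ℝ} {n : ℕ} {ε R τ τ' : ℝ} {u v u' v' : ℝ → L2}
    (h : Sol k n ε R τ u v u' v') (hτ : τ' ≤ τ) : Sol k n ε R τ' u v u' v' := by
  have hs : Icc 0 τ' ⊆ Icc 0 τ := Icc_subset_Icc_right hτ
  have hc : ∀ {r : ℝ} {w : ℝ → L2}, ContInH r τ w → ContInH r τ' w := fun h =>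
    ⟨fun t ht => h.mem t (hs ht), fun t ht => (h.cont t (hs ht)).mono_left (nhdsWithin_mono _ hs)⟩
  have hr : ∀ {w w' : ℝ → L2}, IsRegularCurve R τ w w' → IsRegularCurve R τ' w w' := fun h =>
    ⟨hc h.cont, hc h.cont_deriv, fun t ht => (h.hasDeriv t (hs ht)).mono_left
      (nhdsWithin_mono _ (sdiff_subset_sdiff_left hs))⟩
  exact ⟨hr h.ucurve, hr h.vcurve, fun t ht => h.eq_u t (hs ht), fun t ht => h.eq_v t (hs ht)⟩

/-- The chain rule on the Fourier side. -/
lemma dF_eq_cv_of_rep_pow {f : L2} {R : ℝ} (hR : 3 / 2 < R) (hf : Sob R (FT f)) {n : ℕ}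
    {A W : ℝ → ℂ} (hA : Rep (fun x => bcf f x ^ (n + 1)) A)
    (hW : Rep (gsum n (bcf f) (bcf f) : ℝ →ᵇ ℝ) W) (hWs : Sob R W) :
    dF A =ᵐ[volume] cv (dF (FT f)) W := by
  have hR' : 1 / 2 < R := by linarith
  obtain ⟨Φ, sΦ, e1, e2⟩ := (isD_bcf hR' hf).pow hR n
  have hAΦ : A =ᵐ[volume] Φ := ae_eq_of_fourierInv_eq hA.1 hA.2 (sΦ.integrable hR')
    (sΦ.memLp (by linarith)) fun x => by
      rw [← hA.eq x, ← e1 x]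
      push_cast
      rfl
  have h1 : 1 / 2 < R - 1 := by linarith
  have s2 : Sob (R - 1) (cv (dF (FT f)) W) := hf.dF.cv (hWs.mono (by linarith)) h1
  refine (dF_congr hAΦ).trans (ae_eq_of_fourierInv_eq (sΦ.dF.integrable h1)
    (sΦ.dF.memLp (by linarith)) (s2.integrable h1) (s2.memLp (by linarith)) fun x => ?_)
  rw [fourierInv_cv (hf.dF.integrable h1) hW.1, ← e2 x, ← hW.eq x, gsum_apply, gsum_self]
  push_cast
  ring

/-! ### The energy -/

/-- The energy. -/
noncomputable def en (e : ℝ) (w : ℝ →ᵇ ℝ) (P Q : H) : ℝ := ‖P‖ ^ 2 + ‖Q‖ ^ 2 + e * qf w P P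

lemma hasDerivWithinAt_en (e : ℝ) {w : ℝ → ℝ →ᵇ ℝ} {P Q : ℝ → H} {w' : ℝ →ᵇ ℝ} {P' Q' : H}
    {s : Set ℝ} {t : ℝ} (hw : HasDerivWithinAt w w' s t) (hP : HasDerivWithinAt P P' s t)
    (hQ : HasDerivWithinAt Q Q' s t) :
    HasDerivWithinAt (fun t => en e (w t) (P t) (Q t))
      (2 * inner ℝ (P t) P' + 2 * inner ℝ (Q t) Q' +
        e * (2 * qf (w t) P' (P t) + qf w' (P t) (P t))) s t :=
  (hP.norm_sq.add hQ.norm_sq).add ((hasDerivWithinAt_qf hw hP).const_mul e)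

lemma abs_mul_qf_le {e : ℝ} (he : 0 ≤ e) {w : ℝ →ᵇ ℝ} (hw : e * ‖w‖ ≤ 1 / 2) (x y : H) :
    |e * qf w x y| ≤ 1 / 2 * (‖x‖ * ‖y‖) := by
  rw [abs_mul, abs_of_nonneg he]
  calc e * |qf w x y| ≤ e * (‖w‖ * (‖x‖ * ‖y‖)) := by
        gcongr
        exact abs_qf_le w x y
    _ = (e * ‖w‖) * (‖x‖ * ‖y‖) := by ring
    _ ≤ _ := by gcongr

lemma le_en {e : ℝ} (he : 0 ≤ e) {w : ℝ →ᵇ ℝ} (hw : e * ‖w‖ ≤ 1 / 2) (P Q : H) :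
    1 / 2 * (‖P‖ ^ 2 + ‖Q‖ ^ 2) ≤ en e w P Q := by
  have := abs_le.1 (abs_mul_qf_le he hw P P)
  unfold en
  nlinarith [sq_nonneg ‖Q‖, sq_nonneg ‖P‖]

lemma en_le {e : ℝ} (he : 0 ≤ e) {w : ℝ →ᵇ ℝ} (hw : e * ‖w‖ ≤ 1 / 2) (P Q : H) :
    en e w P Q ≤ 3 / 2 * (‖P‖ ^ 2 + ‖Q‖ ^ 2) := by
  have := abs_le.1 (abs_mul_qf_le he hw P P)
  unfold en
  nlinarith [sq_nonneg ‖Q‖, sq_nonneg ‖P‖]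

lemma enorm_le_of_coeFn {m : ℝ → ℝ} {F : ℝ → ℂ} {x : H}
    (h : (x : ℝ → ℂ) =ᵐ[volume] fun ξ => (m ξ : ℂ) * F ξ) : ‖x‖ₑ = wN m F := by
  rw [Lp.enorm_def]
  exact eLpNorm_congr_ae h

lemma norm_le_of_coeFn_regWeight {η r : ℝ} {F : ℝ → ℂ} {x : H} {γ : ℝ≥0}
    (h : (x : ℝ → ℂ) =ᵐ[volume] fun ξ => (regWeight η r ξ : ℂ) * F ξ) (hF : sN r F ≤ γ) :
    ‖x‖ ≤ γ := by
  have h1 : ‖x‖ₑ ≤ γ := by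
    rw [enorm_le_of_coeFn h]
    refine le_trans ?_ hF
    have := wN_mono (m := regWeight η r) (m' := fun ξ => jb ξ ^ r) F 1 fun ξ => by
      rw [abs_of_nonneg (regWeight_nonneg _ _ _),
        abs_of_nonneg (Real.rpow_nonneg (jb_pos _).le _), NNReal.coe_one, one_mul]
      exact regWeight_le η r ξ
    simpa [sN] using this
  exact_mod_cast enorm_le_coe.1 h1

/-- The energy estimate at a fixed time. -/
lemma exists_energy_estimate {r : ℝ} (hr : 3 / 2 < r) : ∃ C : ℝ≥0,
    ∀ {η R e : ℝ} {C' K a b γ₁ γ₂ : ℝ≥0} {k : ℝ → ℝ} {p q W g₁ g₂ : ℝ → ℂ} {w w' : ℝ →ᵇ ℝ}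
      {P Q P' Q' : H}, 0 ≤ η → r ≤ R → 5 / 2 < R →
      (∀ ξ, |regWeight η r ξ| ≤ C' * jb ξ ^ (R - 1)) → Measurable k → (∀ ξ, |k ξ| ≤ K) →
      Sob R p → Sob R q → Sob R W → Sob (R - 1) g₁ → Sob (R - 1) g₂ → Rep w W →
      sN r p ≤ a → sN r W ≤ b → sN r g₁ ≤ γ₁ → sN r g₂ ≤ γ₂ → 0 ≤ e → e * ‖w‖ ≤ 1 / 2 →
      (P : ℝ → ℂ) =ᵐ[volume] (fun ξ => (regWeight η r ξ : ℂ) * p ξ) →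
      (Q : ℝ → ℂ) =ᵐ[volume] (fun ξ => (regWeight η r ξ : ℂ) * q ξ) →
      (P' : ℝ → ℂ) =ᵐ[volume] (fun ξ => (regWeight η r ξ : ℂ) * (k ξ * dF q ξ + g₁ ξ)) →
      (Q' : ℝ → ℂ) =ᵐ[volume] (fun ξ => (regWeight η r ξ : ℂ) *
        (k ξ * dF p ξ + (e : ℂ) * (k ξ * cv (dF p) W ξ) + g₂ ξ)) →
      2 * inner ℝ P P' + 2 * inner ℝ Q Q' + e * (2 * qf w P' P + qf w' P P) ≤
        2 * e * (C * K * ‖Q‖ * (a * b)) + 2 * ‖Q‖ * γ₂ + 3 * ‖P‖ * γ₁ + e * (‖w'‖ * ‖P‖ ^ 2) := by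
  obtain ⟨C, hC⟩ := exists_commutator_estimate hr
  refine ⟨C, ?_⟩
  intro η R e C' K a b γ₁ γ₂ k p q W g₁ g₂ w w' P Q P' Q' hη hrR hR hm hkm hk hp hq hW hg₁ hg₂ hw
    ha hb hγ₁ hγ₂ he hew hP hQ hP' hQ'
  have hmm : Measurable (regWeight η r) := (continuous_regWeight η r).measurable
  have hks : ∀ {F : ℝ → ℂ}, Sob (R - 1) F → Sob (R - 1) fun ξ => (k ξ : ℂ) * F ξ := fun {F} hF =>
    hF.of_le (measurable_weight hkm hF.meas) K (ae_of_all _ fun ξ => by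
      rw [norm_mul, Complex.norm_real, sub_self, Real.rpow_zero, mul_one]
      exact mul_le_mul_of_nonneg_right (hk ξ) (norm_nonneg _))
  have toH : ∀ {F : ℝ → ℂ}, Sob (R - 1) F →
      ∃ x : H, (x : ℝ → ℂ) =ᵐ[volume] fun ξ => (regWeight η r ξ : ℂ) * F ξ := fun hF =>
    ⟨(hF.memLp_weight hmm C' hm).toLp, (hF.memLp_weight hmm C' hm).coeFn_toLp⟩
  obtain ⟨A, hA⟩ := toH (hks hq.dF)
  obtain ⟨B, hB⟩ := toH (hks hp.dF)
  obtain ⟨N, hN⟩ := toH (hks (hp.dF.cv (hW.mono (by linarith)) (by linarith)))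
  obtain ⟨G₁, hG₁⟩ := toH hg₁
  obtain ⟨G₂, hG₂⟩ := toH hg₂
  have eP : P' = A + G₁ := by
    refine Lp.ext ?_
    filter_upwards [hP', hA, hG₁, Lp.coeFn_add A G₁] with ξ e1 e2 e3 e4
    rw [e1, e4, Pi.add_apply, e2, e3]
    ring
  have eQ : Q' = B + e • N + G₂ := by
    refine Lp.ext ?_
    filter_upwards [hQ', hB, hN, hG₂, Lp.coeFn_add (B + e • N) G₂, Lp.coeFn_add B (e • N),
      Lp.coeFn_smul e N] with ξ e1 e2 e3 e4 e5 e6 e7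
    rw [e1, e5, Pi.add_apply, e6, Pi.add_apply, e7, Pi.smul_apply, e2, e3, e4, Complex.real_smul]
    ring
  have h0 := inner_add_inner_eq_zero hP hQ hA hB
  have h1 : |inner ℝ Q N + qf w A P| ≤ C * K * ‖Q‖ * (a * b) := by
    have h2 : ‖inner ℝ Q N + qf w A P‖ₑ ≤ ((C * K * ‖Q‖₊ * (a * b) : ℝ≥0) : ℝ≥0∞) := by
      refine (hC hη hrR hR hm hk hp hW hw hP hQ hA hN).trans ?_
      push_cast
      rw [← enorm_eq_nnnorm]
      gcongr
    have h3 := enorm_le_coe.1 h2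
    rw [← Real.norm_eq_abs]
    exact_mod_cast h3
  have n1 : ‖G₁‖ ≤ γ₁ := norm_le_of_coeFn_regWeight hG₁ hγ₁
  have n2 : ‖G₂‖ ≤ γ₂ := norm_le_of_coeFn_regWeight hG₂ hγ₂
  have i1 : inner ℝ P G₁ ≤ ‖P‖ * γ₁ := (real_inner_le_norm _ _).trans (by gcongr)
  have i2 : inner ℝ Q G₂ ≤ ‖Q‖ * γ₂ := (real_inner_le_norm _ _).trans (by gcongr)
  -- This term occurs twice in the derivative, so with the contribution of `i1` the factor of `‖P‖
  -- γ₁` becomes 3.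
  have i3 : e * qf w G₁ P ≤ 1 / 2 * (‖P‖ * γ₁) := by
    refine (le_abs_self _).trans ((abs_mul_qf_le he hew G₁ P).trans ?_)
    rw [mul_comm ‖G₁‖]
    gcongr
  have i4 : e * qf w' P P ≤ e * (‖w'‖ * ‖P‖ ^ 2) := by
    refine mul_le_mul_of_nonneg_left ((le_abs_self _).trans ((abs_qf_le w' P P).trans_eq ?_)) he
    ring
  have i5 : e * (inner ℝ Q N + qf w A P) ≤ e * (C * K * ‖Q‖ * (a * b)) :=
    mul_le_mul_of_nonneg_left ((le_abs_self _).trans h1) he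
  rw [eP, eQ, qf_add_left, inner_add_right, inner_add_right, inner_add_right, inner_smul_right]
  linarith

/-! ### Differential inequalities -/

lemma le_add_mul_of_hasDerivWithinAt_le {E E' : ℝ → ℝ} {τ c : ℝ}
    (hE : ∀ t ∈ Icc 0 τ, HasDerivWithinAt E (E' t) (Icc 0 τ) t) (hc : ∀ t ∈ Icc 0 τ, E' t ≤ c)
    {t : ℝ} (ht : t ∈ Icc 0 τ) : E t ≤ E 0 + c * t := by
  have hF : ∀ t ∈ Icc 0 τ, HasDerivWithinAt (fun t => E t - c * t) (E' t - c) (Icc 0 τ) t :=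
    fun t ht => by
      have := (hE t ht).sub ((hasDerivWithinAt_id t (Icc 0 τ)).const_mul c)
      rw [mul_one] at this
      exact this
  have hanti : AntitoneOn (fun t => E t - c * t) (Icc 0 τ) := by
    refine antitoneOn_of_deriv_nonpos (convex_Icc _ _)
      (fun t ht => (hF t ht).continuousWithinAt) (fun t ht => ?_) fun t ht => ?_
    · rw [interior_Icc] at ht
      exact ((hF t (Ioo_subset_Icc_self ht)).hasDerivAt
        (Icc_mem_nhds ht.1 ht.2)).differentiableAt.differentiableWithinAt
    · rw [interior_Icc] at ht
      rw [((hF t (Ioo_subset_Icc_self ht)).hasDerivAt (Icc_mem_nhds ht.1 ht.2)).deriv]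
      linarith [hc t (Ioo_subset_Icc_self ht)]
  have := hanti (left_mem_Icc.2 (ht.1.trans ht.2)) ht ht.1
  simp only [mul_zero, sub_zero] at this
  linarith

/-- Formally `y = √E` satisfies `y' ≤ α y + κ`. The integrating factor is at most 1, so the forcing
contributes `κ t`; the bound is linear in `t` because `E` starts from 0. -/
lemma sqrt_le_of_hasDerivWithinAt_le {E E' : ℝ → ℝ} {τ α κ : ℝ} (hα : 0 ≤ α) (hκ : 0 ≤ κ)
    (hE : ∀ t ∈ Icc 0 τ, HasDerivWithinAt E (E' t) (Icc 0 τ) t) (h0 : E 0 = 0)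
    (hnn : ∀ t ∈ Icc 0 τ, 0 ≤ E t)
    (h : ∀ t ∈ Icc 0 τ, E' t ≤ 2 * α * E t + 2 * κ * Real.sqrt (E t))
    {t : ℝ} (ht : t ∈ Icc 0 τ) : Real.sqrt (E t) ≤ κ * t * Real.exp (α * t) := by
  -- The square root is not differentiable where `E` vanishes, in particular at time 0, so `E` is
  -- shifted by `μ` and `μ → 0` at the end.
  have key : ∀ μ : ℝ, 0 < μ →
      Real.sqrt (E t + μ) * Real.exp (-α * t) ≤ Real.sqrt μ + κ * t := by
    intro μ hμ
    have hd : ∀ s ∈ Icc 0 τ, HasDerivWithinAt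
        (fun s => Real.sqrt (E s + μ) * Real.exp (-α * s))
        (E' s / (2 * Real.sqrt (E s + μ)) * Real.exp (-α * s) +
          Real.sqrt (E s + μ) * (Real.exp (-α * s) * (-α))) (Icc 0 τ) s := fun s hs => by
      have h1 := ((hE s hs).add_const μ).sqrt (by linarith [hnn s hs])
      have h2 : HasDerivWithinAt (fun s => Real.exp (-α * s)) (Real.exp (-α * s) * (-α))
          (Icc 0 τ) s := by
        have := ((hasDerivAt_id s).const_mul (-α)).exp
        simpa using this.hasDerivWithinAt
      exact h1.mul h2
    have := le_add_mul_of_hasDerivWithinAt_le (c := κ) hd (fun s hs => ?_) ht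
    · simpa [h0] using this
    · have hEs := hnn s hs
      set y := Real.sqrt (E s + μ) with hy
      have hy0 : 0 < y := Real.sqrt_pos.2 (by linarith)
      have hy2 : y ^ 2 = E s + μ := Real.sq_sqrt (by linarith)
      have h3 : Real.sqrt (E s) ≤ y := Real.sqrt_le_sqrt (by linarith)
      have h4 : E' s / (2 * y) ≤ α * y + κ := by
        rw [div_le_iff₀ (by positivity)]
        nlinarith [h s hs, mul_le_mul_of_nonneg_left h3 hκ,
          mul_nonneg hα hμ.le]
      have h5 : 0 < Real.exp (-α * s) := Real.exp_pos _
      have h6 : Real.exp (-α * s) ≤ 1 := by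
        rw [Real.exp_le_one_iff]
        nlinarith [hs.1]
      calc _ ≤ (α * y + κ) * Real.exp (-α * s) + y * (Real.exp (-α * s) * (-α)) := by gcongr
        _ = κ * Real.exp (-α * s) := by ring
        _ ≤ κ := mul_le_of_le_one_right hκ h6
  have hlim : Real.sqrt (E t) * Real.exp (-α * t) ≤ κ * t := by
    have hc1 : Tendsto (fun μ : ℝ => Real.sqrt (E t + μ) * Real.exp (-α * t)) (𝓝[>] 0)
        (𝓝 (Real.sqrt (E t + 0) * Real.exp (-α * t))) :=
      Tendsto.mono_left (Continuous.tendsto (by fun_prop) 0) nhdsWithin_le_nhds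
    have hc2 : Tendsto (fun μ : ℝ => Real.sqrt μ + κ * t) (𝓝[>] 0)
        (𝓝 (Real.sqrt 0 + κ * t)) :=
      Tendsto.mono_left (Continuous.tendsto (by fun_prop) 0) nhdsWithin_le_nhds
    have := le_of_tendsto_of_tendsto hc1 hc2 (by
      filter_upwards [self_mem_nhdsWithin] with μ hμ using key μ hμ)
    simpa using this
  have h7 : Real.exp (-α * t) * Real.exp (α * t) = 1 := by
    rw [← Real.exp_add]
    simp
  calc Real.sqrt (E t) = (Real.sqrt (E t) * Real.exp (-α * t)) * Real.exp (α * t) := by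
        rw [mul_assoc, h7, mul_one]
    _ ≤ _ := by gcongr

/-! ### A priori bounds -/

/-- All constants attached to `w`: its Sobolev norm comes from the algebra property, the sup norms
of `w` and of its time derivative from the embedding at orders `R` and `R - 1`. The bound `K * M` on
`f'` and `g'` is the one that the first equation supplies. -/
lemma exists_gsum_bounds {R : ℝ} (hR : 3 / 2 < R) {n : ℕ} (hn : 1 ≤ n) (M K : ℝ≥0) :
    ∃ b : ℝ≥0, ∃ c : ℝ, 0 ≤ c ∧ ∀ {f g f' g' : L2}, Sob R (FT f) → Sob R (FT g) →
      Sob (R - 1) (FT f') → Sob (R - 1) (FT g') → sN R (FT f) ≤ M → sN R (FT g) ≤ M →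
      sN (R - 1) (FT f') ≤ K * M → sN (R - 1) (FT g') ≤ K * M →
      (∃ W, Rep (gsum n (bcf f) (bcf g) : ℝ →ᵇ ℝ) W ∧ Sob R W ∧ sN R W ≤ b) ∧
      ‖gsum n (bcf f) (bcf g)‖ ≤ c ∧
      ‖dgsum n (bcf f) (bcf g) (bcf f') (bcf g')‖ ≤ c := by
  have hR' : 1 / 2 < R := by linarith
  obtain ⟨C₁, h₁⟩ := (sobLin_bcf hR').bound
  obtain ⟨C₂, h₂⟩ := (sobLin_bcf (r := R - 1) (by linarith)).bound
  obtain ⟨b, hb⟩ := exists_WB_gsum hR' M hn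
  obtain ⟨c, hc, h⟩ := exists_norm_gsum_le n ((C₁ * M + C₂ * (K * M) : ℝ≥0) : ℝ)
  have key₁ : ∀ {f : L2}, Sob R (FT f) → sN R (FT f) ≤ M →
      ‖bcf f‖ ≤ ((C₁ * M + C₂ * (K * M) : ℝ≥0) : ℝ) := fun {f} hf hM => by
    have : ‖bcf f‖ₑ ≤ ((C₁ * M : ℝ≥0) : ℝ≥0∞) := by
      refine (h₁ f hf).trans ?_
      push_cast
      gcongr
    have := enorm_le_coe.1 this
    exact_mod_cast this.trans le_self_add
  have key₂ : ∀ {f : L2}, Sob (R - 1) (FT f) → sN (R - 1) (FT f) ≤ K * M →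
      ‖bcf f‖ ≤ ((C₁ * M + C₂ * (K * M) : ℝ≥0) : ℝ) := fun {f} hf hM => by
    have : ‖bcf f‖ₑ ≤ ((C₂ * (K * M) : ℝ≥0) : ℝ≥0∞) := by
      refine (h₂ f hf).trans ?_
      push_cast
      gcongr
    have := enorm_le_coe.1 this
    exact_mod_cast this.trans le_add_self
  refine ⟨b, c, hc, fun {f g f' g'} hf hg hf' hg' e1 e2 e3 e4 => ⟨?_, h _ _ _ _ (key₁ hf e1)
    (key₁ hg e2) (key₂ hf' e3) (key₂ hg' e4)⟩⟩
  obtain ⟨W, hW, hW'⟩ := hb (WB_bcf hR' hf e1) (WB_bcf hR' hg e2)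
  refine ⟨W, ?_, hW.sob hW', hW'⟩
  rwa [← funext (gsum_apply n (bcf f) (bcf g))] at hW

lemma Sol.sN_le {k : ℝ → ℝ} {n : ℕ} {ε R τ : ℝ} {u v u' v' : ℝ → L2}
    (h : Sol k n ε R τ u v u' v') {K M : ℝ≥0} (hk : ∀ ξ, |k ξ| ≤ K) {t : ℝ} (ht : t ∈ Icc 0 τ)
    (hM : sN R (FT (v t)) ≤ M) : sN (R - 1) (FT (u' t)) ≤ K * M := by
  rw [sN_congr (h.eq_u t ht)]
  refine (sN_le_of_norm_le (r' := R - 1) (G := dF (FT (v t))) K (ae_of_all _ fun ξ => ?_)).trans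
    (by gcongr; exact (sN_dF_le _ _).trans hM)
  rw [norm_mul, Complex.norm_real, sub_self, Real.rpow_zero, mul_one]
  exact mul_le_mul_of_nonneg_right (hk ξ) (norm_nonneg _)

lemma sN_zero (r : ℝ) : sN r (fun _ => 0) = 0 := by simp [sN, wN]

lemma sob_zero (r : ℝ) : Sob r (fun _ => 0) :=
  ⟨aestronglyMeasurable_const, by simp [sN_zero]⟩

/-- Smallness of `εⁿ` enters here: it makes the energy comparable to `‖P‖² + ‖Q‖²`. -/
lemma mul_norm_le_half {X : Type*} [SeminormedAddCommGroup X] {e c : ℝ} (hc : 0 ≤ c)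
    (he : e ≤ 1 / (2 * (c + 1))) {w : X} (hw : ‖w‖ ≤ c) : e * ‖w‖ ≤ 1 / 2 := by
  rw [le_div_iff₀ (by positivity)] at he
  rcases le_or_gt 0 e with h | h
  · nlinarith
  · nlinarith [norm_nonneg w]

/-- The regularized energy grows at most linearly on the scale `ε ^ n * t`. -/
lemma exists_regularized_bound {R : ℝ} (hR : 5 / 2 < R) {n : ℕ} (hn : 1 ≤ n) (M K : ℝ≥0) :
    ∃ e₀ > 0, ∃ C : ℝ, 0 ≤ C ∧ ∀ {k : ℝ → ℝ} {ε τ η : ℝ} {u v u' v' : ℝ → L2}, Measurable k →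
      (∀ ξ, |k ξ| ≤ K) → 0 < ε → ε ^ n ≤ e₀ → 0 < η → η ≤ 1 → Sol k n ε R τ u v u' v' →
      (∀ t ∈ Icc 0 τ, sN R (FT (u t)) ≤ M ∧ sN R (FT (v t)) ≤ M) → ∀ t ∈ Icc 0 τ,
      ‖wt (regWeight η R) (u t)‖ ^ 2 + ‖wt (regWeight η R) (v t)‖ ^ 2 ≤
        3 * (‖wt (regWeight η R) (u 0)‖ ^ 2 + ‖wt (regWeight η R) (v 0)‖ ^ 2) +
          C * (ε ^ n * t) := by
  have hR3 : 3 / 2 < R := by linarith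
  obtain ⟨b, c, hc, hgb⟩ := exists_gsum_bounds hR3 hn M K
  obtain ⟨C, hC⟩ := exists_energy_estimate hR3
  -- The outer 2 undoes the factor 1/2 of `le_en`; the 3 in front of the initial energy is the
  -- quotient of the factors 3/2 and 1/2 in `en_le` and `le_en`.
  refine ⟨1 / (2 * (c + 1)), by positivity, 2 * (2 * (C * K * M * (M * b)) + c * M ^ 2),
    by positivity, ?_⟩
  intro k ε τ η u v u' v' hkm hk hε hεe hη hη1 h hM t ht
  have he : 0 ≤ ε ^ n := by positivity
  set m := regWeight η R with hmdef
  have hmm : Measurable m := (continuous_regWeight η R).measurable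
  -- This constant blows up as `η → 0`, but it only justifies differentiation and does not enter the
  -- final bound.
  have hm' : ∀ ξ, |m ξ| ≤ (η⁻¹.toNNReal : ℝ≥0) * jb ξ ^ (R - 1) := fun ξ => by
    rw [abs_of_nonneg (regWeight_nonneg _ _ _), Real.coe_toNNReal _ (inv_nonneg.2 hη.le)]
    exact regWeight_le_sub_one hη hη1 R ξ
  have hL : SobLin (R - 1) (wt m) := sobLin_wt hmm _ hm'
  have hB : SobLin (R - 1) bcf := sobLin_bcf (by linarith)
  have hcoe : ∀ {f : L2}, Sob (R - 1) (FT f) →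
      (wt m f : ℝ → ℂ) =ᵐ[volume] fun ξ => (m ξ : ℂ) * FT f ξ := fun hf =>
    coeFn_wt (hf.memLp_weight hmm _ hm')
  have hbd : ∀ t ∈ Icc 0 τ, _ := fun t ht =>
    hgb (h.ucurve.cont.sob ht) (h.ucurve.cont.sob ht) (h.ucurve.cont_deriv.sob ht)
      (h.ucurve.cont_deriv.sob ht) (hM t ht).1 (hM t ht).1 (h.sN_le hk ht (hM t ht).2)
      (h.sN_le hk ht (hM t ht).2)
  have hmain := le_add_mul_of_hasDerivWithinAt_le
    (c := ε ^ n * (2 * (C * K * M * (M * b)) + c * M ^ 2))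
    (fun t ht => hasDerivWithinAt_en (ε ^ n)
      (hasDerivWithinAt_gsum n (h.ucurve.hasDerivWithinAt hB ht) (h.ucurve.hasDerivWithinAt hB ht))
      (h.ucurve.hasDerivWithinAt hL ht) (h.vcurve.hasDerivWithinAt hL ht)) (fun t ht => ?_) ht
  · have h0 : (0 : ℝ) ∈ Icc 0 τ := left_mem_Icc.2 (ht.1.trans ht.2)
    have l1 := le_en he (mul_norm_le_half hc hεe (hbd t ht).2.1) (wt m (u t)) (wt m (v t))
    have l2 := en_le he (mul_norm_le_half hc hεe (hbd 0 h0).2.1) (wt m (u 0)) (wt m (v 0))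
    linarith
  · obtain ⟨⟨W, hW, hWs, hWb⟩, hw, hw'⟩ := hbd t ht
    have hus := h.ucurve.cont.sob ht
    have hvs := h.vcurve.cont.sob ht
    have hP := hcoe (h.ucurve.sob_sub_one ht)
    have hQ := hcoe (h.vcurve.sob_sub_one ht)
    obtain ⟨A, hA, hv'⟩ := h.eq_v t ht
    have hchain := dF_eq_cv_of_rep_pow hR3 hus hA hW hWs
    refine (hC hη.le le_rfl hR hm' hkm hk hus hvs hWs (sob_zero _) (sob_zero _) hW
      (hM t ht).1 hWb (sN_zero R).le (sN_zero R).le he (mul_norm_le_half hc hεe hw) hP hQ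
      ?_ ?_).trans ?_
    · filter_upwards [hcoe (h.ucurve.cont_deriv.sob ht), h.eq_u t ht] with ξ e1 e2
      rw [e1, e2, add_zero]
    · filter_upwards [hcoe (h.vcurve.cont_deriv.sob ht), hv', hchain] with ξ e1 e2 e3
      rw [e1, e2, add_zero, ← e3]
      simp only [dF]
      ring
    · have nP : ‖wt m (u t)‖ ≤ M := norm_le_of_coeFn_regWeight hP (hM t ht).1
      have nQ : ‖wt m (v t)‖ ≤ M := norm_le_of_coeFn_regWeight hQ (hM t ht).2
      have i1 : C * K * ‖wt m (v t)‖ * (M * b) ≤ C * K * M * (M * b) := by gcongr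
      have i2 : ‖dgsum n (bcf (u t)) (bcf (u t)) (bcf (u' t)) (bcf (u' t))‖ *
          ‖wt m (u t)‖ ^ 2 ≤ c * M ^ 2 := by gcongr
      have := mul_le_mul_of_nonneg_left (add_le_add (mul_le_mul_of_nonneg_left i1 zero_le_two) i2)
        he
      push_cast at this ⊢
      linarith

lemma wN_sq (m : ℝ → ℝ) (F : ℝ → ℂ) : wN m F ^ 2 = ∫⁻ ξ, ‖(m ξ : ℂ) * F ξ‖ₑ ^ 2 := by
  have := eLpNorm_nnreal_pow_eq_lintegral (μ := (volume : Measure ℝ)) (p := 2)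
    (f := fun ξ => (m ξ : ℂ) * F ξ) two_ne_zero
  simpa [wN] using this

/-- Dominated convergence: the damped weights converge pointwise and are dominated by the undamped
one. -/
lemma tendsto_norm_wt_regWeight {R : ℝ} {f : L2} (hf : Sob R (FT f)) {η : ℕ → ℝ}
    (hη : Tendsto η atTop (𝓝 0)) :
    Tendsto (fun j => ‖wt (regWeight (η j) R) f‖ ^ 2) atTop (𝓝 (‖wt (regWeight 0 R) f‖ ^ 2)) := by
  have hm : ∀ η ξ, |regWeight η R ξ| ≤ (1 : ℝ≥0) * jb ξ ^ R := fun η ξ => by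
    rw [abs_of_nonneg (regWeight_nonneg _ _ _), NNReal.coe_one, one_mul]
    exact regWeight_le η R ξ
  have hmm : ∀ η, Measurable (regWeight η R) := fun η => (continuous_regWeight η R).measurable
  have he : ∀ η, ‖wt (regWeight η R) f‖ ^ 2 =
      (∫⁻ ξ, ‖(regWeight η R ξ : ℂ) * FT f ξ‖ₑ ^ 2).toReal := fun η => by
    rw [← wN_sq, ENNReal.toReal_pow, ← enorm_wt (hf.memLp_weight (hmm η) 1 (hm η)), toReal_enorm]
  simp only [he]
  have hfin : (∫⁻ ξ, ‖((jb ξ ^ R : ℝ) : ℂ) * FT f ξ‖ₑ ^ 2) ≠ ∞ := by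
    rw [← wN_sq (fun ξ => jb ξ ^ R)]
    exact (ENNReal.pow_lt_top hf.2).ne
  have hle : ∀ η, ∀ ξ, ‖(regWeight η R ξ : ℂ) * FT f ξ‖ₑ ^ 2 ≤
      ‖((jb ξ ^ R : ℝ) : ℂ) * FT f ξ‖ₑ ^ 2 := fun η ξ => by
    gcongr
    rw [enorm_mul, enorm_mul]
    gcongr
    rw [enorm_le_iff_norm_le, Complex.norm_real, Complex.norm_real, Real.norm_eq_abs,
      Real.norm_of_nonneg (Real.rpow_nonneg (jb_pos _).le _)]
    simpa using hm η ξ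
  refine (ENNReal.tendsto_toReal (ne_top_of_le_ne_top hfin (lintegral_mono (hle 0)))).comp ?_
  refine tendsto_lintegral_filter_of_dominated_convergence' _ (Eventually.of_forall fun j => ?_)
    (Eventually.of_forall fun j => ae_of_all _ (hle (η j))) hfin (ae_of_all _ fun ξ => ?_)
  · exact ((measurable_weight (hmm _) hf.meas).aemeasurable.enorm).pow_const 2
  · have h1 : Continuous fun η => regWeight η R ξ := by
      unfold regWeight
      exact continuous_const.div (continuous_jb.comp (continuous_mul_const ξ))
        fun η => (jb_pos _).ne'
    have h2 : Continuous fun η => ‖(regWeight η R ξ : ℂ) * FT f ξ‖ₑ ^ 2 :=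
      (ENNReal.continuous_pow 2).comp (((Complex.continuous_ofReal.comp h1).mul
        continuous_const).enorm)
    exact (h2.tendsto 0).comp hη

lemma exists_sobolev_bound {R : ℝ} (hR : 5 / 2 < R) {n : ℕ} (hn : 1 ≤ n) (M K : ℝ≥0) :
    ∃ e₀ > 0, ∃ C : ℝ, 0 ≤ C ∧ ∀ {k : ℝ → ℝ} {ε τ : ℝ} {u v u' v' : ℝ → L2}, Measurable k →
      (∀ ξ, |k ξ| ≤ K) → 0 < ε → ε ^ n ≤ e₀ → Sol k n ε R τ u v u' v' →
      (∀ t ∈ Icc 0 τ, sN R (FT (u t)) ≤ M ∧ sN R (FT (v t)) ≤ M) → ∀ t ∈ Icc 0 τ,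
      ‖wt (regWeight 0 R) (u t)‖ ^ 2 + ‖wt (regWeight 0 R) (v t)‖ ^ 2 ≤
        3 * (‖wt (regWeight 0 R) (u 0)‖ ^ 2 + ‖wt (regWeight 0 R) (v 0)‖ ^ 2) +
          C * (ε ^ n * t) := by
  obtain ⟨e₀, he₀, C, hC, h⟩ := exists_regularized_bound hR hn M K
  refine ⟨e₀, he₀, C, hC, fun {k ε τ u v u' v'} hkm hk hε hεe hs hM t ht => ?_⟩
  have hη : Tendsto (fun j : ℕ => 1 / ((j : ℝ) + 1)) atTop (𝓝 0) :=
    tendsto_one_div_add_atTop_nhds_zero_nat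
  have h0 : (0 : ℝ) ∈ Icc 0 τ := left_mem_Icc.2 (ht.1.trans ht.2)
  have lim : ∀ {t}, t ∈ Icc 0 τ → _ := fun ht =>
    (tendsto_norm_wt_regWeight (hs.ucurve.cont.sob ht) hη).add
      (tendsto_norm_wt_regWeight (hs.vcurve.cont.sob ht) hη)
  refine le_of_tendsto_of_tendsto' (lim ht) (((lim h0).const_mul 3).add_const _) fun j => ?_
  refine h hkm hk hε hεe (by positivity) ?_ hs hM t ht
  rw [div_le_one (by positivity)]
  linarith [(j.cast_nonneg : (0 : ℝ) ≤ j)]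

/-- If `N` exceeded `b`, there would be a first time with `N = b`; the bound by `b` holds up to that
time, so the hypothesis forces `N ≤ a < b` there. -/
lemma bootstrap {N : ℝ → ℝ} {τ a b : ℝ} (hab : a < b) (hN : ContinuousOn N (Icc 0 τ))
    (h0 : N 0 ≤ b) (h : ∀ t ∈ Icc 0 τ, (∀ s ∈ Icc 0 t, N s ≤ b) → N t ≤ a) :
    ∀ t ∈ Icc 0 τ, N t ≤ b := by
  intro t ht
  by_contra! hlt
  have hsub : ∀ {s}, s ∈ Icc 0 τ → Icc 0 s ⊆ Icc 0 τ := fun hs => Icc_subset_Icc_right hs.2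
  have hiv : ∀ {s}, s ∈ Icc 0 τ → b < N s → ∃ r ∈ Icc 0 s, N r = b := fun {s} hs hb =>
    intermediate_value_Icc hs.1 (hN.mono (hsub hs)) ⟨h0, hb.le⟩
  have hcl : IsClosed (Icc 0 t ∩ N ⁻¹' {b}) :=
    (hN.mono (hsub ht)).preimage_isClosed_of_isClosed isClosed_Icc isClosed_singleton
  obtain ⟨s, ⟨hs, hsb⟩, hmin⟩ := (isCompact_Icc.of_isClosed_subset hcl
    inter_subset_left).exists_isLeast (hiv ht hlt)
  have := h s (hsub ht hs) fun r hr => by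
    by_contra! hrb
    obtain ⟨q, hq, hqb⟩ := hiv (hsub ht (Icc_subset_Icc_right hs.2 hr)) hrb
    have hqs : s ≤ q := hmin ⟨⟨hq.1, hq.2.trans (hr.2.trans hs.2)⟩, hqb⟩
    have : r = s := le_antisymm hr.2 (hqs.trans hq.2)
    rw [this, hsb] at hrb
    exact lt_irrefl _ hrb
  rw [hsb] at this
  exact absurd hab (not_lt.2 this)

lemma coeFn_wt_zero {r R : ℝ} (hrR : r ≤ R) {f : L2} (hf : Sob R (FT f)) :
    (wt (regWeight 0 r) f : ℝ → ℂ) =ᵐ[volume] fun ξ => (regWeight 0 r ξ : ℂ) * FT f ξ :=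
  coeFn_wt ((hf.mono hrR).memLp_weight (continuous_regWeight 0 r).measurable 1 fun ξ => by
    rw [abs_of_nonneg (regWeight_nonneg _ _ _), NNReal.coe_one, one_mul]
    exact regWeight_le 0 r ξ)

lemma sobLin_wt_zero {r R : ℝ} (hrR : r ≤ R) : SobLin R (wt (regWeight 0 r)) :=
  sobLin_wt (continuous_regWeight 0 r).measurable 1 fun ξ => by
    rw [abs_of_nonneg (regWeight_nonneg _ _ _), NNReal.coe_one, one_mul]
    exact (regWeight_le 0 r ξ).trans (Real.rpow_le_rpow_of_exponent_le (one_le_jb ξ) hrR)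

lemma enorm_eq_sN {r : ℝ} {F : ℝ → ℂ} {x : H}
    (h : (x : ℝ → ℂ) =ᵐ[volume] fun ξ => (regWeight 0 r ξ : ℂ) * F ξ) : ‖x‖ₑ = sN r F := by
  rw [enorm_le_of_coeFn h, regWeight_zero]
  rfl

/-- Solutions with given initial data stay bounded on the time scale `ε ^ (-n)`. -/
lemma exists_uniform_bound {R : ℝ} (hR : 5 / 2 < R) {n : ℕ} (hn : 1 ≤ n) (K : ℝ≥0) {u₀ v₀ : L2} :
    ∃ M : ℝ≥0, ∃ T₀ > 0, ∃ e₀ > 0, ∀ {k : ℝ → ℝ} {ε τ : ℝ} {u v u' v' : ℝ → L2}, Measurable k →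
      (∀ ξ, |k ξ| ≤ K) → 0 < ε → ε ^ n ≤ e₀ → ε ^ n * τ ≤ T₀ → Sol k n ε R τ u v u' v' →
      u 0 = u₀ → v 0 = v₀ → ∀ t ∈ Icc 0 τ, sN R (FT (u t)) ≤ M ∧ sN R (FT (v t)) ≤ M := by
  set N₀ : ℝ := ‖wt (regWeight 0 R) u₀‖ ^ 2 + ‖wt (regWeight 0 R) v₀‖ ^ 2 with hN₀
  have hN₀' : 0 ≤ N₀ := by positivity
  -- `M` depends only on the data and is fixed before `C`. The time bound then keeps `C εⁿ t ≤ 1`,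
  -- so the norm squared stays below `3 N₀ + 1`, strictly less than `M² = 3 N₀ + 2`.
  set M : ℝ≥0 := (Real.sqrt (3 * N₀ + 2)).toNNReal with hMdef
  have hMsq : (M : ℝ) ^ 2 = 3 * N₀ + 2 := by
    rw [hMdef, Real.coe_toNNReal _ (Real.sqrt_nonneg _), Real.sq_sqrt (by positivity)]
  obtain ⟨e₀, he₀, C, hC, h⟩ := exists_sobolev_bound hR hn M K
  refine ⟨M, 1 / (C + 1), by positivity, e₀, he₀, ?_⟩
  intro k ε τ u v u' v' hkm hk hε hεe hετ hs hu hv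
  have hcoe : ∀ {f : L2}, Sob R (FT f) → ‖wt (regWeight 0 R) f‖ ^ 2 ≤ M ^ 2 →
      sN R (FT f) ≤ M := fun hf hle => by
    rw [← enorm_eq_sN (coeFn_wt_zero le_rfl hf), enorm_le_coe]
    exact_mod_cast (pow_le_pow_iff_left₀ (norm_nonneg _) M.2 two_ne_zero).1 hle
  have hbound : ∀ {t}, t ∈ Icc 0 τ → ‖wt (regWeight 0 R) (u t)‖ ^ 2 +
      ‖wt (regWeight 0 R) (v t)‖ ^ 2 ≤ M ^ 2 → sN R (FT (u t)) ≤ M ∧ sN R (FT (v t)) ≤ M :=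
    fun ht hle => ⟨hcoe (hs.ucurve.cont.sob ht) ((le_add_of_nonneg_right (sq_nonneg _)).trans hle),
      hcoe (hs.vcurve.cont.sob ht) ((le_add_of_nonneg_left (sq_nonneg _)).trans hle)⟩
  have hL := sobLin_wt_zero (le_refl R)
  intro t ht
  refine hbound ht (bootstrap (a := 3 * N₀ + 1) (by linarith)
    (((hs.ucurve.cont.continuousOn hL).norm.pow 2).add
      ((hs.vcurve.cont.continuousOn hL).norm.pow 2)) ?_ (fun t ht hle => ?_) t ht)
  · change ‖wt (regWeight 0 R) (u 0)‖ ^ 2 + ‖wt (regWeight 0 R) (v 0)‖ ^ 2 ≤ _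
    rw [hu, hv]
    linarith
  · have h1 := h hkm hk hε hεe (hs.mono ht.2)
      (fun s hs' => hbound (Icc_subset_Icc_right ht.2 hs') (hle s hs')) t ⟨ht.1, le_rfl⟩
    rw [hu, hv, ← hN₀] at h1
    have h2 : ε ^ n * t ≤ 1 / (C + 1) :=
      (mul_le_mul_of_nonneg_left ht.2 (by positivity)).trans hετ
    have h3 : C * (ε ^ n * t) ≤ 1 := by
      rw [le_div_iff₀ (by positivity)] at h2
      have : 0 ≤ ε ^ n * t := mul_nonneg (by positivity) ht.1
      linarith
    exact h1.trans (by linarith)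

/-! ### The difference of two solutions -/

/-- The consistency error: `K - 1` costs `θ` derivatives and `∂` one more, and `κ` carries the rate
`δ^θ`. -/
lemma sN_sub_one_mul_dF_le {r R θ : ℝ} {k : ℝ → ℝ} {κ : ℝ≥0} (hrR : r + 1 + θ ≤ R)
    (hκ : ∀ ξ, |k ξ - 1| ≤ κ * jb ξ ^ θ) (F : ℝ → ℂ) :
    sN r (fun ξ => ((k ξ - 1 : ℝ) : ℂ) * dF F ξ) ≤ κ * sN R F := by
  refine sN_le_of_norm_le κ (ae_of_all _ fun ξ => ?_)
  rw [norm_mul, Complex.norm_real, Real.norm_eq_abs]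
  calc _ ≤ (κ * jb ξ ^ θ) * (jb ξ * ‖F ξ‖) := by
        have := Real.rpow_nonneg (jb_pos ξ).le θ
        exact mul_le_mul (hκ ξ) (norm_dF_le F ξ) (norm_nonneg _) (by positivity)
    _ = κ * jb ξ ^ (θ + 1) * ‖F ξ‖ := by
        rw [Real.rpow_add_one (jb_pos ξ).ne']
        ring
    _ ≤ _ := by
        gcongr
        · exact one_le_jb ξ
        · linarith

lemma sN_mul_le {r : ℝ} {k : ℝ → ℝ} {K : ℝ≥0} (hk : ∀ ξ, |k ξ| ≤ K) (F : ℝ → ℂ) :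
    sN r (fun ξ => (k ξ : ℂ) * F ξ) ≤ K * sN r F :=
  sN_le_of_norm_le K (ae_of_all _ fun ξ => by
    rw [norm_mul, Complex.norm_real, sub_self, Real.rpow_zero, mul_one]
    exact mul_le_mul_of_nonneg_right (hk ξ) (norm_nonneg _))

lemma Sob.mul {r : ℝ} {k : ℝ → ℝ} {K : ℝ≥0} {F : ℝ → ℂ} (hF : Sob r F) (hkm : Measurable k)
    (hk : ∀ ξ, |k ξ| ≤ K) : Sob r fun ξ => (k ξ : ℂ) * F ξ :=
  ⟨measurable_weight hkm hF.meas, (sN_mul_le hk F).trans_lt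
    (ENNReal.mul_lt_top ENNReal.coe_lt_top hF.2)⟩

/-- Here `x` and `y` stand for the norms of the two differences and `S` for `√E`. Terms with `e` are
quadratic in the norms and go into `E`; terms with `κ` are linear and go into `S`. -/
lemma energy_rate_le {e C K b D κ M B c x y w E S : ℝ} (he : 0 ≤ e) (hc : 0 ≤ c) (hC : 0 ≤ C)
    (hK : 0 ≤ K) (hb : 0 ≤ b) (hD : 0 ≤ D) (hκ : 0 ≤ κ) (hM : 0 ≤ M) (hB : 0 ≤ B)
    (hxS : x ≤ 2 * S) (hyS : y ≤ 2 * S) (hE : 1 / 2 * (x ^ 2 + y ^ 2) ≤ E)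
    (hw : w ≤ c) :
    2 * e * (C * K * y * (x * b)) + 2 * y * (e * (K * (D * (x * b))) + κ * (M + B)) +
      3 * x * (κ * M) + e * (w * x ^ 2) ≤
      2 * (e * (2 * (C * K * b) + 2 * (K * D * b) + c)) * E +
        2 * (κ * (2 * (M + B) + 3 * M)) * S := by
  have hxy : x * y ≤ E := by nlinarith [sq_nonneg (x - y)]
  have hE0 : 0 ≤ E := le_trans (by positivity) hE
  have h1 : 2 * e * (C * K * b + K * D * b) * (x * y) ≤ 2 * e * (C * K * b + K * D * b) * E := by
    gcongr
  have h1' : 0 ≤ 2 * e * (C * K * b + K * D * b) * E := by positivity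
  have h2 : e * (w * x ^ 2) ≤ e * (c * (2 * E)) := by
    gcongr
    nlinarith [sq_nonneg y]
  have h3 : 2 * y * (κ * (M + B)) ≤ 2 * (2 * S) * (κ * (M + B)) := by gcongr
  have h4 : 3 * x * (κ * M) ≤ 3 * (2 * S) * (κ * M) := by gcongr
  linarith

set_option maxHeartbeats 600000 in
/-- The two solutions stay close as long as they are bounded. -/
lemma exists_difference_bound {r R θ : ℝ} (hr : 3 / 2 < r) (hθ : 0 < θ) (hrR : r + 1 + θ = R)
    {n : ℕ} (hn : 1 ≤ n) (M K : ℝ≥0) :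
    ∃ e₀ > 0, ∃ C : ℝ, 0 ≤ C ∧ ∀ {k : ℝ → ℝ} {ε τ : ℝ} {κ : ℝ≥0}
      {u v u' v' y z y' z' : ℝ → L2}, Measurable k → (∀ ξ, |k ξ| ≤ K) →
      (∀ ξ, |k ξ - 1| ≤ κ * jb ξ ^ θ) → 0 < ε → ε ^ n ≤ e₀ →
      Sol k n ε R τ u v u' v' → Sol (fun _ => 1) n ε R τ y z y' z' → u 0 = y 0 → v 0 = z 0 →
      (∀ t ∈ Icc 0 τ, sN R (FT (u t)) ≤ M ∧ sN R (FT (v t)) ≤ M) →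
      (∀ t ∈ Icc 0 τ, sN R (FT (y t)) ≤ M ∧ sN R (FT (z t)) ≤ M) → ∀ t ∈ Icc 0 τ,
      sN r (FT (u t - y t)) ≤ ENNReal.ofReal (C * κ * t * Real.exp (C * ε ^ n * t)) ∧
      sN r (FT (v t - z t)) ≤ ENNReal.ofReal (C * κ * t * Real.exp (C * ε ^ n * t)) := by
  have hR3 : 3 / 2 < R := by linarith
  have hR1 : 1 / 2 < R - 1 := by linarith
  -- `K + 1` dominates both symbols, `k` and the constant 1.
  obtain ⟨b, c, hc, hgb⟩ := exists_gsum_bounds hR3 hn M (K + 1)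
  obtain ⟨C, hC⟩ := exists_energy_estimate hr
  obtain ⟨B, hB⟩ := exists_WB_pow (r := R) (by linarith) M n
  obtain ⟨D, hD⟩ := exists_sN_cv_le (r := r) (by linarith)
  set α : ℝ := 2 * (C * K * b) + 2 * (K * D * b) + c with hα
  set μ : ℝ := 2 * (M + B) + 3 * M with hμ
  have hα0 : 0 ≤ α := by positivity
  have hμ0 : 0 ≤ μ := by positivity
  -- The bound `εⁿ ≤ 1` removes `εⁿ` from the power term in the forcing. In `2μ + α` the first
  -- summand serves the prefactor, with 2 from `‖P‖ ≤ 2√E`, and `α` serves the exponent.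
  refine ⟨min 1 (1 / (2 * (c + 1))), by positivity, 2 * μ + α, by positivity, ?_⟩
  intro k ε τ κ u v u' v' y z y' z' hkm hk hκ hε hεe h g hu0 hv0 hM hM' t ht
  obtain ⟨hε1, hεc⟩ := le_min_iff.1 hεe
  have he : 0 ≤ ε ^ n := by positivity
  set m := regWeight 0 r with hmdef
  have hm' : ∀ ξ, |m ξ| ≤ (1 : ℝ≥0) * jb ξ ^ (R - 1) := fun ξ => by
    rw [abs_of_nonneg (regWeight_nonneg _ _ _), NNReal.coe_one, one_mul]
    exact (regWeight_le 0 r ξ).trans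
      (Real.rpow_le_rpow_of_exponent_le (one_le_jb ξ) (by linarith))
  have hL : SobLin (R - 1) (wt m) := sobLin_wt_zero (by linarith)
  have hBl : SobLin (R - 1) bcf := sobLin_bcf hR1
  have hcoe : ∀ {f g : L2}, Sob (R - 1) (FT f) → Sob (R - 1) (FT g) →
      ((wt m f - wt m g : H) : ℝ → ℂ) =ᵐ[volume] fun ξ => (m ξ : ℂ) * (FT f ξ - FT g ξ) :=
    fun {f g} hf hg => by
      filter_upwards [coeFn_wt_zero (r := r) (by linarith) hf,
        coeFn_wt_zero (r := r) (by linarith) hg, Lp.coeFn_sub (wt m f) (wt m g)] with ξ e1 e2 e3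
      rw [e3, Pi.sub_apply, e1, e2]
      ring
  have hbd : ∀ t ∈ Icc 0 τ, _ := fun t ht =>
    hgb (h.ucurve.cont.sob ht) (g.ucurve.cont.sob ht) (h.ucurve.cont_deriv.sob ht)
      (g.ucurve.cont_deriv.sob ht) (hM t ht).1 (hM' t ht).1
      (h.sN_le (K := K + 1) (fun ξ => (hk ξ).trans (by push_cast; linarith)) ht (hM t ht).2)
      (g.sN_le (K := K + 1) (fun ξ => by rw [abs_one]; push_cast; linarith [K.2]) ht
        (hM' t ht).2)
  set P : ℝ → H := fun t => wt m (u t) - wt m (y t) with hP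
  set Q : ℝ → H := fun t => wt m (v t) - wt m (z t) with hQ
  set E : ℝ → ℝ := fun t => en (ε ^ n) (gsum n (bcf (u t)) (bcf (y t))) (P t) (Q t) with hE
  have hlow : ∀ t ∈ Icc 0 τ, 1 / 2 * (‖P t‖ ^ 2 + ‖Q t‖ ^ 2) ≤ E t := fun t ht =>
    le_en he (mul_norm_le_half hc hεc (hbd t ht).2.1) _ _
  have hPE : ∀ t ∈ Icc 0 τ, ‖P t‖ ≤ 2 * Real.sqrt (E t) := fun t ht => by
    have := hlow t ht
    rw [← abs_of_nonneg (norm_nonneg (P t))]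
    refine abs_le_of_sq_le_sq ?_ (by positivity)
    rw [mul_pow, Real.sq_sqrt (by nlinarith [sq_nonneg ‖P t‖, sq_nonneg ‖Q t‖])]
    nlinarith [sq_nonneg ‖P t‖, sq_nonneg ‖Q t‖]
  have hQE : ∀ t ∈ Icc 0 τ, ‖Q t‖ ≤ 2 * Real.sqrt (E t) := fun t ht => by
    have := hlow t ht
    rw [← abs_of_nonneg (norm_nonneg (Q t))]
    refine abs_le_of_sq_le_sq ?_ (by positivity)
    rw [mul_pow, Real.sq_sqrt (by nlinarith [sq_nonneg ‖P t‖, sq_nonneg ‖Q t‖])]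
    nlinarith [sq_nonneg ‖P t‖, sq_nonneg ‖Q t‖]
  have hmain := sqrt_le_of_hasDerivWithinAt_le (E := E) (α := ε ^ n * α) (κ := κ * μ)
    (by positivity) (by positivity)
    (fun t ht => hasDerivWithinAt_en (ε ^ n)
      (hasDerivWithinAt_gsum n (h.ucurve.hasDerivWithinAt hBl ht)
        (g.ucurve.hasDerivWithinAt hBl ht))
      ((h.ucurve.hasDerivWithinAt hL ht).sub (g.ucurve.hasDerivWithinAt hL ht))
      ((h.vcurve.hasDerivWithinAt hL ht).sub (g.vcurve.hasDerivWithinAt hL ht)))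
    (by simp [hE, hP, hQ, hu0, hv0, en, qf])
    (fun t ht => by nlinarith [hlow t ht, sq_nonneg ‖P t‖, sq_nonneg ‖Q t‖])
    (fun t ht => ?_) ht
  · have hfin : ∀ {f g : L2} {x : H}, Sob (R - 1) (FT f) → Sob (R - 1) (FT g) →
        x = wt m f - wt m g → ‖x‖ ≤ 2 * Real.sqrt (E t) → sN r (FT (f - g)) ≤
          ENNReal.ofReal ((2 * μ + α) * κ * t * Real.exp ((2 * μ + α) * ε ^ n * t)) :=
      fun {f g x} hf hg hx hle => by
        rw [sN_congr (FT_sub f g), ← enorm_eq_sN (hcoe hf hg), ← hx, ← ofReal_norm]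
        refine ENNReal.ofReal_le_ofReal (hle.trans ?_)
        have h1 : Real.exp (ε ^ n * α * t) ≤ Real.exp ((2 * μ + α) * ε ^ n * t) := by
          refine Real.exp_le_exp.2 ?_
          have : 0 ≤ ε ^ n * t := mul_nonneg he ht.1
          nlinarith
        calc 2 * Real.sqrt (E t) ≤ 2 * (κ * μ * t * Real.exp (ε ^ n * α * t)) := by linarith
          _ = (2 * μ) * (κ * t * Real.exp (ε ^ n * α * t)) := by ring
          _ ≤ (2 * μ + α) * (κ * t * Real.exp ((2 * μ + α) * ε ^ n * t)) := by
              have := ht.1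
              gcongr
              linarith
          _ = _ := by ring
    exact ⟨hfin (h.ucurve.sob_sub_one ht) (g.ucurve.sob_sub_one ht) rfl (hPE t ht),
      hfin (h.vcurve.sob_sub_one ht) (g.vcurve.sob_sub_one ht) rfl (hQE t ht)⟩
  · obtain ⟨⟨W, hW, hWs, hWb⟩, hw, hw'⟩ := hbd t ht
    have su := h.ucurve.cont.sob ht
    have sv := h.vcurve.cont.sob ht
    have sy := g.ucurve.cont.sob ht
    have sz := g.vcurve.cont.sob ht
    obtain ⟨A₁, hA₁, ev'⟩ := h.eq_v t ht
    obtain ⟨A₂, hA₂, ez'⟩ := g.eq_v t ht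
    set p : ℝ → ℂ := fun ξ => FT (u t) ξ - FT (y t) ξ with hp
    have sp : Sob R p := su.sub sy
    -- The difference of the powers factors through `gsum`, so the nonlinear term becomes linear in
    -- `p`.
    have hdiff : (fun ξ => A₁ ξ - A₂ ξ) =ᵐ[volume] cv p W := by
      have hrep := ((bcf_spec (by linarith) su).1.sub (bcf_spec (by linarith) sy).1).mul hW
        ((sp.cv hWs (by linarith)).memLp (by linarith))
      have e : (fun x => (bcf (u t) x - bcf (y t) x) * gsum n (bcf (u t)) (bcf (y t)) x) =
          fun x => bcf (u t) x ^ (n + 1) - bcf (y t) x ^ (n + 1) := by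
        ext x
        rw [gsum_apply, sub_mul_gsum]
      rw [e] at hrep
      exact (hA₁.sub hA₂).unique hrep
    have hA₂B : sN R A₂ ≤ B := by
      obtain ⟨A, hA, hAB⟩ := hB (WB_bcf (by linarith) sy (hM' t ht).1)
      rwa [sN_congr (hA₂.unique hA)]
    have sA₂ : Sob R A₂ := hA₂.sob hA₂B
    set G : ℝ → ℂ := fun ξ => FT (y t) ξ + ((ε ^ n : ℝ) : ℂ) * A₂ ξ with hG
    have sG : Sob R G := sy.add (sA₂.const_mul _)
    have hGb : sN R G ≤ M + B := by
      refine (sN_add_le sy.meas (sA₂.const_mul _).meas).trans (add_le_add (hM' t ht).1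
        (((sN_const_mul_le _ _).trans ?_).trans hA₂B))
      refine mul_le_of_le_one_left bot_le ?_
      rw [ENNReal.coe_le_one_iff, ← NNReal.coe_le_coe, coe_nnnorm, Complex.norm_real,
        Real.norm_of_nonneg he]
      exact hε1
    have hk1 : ∀ ξ, |k ξ - 1| ≤ (K + 1 : ℝ≥0) := fun ξ => by
      have := abs_sub (k ξ) 1
      rw [abs_one] at this
      push_cast
      linarith [hk ξ]
    have hk1m : Measurable fun ξ => k ξ - 1 := hkm.sub_const 1
    -- The part of `∂(w p)` with the derivative on `w` loses nothing on `p` and is treated as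
    -- forcing; it needs `w` at order `r + 1 ≤ R`.
    have sN₁ : Sob (R - 1) (cv p (dF W)) := (sp.mono (by linarith)).cv hWs.dF hR1
    have sg₁ : Sob (R - 1) fun ξ => ((k ξ - 1 : ℝ) : ℂ) * dF (FT (z t)) ξ := sz.dF.mul hk1m hk1
    have sg₂ : Sob (R - 1) fun ξ => ((k ξ - 1 : ℝ) : ℂ) * dF G ξ := sG.dF.mul hk1m hk1
    have sg₃ : Sob (R - 1) fun ξ => ((ε ^ n : ℝ) : ℂ) * ((k ξ : ℂ) * cv p (dF W) ξ) :=
      (sN₁.mul hkm hk).const_mul _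
    have hPc := hcoe (h.ucurve.sob_sub_one ht) (g.ucurve.sob_sub_one ht)
    have hQc := hcoe (h.vcurve.sob_sub_one ht) (g.vcurve.sob_sub_one ht)
    have hpP : sN r p = ‖P t‖ₑ := (enorm_eq_sN hPc).symm
    have bg₁ : sN r (fun ξ => ((k ξ - 1 : ℝ) : ℂ) * dF (FT (z t)) ξ) ≤ (κ * M : ℝ≥0) := by
      refine (sN_sub_one_mul_dF_le hrR.le hκ _).trans ?_
      push_cast
      gcongr
      exact (hM' t ht).2
    have bg₂ : sN r (fun ξ => ((ε ^ n : ℝ) : ℂ) * ((k ξ : ℂ) * cv p (dF W) ξ) +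
        ((k ξ - 1 : ℝ) : ℂ) * dF G ξ) ≤
        (‖((ε ^ n : ℝ) : ℂ)‖₊ * (K * (D * (‖P t‖₊ * b))) + κ * (M + B) : ℝ≥0) := by
      refine (sN_add_le sg₃.meas sg₂.meas).trans ?_
      simp only [ENNReal.coe_add, ENNReal.coe_mul]
      refine add_le_add ((sN_const_mul_le _ _).trans ?_)
        ((sN_sub_one_mul_dF_le hrR.le hκ _).trans (by gcongr))
      gcongr
      refine (sN_mul_le hk _).trans ?_
      gcongr
      refine (hD _ _ sp.meas hWs.dF.meas).trans ?_
      rw [hpP, enorm_eq_nnnorm]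
      gcongr
      exact (sN_mono (by linarith) _).trans ((sN_dF_le R W).trans hWb)
    have hest := hC (a := ‖P t‖₊) (η := 0) (k := k) (P := P t) (Q := Q t)
      (P' := wt m (u' t) - wt m (y' t)) (Q' := wt m (v' t) - wt m (z' t))
      (w := gsum n (bcf (u t)) (bcf (y t)))
      (w' := dgsum n (bcf (u t)) (bcf (y t)) (bcf (u' t)) (bcf (y' t)))
      le_rfl (by linarith) (by linarith) hm' hkm hk sp (sv.sub sz) hWs sg₁
      (sg₃.add sg₂) hW (by rw [hpP, enorm_eq_nnnorm]) ((sN_mono (by linarith) _).trans hWb)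
      bg₁ bg₂ he (mul_norm_le_half hc hεc hw) hPc hQc
    refine (hest ?_ ?_).trans ?_
    · filter_upwards [hcoe (h.ucurve.cont_deriv.sob ht) (g.ucurve.cont_deriv.sob ht),
        h.eq_u t ht, g.eq_u t ht] with ξ e1 e2 e3
      rw [e1, e2, e3]
      simp only [dF]
      push_cast
      ring
    · filter_upwards [hcoe (h.vcurve.cont_deriv.sob ht) (g.vcurve.cont_deriv.sob ht),
        ev', ez', hdiff] with ξ e1 e2 e3 e4
      -- The product rule separates the commutator term, with the derivative on `p`, from the
      -- forcing term with the derivative on `w`.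
      have e5 := dF_cv (by linarith) sp hWs ξ
      rw [dF, ← e4] at e5
      rw [e1, e2, e3, eq_sub_of_add_eq' e5.symm]
      simp only [dF, hG, hp]
      push_cast
      ring
    · have hP2 := hPE t ht
      have hQ2 := hQE t ht
      have hlo := hlow t ht
      have hnorm : ‖((ε ^ n : ℝ) : ℂ)‖ = ε ^ n := by
        rw [Complex.norm_real, Real.norm_of_nonneg he]
      simp only [NNReal.coe_add, NNReal.coe_mul, coe_nnnorm, hnorm]
      exact energy_rate_le he hc C.2 K.2 b.2 D.2 κ.2 M.2 B.2 hP2 hQ2 hlo hw'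

/-! ### Return to the original norms and final assembly -/

lemma two_pi_rpow_half_le : ENNReal.ofReal (2 * Real.pi) ^ (1 / 2 : ℝ) ≤ ENNReal.ofReal 7 := by
  have h : 1 ≤ ENNReal.ofReal (2 * Real.pi) := by
    rw [ENNReal.one_le_ofReal]
    linarith [Real.pi_gt_three]
  calc _ ≤ ENNReal.ofReal (2 * Real.pi) ^ (1 : ℝ) :=
        ENNReal.rpow_le_rpow_of_exponent_le h (by norm_num)
    _ ≤ _ := by
        rw [ENNReal.rpow_one]
        exact ENNReal.ofReal_le_ofReal (by linarith [Real.pi_lt_d2])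

lemma IsAdmissibleKernel.exists_symbol_bound {β : SignedMeasure ℝ} (hβ : IsAdmissibleKernel β) :
    ∃ K : ℝ≥0, 1 ≤ K ∧ ∀ δ ξ : ℝ, |kernelSymbol β (δ * (2 * Real.pi * ξ))| ≤ K := by
  obtain ⟨K, hK1, hK⟩ := hβ.exists_kernelSymbol_le
  refine ⟨⟨K, by linarith⟩, hK1, fun δ ξ => ?_⟩
  rw [abs_of_nonneg (kernelSymbol_nonneg _ _)]
  exact hK _

lemma IsAdmissibleKernel.measurable_symbol {β : SignedMeasure ℝ} (hβ : IsAdmissibleKernel β)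
    (δ : ℝ) : Measurable fun ξ => kernelSymbol β (δ * (2 * Real.pi * ξ)) :=
  hβ.measurable_kernelSymbol.comp (by fun_prop)

lemma exists_errorBound {β : SignedMeasure ℝ} (hβ : IsAdmissibleKernel β) {n : ℕ} (hn : 1 ≤ n)
    {s θ : ℝ} (hs : 5 / 2 < s) (hθ : 0 < θ) (hθ' : θ ≤ 2) (M : ℝ≥0) :
    ∃ e₀ > 0, ∃ C > 0, ∀ {ε δ τ : ℝ} {u₀ v₀ : L2} {uδ vδ u v : ℝ → L2}, 0 < ε → ε ^ n ≤ e₀ →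
      0 < δ → IsNonlocalSolution β n ε δ (s + θ) τ u₀ v₀ uδ vδ →
      IsClassicalSolution n ε (s + θ) τ u₀ v₀ u v →
      (∀ t ∈ Icc 0 τ, sN (s + θ) (FT (uδ t)) ≤ M ∧ sN (s + θ) (FT (vδ t)) ≤ M) →
      (∀ t ∈ Icc 0 τ, sN (s + θ) (FT (u t)) ≤ M ∧ sN (s + θ) (FT (v t)) ≤ M) →
      ErrorBound n ε δ θ (s - 1) τ C uδ vδ u v := by
  obtain ⟨K, -, hK⟩ := hβ.exists_symbol_bound
  obtain ⟨B, hB, hBξ⟩ := hβ.exists_abs_kernelSymbol_sub_one_le hθ hθ'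
  obtain ⟨e₀, he₀, D, hD, h⟩ := exists_difference_bound (r := s - 1) (R := s + θ) (by linarith)
    hθ (by ring) hn M K
  -- 14 is 7 for the Fourier normalization times 2 for the two components; `D` covers the exponent
  -- and 1 gives strict positivity.
  refine ⟨e₀, he₀, 14 * D * B + D + 1, by positivity, ?_⟩
  intro ε δ τ u₀ v₀ uδ vδ u v hε hεe hδ hsol hcl hM hM' t ht
  obtain ⟨u', v', S⟩ := hsol.exists_sol (by linarith)
  obtain ⟨y', z', S'⟩ := hcl.exists_sol (by linarith)
  have hδθ : 0 ≤ δ ^ θ := Real.rpow_nonneg hδ.le θ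
  obtain ⟨κ, hκ'⟩ : ∃ κ : ℝ≥0, (κ : ℝ) = B * δ ^ θ :=
    ⟨(B * δ ^ θ).toNNReal, Real.coe_toNNReal _ (by positivity)⟩
  have hκ : ∀ ξ, |kernelSymbol β (δ * (2 * Real.pi * ξ)) - 1| ≤
      κ * jb ξ ^ θ := fun ξ => by
    refine (hBξ _).trans ?_
    rw [abs_mul, Real.mul_rpow (abs_nonneg _) (abs_nonneg _), abs_of_pos hδ, hκ',
      ← mul_assoc]
    gcongr
    exact abs_two_pi_mul_le_jb ξ
  obtain ⟨h1, h2⟩ := h (hβ.measurable_symbol δ) (hK δ) hκ hε hεe S S'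
    (hsol.1.trans hcl.1.symm) (hsol.2.1.trans hcl.2.1.symm) hM hM' t ht
  rw [eSobolevNorm_eq, eSobolevNorm_eq, ← mul_add]
  refine (mul_le_mul' two_pi_rpow_half_le (add_le_add h1 h2)).trans ?_
  have ht0 := ht.1
  have hε0 : 0 ≤ ε ^ n := by positivity
  rw [hκ', ← ENNReal.ofReal_add (by positivity) (by positivity),
    ← ENNReal.ofReal_mul (by norm_num)]
  refine ENNReal.ofReal_le_ofReal ?_
  have hDB : 0 ≤ D * B := by positivity
  calc _ = 14 * D * B * δ ^ θ * t * Real.exp (D * ε ^ n * t) := by ring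
    _ ≤ _ := by
        gcongr <;> linarith

end NonlocalElasticity

theorem theorem6p2 (β : SignedMeasure ℝ) (hβ : IsAdmissibleKernel β) (n : ℕ) (hn : 1 ≤ n)
    (s θ : ℝ) (hs : 5 / 2 < s) (hθ : 0 < θ) (hθ' : θ ≤ 2)
    (u₀ v₀ : L2) (hu₀ : MemH (s + θ) u₀) (hv₀ : MemH (s + θ) v₀) :
    (∃ T₀ > 0, ∃ ε₀ > 0, ∃ C > 0, ∀ T : ℝ, 0 < T → T ≤ T₀ →
      ∀ ε : ℝ, 0 < ε → ε ≤ ε₀ → ∀ δ : ℝ, 0 < δ →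
      ∀ uδ vδ u v : ℝ → L2,
        IsNonlocalSolution β n ε δ (s + θ) (T / ε ^ n) u₀ v₀ uδ vδ →
        IsClassicalSolution n ε (s + θ) (T / ε ^ n) u₀ v₀ u v →
        ErrorBound n ε δ θ (s - 1) (T / ε ^ n) C uδ vδ u v) ∧
    (∀ T > 0, ∀ M > 0, ∃ ε₀ > 0, ∃ C > 0,
      ∀ ε : ℝ, 0 < ε → ε ≤ ε₀ → ∀ δ : ℝ, 0 < δ →
      ∀ uδ vδ u v : ℝ → L2,
        IsNonlocalSolution β n ε δ (s + θ) (T / ε ^ n) u₀ v₀ uδ vδ →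
        IsClassicalSolution n ε (s + θ) (T / ε ^ n) u₀ v₀ u v →
        BoundedInH (s + θ) (T / ε ^ n) M uδ → BoundedInH (s + θ) (T / ε ^ n) M vδ →
        BoundedInH (s + θ) (T / ε ^ n) M u → BoundedInH (s + θ) (T / ε ^ n) M v →
        ErrorBound n ε δ θ (s - 1) (T / ε ^ n) C uδ vδ u v) := by

  have hR : 5 / 2 < s + θ := by linarith
  -- For `ε ≤ 1` and `n ≥ 1` one has `εⁿ ≤ ε`, which turns thresholds for `εⁿ` into thresholds for
  -- `ε`.
  have hpow : ∀ {ε e₀ : ℝ}, 0 < ε → ε ≤ min 1 e₀ → ε ^ n ≤ e₀ := fun hε h =>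
    (pow_le_of_le_one hε.le (h.trans (min_le_left _ _)) (by omega)).trans
      (h.trans (min_le_right _ _))
  constructor
  · obtain ⟨K, hK1, hK⟩ := hβ.exists_symbol_bound
    obtain ⟨M, T₀, hT₀, e₁, he₁, hM⟩ := exists_uniform_bound hR hn K (u₀ := u₀) (v₀ := v₀)
    obtain ⟨e₂, he₂, C, hC, h⟩ := exists_errorBound hβ hn hs hθ hθ' M
    refine ⟨T₀, hT₀, min 1 (min e₁ e₂), by positivity, C, hC, ?_⟩
    intro T hT hTT ε hε hεe δ hδ uδ vδ u v hsol hcl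
    have hεn := hpow hε hεe
    have hτ : ε ^ n * (T / ε ^ n) ≤ T₀ := by
      rwa [mul_div_cancel₀ T (pow_pos hε n).ne']
    obtain ⟨u', v', S⟩ := hsol.exists_sol (by linarith)
    obtain ⟨y', z', S'⟩ := hcl.exists_sol (by linarith)
    exact h hε (hεn.trans (min_le_right _ _)) hδ hsol hcl
      (hM (hβ.measurable_symbol δ) (hK δ) hε (hεn.trans (min_le_left _ _)) hτ S hsol.1 hsol.2.1)
      -- Since `1 ≤ K`, the same uniform bound covers the classical system, whose symbol is 1.
      (hM measurable_const (fun _ => by rw [abs_one]; exact_mod_cast hK1) hε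
        (hεn.trans (min_le_left _ _)) hτ S' hcl.1 hcl.2.1)
  · intro T hT M hM
    -- Once the solutions are bounded by `M`, the constants obtained do not involve `T`.
    obtain ⟨e₀, he₀, C, hC, h⟩ := exists_errorBound hβ hn hs hθ hθ' M.toNNReal
    refine ⟨min 1 e₀, by positivity, C, hC, ?_⟩
    intro ε hε hεe δ hδ uδ vδ u v hsol hcl h1 h2 h3 h4
    exact h hε (hpow hε hεe) hδ hsol hcl
      (fun t ht => ⟨(sN_le_eSobolevNorm _ _).trans (h1 t ht),
        (sN_le_eSobolevNorm _ _).trans (h2 t ht)⟩)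
      (fun t ht => ⟨(sN_le_eSobolevNorm _ _).trans (h3 t ht),
        (sN_le_eSobolevNorm _ _).trans (h4 t ht)⟩)
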